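/- Let $0<\alpha<1$ and $$\mathcal D^\alpha[g](x)=\frac1{\Gamma(1-\alpha)}\int_{-\infty}^x\frac{g'(y)}{(x-y)^\alpha}\,dy .$$ Let $\phi_-,\phi_+\in\mathbb R$ satisfy $\phi_+<\phi_c<\phi_-$, where $\phi_c:=-(\phi_-+\phi_+)$, and $\phi_-+\phi_+>0$. Put $c=\phi_+^2+\phi_-^2+\phi_-\phi_+$ and $h(u)=-c(u-\phi_-)+u^3-\phi_-^3$. For $\tau>0$, let $\phi_\tau$ denote the solution (unique up to a shift in $\xi$), continued to its maximal interval of existence $(-\infty,b)$, $b\in\mathbb R\cup\{+\infty\}$, of $$\tau\phi''+\mathcal D^\alpha[\phi]=h(\phi),\qquad \lim_{\xi\to-\infty}\phi(\xi)=\phi_-,$$ that is of class $C^3$ and that on some half-line $(-\infty,\xi_0)$, $\xi_0<b$, satisfies $\phi'<0$ and $\phi\in\phi_-+H^2(-\infty,\xi_0)\cap C^3_b(-\infty,\xi_0)$. Let $\Sigma_u$ be the set of all $\tau>0$ such that $\phi_\tau$ exists and blows down at a finite point, that is, $\lim_{\xi\to(\xi^*)^-}\phi_\tau(\xi)=-\infty$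 for some $\xi^*\in\mathbb R$, the right end point of the interval of existence. Then there is $\tau_m>0$ such that for every $\tau>\tau_m$ the solution $\phi_\tau$ exists and blows down to $-\infty$ at a finite point $\xi^*_\tau\in\mathbb R$. Moreover, $\Sigma_u$ is open in $(0,\infty)$. -/

import Mathlib

open Set Filter Topology MeasureTheory

namespace NonlocalTW

/-- The open half-line `(-∞, b)` of real numbers, with `b` real or `±∞`. -/
def leftRay (b : EReal) : Set ℝ := {x : ℝ | (x : EReal) < b}

/-- The non-local operator
`D^α[g](x) = (1 / Γ(1-α)) ∫_{-∞}^x g'(y) / (x-y)^α dy`. -/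
noncomputable def fracDeriv (α : ℝ) (g : ℝ → ℝ) (x : ℝ) : ℝ :=
  (1 / Real.Gamma (1 - α)) * ∫ y in Iio x, deriv g y / (x - y) ^ α

/-- The wave speed given by the Rankine-Hugoniot condition,
`c = (φ₊³ - φ₋³) / (φ₊ - φ₋) = φ₊² + φ₋² + φ₋ φ₊`. -/
def waveSpeed (φm φp : ℝ) : ℝ := φp ^ 2 + φm ^ 2 + φm * φp

/-- The non-linearity `h(u) = -c (u - φ₋) + u³ - φ₋³`. -/
def h (φm φp u : ℝ) : ℝ := -waveSpeed φm φp * (u - φm) + u ^ 3 - φm ^ 3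

/-- `φ` is a `C³` solution on `(-∞, b)` of the travelling wave equation
`τ φ'' + D^α[φ] = h(φ)`; the integral that defines `D^α[φ]` is required to converge. -/
structure IsSolutionOn (α φm φp τ : ℝ) (b : EReal) (φ : ℝ → ℝ) : Prop where
  contDiffOn : ContDiffOn ℝ 3 φ (leftRay b)
  integrable : ∀ ξ ∈ leftRay b, IntegrableOn (fun y => deriv φ y / (ξ - y) ^ α) (Iio ξ)
  equation : ∀ ξ ∈ leftRay b,
    τ * iteratedDeriv 2 φ ξ + fracDeriv α φ ξ = h φm φp (φ ξ)

/-- `φ ∈ φ₋ + H²(-∞, ξ₀) ∩ C³_b(-∞, ξ₀)`, for a function `φ` that is already known to be `C³` on a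
neighbourhood of `(-∞, ξ₀]`, so that its weak derivatives are the classical ones. -/
def InClassNearMinusInfty (φm : ℝ) (φ : ℝ → ℝ) (ξ₀ : ℝ) : Prop :=
  MemLp (fun ξ => φ ξ - φm) 2 (volume.restrict (Iio ξ₀)) ∧
  (∀ k : ℕ, 1 ≤ k → k ≤ 2 → MemLp (iteratedDeriv k φ) 2 (volume.restrict (Iio ξ₀))) ∧
  (∀ k : ℕ, k ≤ 3 → ∃ C : ℝ, ∀ ξ < ξ₀, |iteratedDeriv k φ ξ| ≤ C)

/-- `φ` on `(-∞, b)` is a trajectory leaving `φ₋`: a solution of the travelling wave equation with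
`φ(ξ) → φ₋` as `ξ → -∞` which, on some half-line `(-∞, ξ₀)`, is strictly decreasing with `φ' < 0`
and lies in `φ₋ + H² ∩ C³_b`, and for which `(-∞, b)` is the maximal interval of existence.
The values of `φ` outside `(-∞, b)` play no role. -/
structure IsTrajectory (α φm φp τ : ℝ) (b : EReal) (φ : ℝ → ℝ) : Prop where
  solution : IsSolutionOn α φm φp τ b φ
  farField : Tendsto φ atBot (𝓝 φm)
  nearMinusInfty : ∃ ξ₀ ∈ leftRay b,
    (∀ ξ < ξ₀, deriv φ ξ < 0) ∧ InClassNearMinusInfty φm φ ξ₀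
  maximal : ∀ (b' : EReal) (ψ : ℝ → ℝ), b < b' →
    IsSolutionOn α φm φp τ b' ψ → ¬ EqOn ψ φ (leftRay b)

/-- `φ`, with interval of existence `(-∞, b)`, blows down to `-∞` at a finite point: `b` is a real
number `ξ*`, and `φ(ξ) → -∞` as `ξ → ξ*` from the left. -/
def BlowsDown (b : EReal) (φ : ℝ → ℝ) : Prop :=
  ∃ ξs : ℝ, b = (ξs : EReal) ∧ Tendsto φ (𝓝[<] ξs) atBot

/-- The set of all `τ > 0` for which the trajectory leaving `φ₋` blows down at a finite point: there
is such a trajectory, and it (that is, each of its translates) blows down. -/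
def sigmaU (α φm φp : ℝ) : Set ℝ :=
  {τ : ℝ | 0 < τ ∧
    (∃ (b : EReal) (φ : ℝ → ℝ), IsTrajectory α φm φp τ b φ) ∧
    ∀ (b : EReal) (φ : ℝ → ℝ), IsTrajectory α φm φp τ b φ → BlowsDown b φ}

end NonlocalTW

namespace NonlocalTW

/-! Write `a = h'(φm)`, which is positive here. Linearising at `φm`, an exponential `e^{rξ}` solves
the equation exactly when `τ r² + r^α = a`; let `r > 0` be the root. Rescaling by `ξ = x / r` gives
`A v'' + B D^α[v] = h(v)` with `B = r^α` and `A = a - B`, so the growth rate at `-∞` is always `1`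
and the only parameter left is `B ∈ (0, a)`. Large `τ` corresponds to `B → 0`, where the equation
becomes the local equation `a v'' = h(v)`.

Existence: with the cubic truncated outside `[-N, N]` the nonlinearity is Lipschitz. A solution is
sought as `φm - e^x +` a polynomial in `e^x` + a remainder of order `e^{(K+1)x}`. The coefficients
follow recursively because no exponent `k ≥ 2` is resonant, and the remainder is a fixed point in a
weighted space, where integration gains inverse powers of the weight rate
(`exists_weighted_solution`). This yields global solutions depending continuously on `B ∈ [0, b]`
for `b < a` (`exists_base_family`).

Uniqueness: any trajectory in the stated class must be a translate of this one. For two trajectories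
shifted to agree at `0`, an energy identity for the difference is combined with coercivity of the
kernel `z^{-α}`, which is a positive superposition of decaying exponentials
(`weighted_le_kernel_energy`, `exists_eqOn_of_smallTail`). The tails needed for this are made small
by an a priori integrability estimate at `-∞` (`exists_tail_bound`).

Blow-down: at a point where the solution is very negative and its modulus is a record, interpolation
bounds the non-local term by a power of the modulus below three, so the cubic wins
(`exists_record_bound`). From there on the solution keeps decreasing and obeys `τ φ'' ≤ φ³ / 4`,
which cannot last for all `ξ` (`not_global_of_cubic`). A bounded trajectory always continues past a
finite end point, so it must tend to `-∞`.

Conclusion: reaching a record of large size is an open condition on the base solution, called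
`Escapes`, and is equivalent to blow-down once the constants are chosen uniformly for `τ` near its
reference value. Openness of `sigmaU` follows. For large `τ` the same openness is used at `B = 0`,
where conservation of energy shows that the local trajectory crosses every level below `φm`
(`ode_escape`). -/

/-! ### The fractional integral: exponential bounds, translation, scaling, regularity. -/

/-- The fractional integral of order `1 - α` with base point `-∞`. -/
noncomputable def fracInt (α : ℝ) (g : ℝ → ℝ) (x : ℝ) : ℝ :=
  (1 / Real.Gamma (1 - α)) * ∫ y in Iio x, g y / (x - y) ^ α

theorem fracDeriv_eq_fracInt (α : ℝ) (g : ℝ → ℝ) (x : ℝ) :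
    fracDeriv α g x = fracInt α (deriv g) x := rfl

theorem setIntegral_Iio_eq_Ioi (f : ℝ → ℝ) (x : ℝ) :
    ∫ y in Iio x, f y = ∫ z in Ioi (0 : ℝ), f (x - z) := by
  have h := (Measure.measurePreserving_sub_left volume x).setIntegral_preimage_emb
    (MeasurableEquiv.subLeft x).measurableEmbedding f (Iio x)
  rw [← h]
  congr 2
  ext z
  simp

theorem integrableOn_Iio_iff_Ioi (f : ℝ → ℝ) (x : ℝ) :
    IntegrableOn f (Iio x) ↔ IntegrableOn (fun z => f (x - z)) (Ioi (0 : ℝ)) := by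
  have h := (Measure.measurePreserving_sub_left volume x).integrableOn_comp_preimage
    (MeasurableEquiv.subLeft x).measurableEmbedding (f := f) (s := Iio x)
  rw [← h]
  have : (fun z => x - z) ⁻¹' Iio x = Ioi (0 : ℝ) := by
    ext z
    simp
  rw [this]
  rfl

theorem div_rpow_eq_mul_rpow_neg {α : ℝ} (g : ℝ → ℝ) (x : ℝ) {z : ℝ} (hz : z ∈ Ioi (0 : ℝ)) :
    g (x - z) / (x - (x - z)) ^ α = g (x - z) * z ^ (-α) := by
  rw [sub_sub_cancel, Real.rpow_neg (le_of_lt hz), div_eq_mul_inv]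

theorem fracInt_eq_Ioi (α : ℝ) (g : ℝ → ℝ) (x : ℝ) :
    fracInt α g x = (1 / Real.Gamma (1 - α)) * ∫ z in Ioi (0 : ℝ), g (x - z) * z ^ (-α) := by
  rw [fracInt, setIntegral_Iio_eq_Ioi]
  congr 1
  exact setIntegral_congr_fun measurableSet_Ioi fun z hz => div_rpow_eq_mul_rpow_neg g x hz

theorem integrableOn_kernel_iff (α : ℝ) (g : ℝ → ℝ) (x : ℝ) :
    IntegrableOn (fun y => g y / (x - y) ^ α) (Iio x) ↔
      IntegrableOn (fun z => g (x - z) * z ^ (-α)) (Ioi (0 : ℝ)) := by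
  rw [integrableOn_Iio_iff_Ioi]
  exact integrableOn_congr_fun (fun z hz => div_rpow_eq_mul_rpow_neg g x hz) measurableSet_Ioi

theorem integrableOn_exp_mul_rpow {α μ : ℝ} (hα1 : α < 1) (hμ : 0 < μ) :
    IntegrableOn (fun z => Real.exp (-(μ * z)) * z ^ (-α)) (Ioi (0 : ℝ)) := by
  have := integrableOn_rpow_mul_exp_neg_mul_rpow (p := 1) (s := -α) (b := μ) (by linarith)
    one_pos hμ
  refine this.congr_fun (fun z _ => ?_) measurableSet_Ioi
  simp only [Real.rpow_one]
  rw [mul_comm, neg_mul]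

theorem integral_exp_mul_rpow {α μ : ℝ} (hα1 : α < 1) (hμ : 0 < μ) :
    ∫ z in Ioi (0 : ℝ), Real.exp (-(μ * z)) * z ^ (-α) = Real.Gamma (1 - α) * μ ^ (α - 1) := by
  have := Real.integral_rpow_mul_exp_neg_mul_Ioi (a := 1 - α) (r := μ) (by linarith) hμ
  rw [show (1 - α - 1) = -α by ring] at this
  simp_rw [mul_comm (Real.exp _)]
  rw [this, mul_comm, one_div, Real.inv_rpow hμ.le, ← Real.rpow_neg hμ.le, neg_sub]

theorem exp_sub_mul (μ x z : ℝ) :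
    Real.exp (μ * (x - z)) = Real.exp (μ * x) * Real.exp (-(μ * z)) := by
  rw [← Real.exp_add]; ring_nf

theorem integrableOn_kernel_of_exp_bound {α μ C x : ℝ} {g : ℝ → ℝ} (hα1 : α < 1) (hμ : 0 < μ)
    (hg : ContinuousOn g (Iio x)) (hb : ∀ y < x, |g y| ≤ C * Real.exp (μ * y)) :
    IntegrableOn (fun z => g (x - z) * z ^ (-α)) (Ioi (0 : ℝ)) := by
  refine Integrable.mono' ((integrableOn_exp_mul_rpow hα1 hμ).const_mul (C * Real.exp (μ * x)))
    ?_ ?_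
  · refine ContinuousOn.aestronglyMeasurable ?_ measurableSet_Ioi
    refine ContinuousOn.mul (hg.comp (by fun_prop) fun z hz => ?_) ?_
    · have : 0 < z := hz
      simp only [mem_Iio]
      linarith
    · exact continuousOn_id.rpow_const fun z hz => Or.inl (ne_of_gt hz)
  · refine (ae_restrict_iff' measurableSet_Ioi).2 (Eventually.of_forall fun z hz => ?_)
    have hz' : 0 < z := hz
    have h0 : 0 < z ^ (-α) := Real.rpow_pos_of_pos hz' _
    have := hb (x - z) (by linarith)
    rw [exp_sub_mul] at this
    rw [Real.norm_eq_abs, abs_mul, abs_of_pos h0]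
    calc |g (x - z)| * z ^ (-α) ≤ C * (Real.exp (μ * x) * Real.exp (-(μ * z))) * z ^ (-α) := by
          gcongr
      _ = _ := by ring

theorem abs_fracInt_le_of_exp_bound {α μ C x : ℝ} {g : ℝ → ℝ} (hα1 : α < 1) (hμ : 0 < μ)
    (hb : ∀ y < x, |g y| ≤ C * Real.exp (μ * y)) :
    |fracInt α g x| ≤ C * μ ^ (α - 1) * Real.exp (μ * x) := by
  have hΓ : 0 < Real.Gamma (1 - α) := Real.Gamma_pos_of_pos (by linarith)
  rw [fracInt_eq_Ioi, abs_mul, abs_of_pos (by positivity : 0 < 1 / Real.Gamma (1 - α))]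
  have h1 : |∫ z in Ioi (0 : ℝ), g (x - z) * z ^ (-α)| ≤
      ∫ z in Ioi (0 : ℝ), C * Real.exp (μ * x) * (Real.exp (-(μ * z)) * z ^ (-α)) := by
    rw [← Real.norm_eq_abs]
    refine norm_integral_le_of_norm_le
      ((integrableOn_exp_mul_rpow hα1 hμ).const_mul _) ?_
    refine (ae_restrict_iff' measurableSet_Ioi).2 (Eventually.of_forall fun z hz => ?_)
    have hz' : 0 < z := hz
    have h0 : 0 < z ^ (-α) := Real.rpow_pos_of_pos hz' _
    have := hb (x - z) (by linarith)
    rw [exp_sub_mul] at this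
    rw [Real.norm_eq_abs, abs_mul, abs_of_pos h0]
    calc |g (x - z)| * z ^ (-α) ≤ C * (Real.exp (μ * x) * Real.exp (-(μ * z))) * z ^ (-α) := by
          gcongr
      _ = _ := by ring
  rw [integral_const_mul, integral_exp_mul_rpow hα1 hμ] at h1
  calc _ ≤ 1 / Real.Gamma (1 - α) *
        (C * Real.exp (μ * x) * (Real.Gamma (1 - α) * μ ^ (α - 1))) := by gcongr
    _ = _ := by field_simp

/-- Exponentials are eigenfunctions, the eigenvalue being a Gamma integral. This is why an expansion
in powers of `e^x` turns the equation into algebra. -/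
theorem fracInt_exp {α μ : ℝ} (hα1 : α < 1) (hμ : 0 < μ) (x : ℝ) :
    fracInt α (fun y => Real.exp (μ * y)) x = μ ^ (α - 1) * Real.exp (μ * x) := by
  have hΓ : 0 < Real.Gamma (1 - α) := Real.Gamma_pos_of_pos (by linarith)
  rw [fracInt_eq_Ioi]
  simp_rw [exp_sub_mul, mul_assoc]
  rw [integral_const_mul, integral_exp_mul_rpow hα1 hμ]
  field_simp

theorem fracInt_const_mul (α c : ℝ) (g : ℝ → ℝ) (x : ℝ) :
    fracInt α (fun y => c * g y) x = c * fracInt α g x := by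
  simp only [fracInt_eq_Ioi, mul_assoc, integral_const_mul]
  ring

theorem fracInt_add {α x : ℝ} {f g : ℝ → ℝ}
    (hf : IntegrableOn (fun y => f y / (x - y) ^ α) (Iio x))
    (hg : IntegrableOn (fun y => g y / (x - y) ^ α) (Iio x)) :
    fracInt α (fun y => f y + g y) x = fracInt α f x + fracInt α g x := by
  simp only [fracInt, add_div]
  rw [integral_add hf hg, mul_add]

theorem fracInt_sub {α x : ℝ} {f g : ℝ → ℝ}
    (hf : IntegrableOn (fun y => f y / (x - y) ^ α) (Iio x))
    (hg : IntegrableOn (fun y => g y / (x - y) ^ α) (Iio x)) :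
    fracInt α (fun y => f y - g y) x = fracInt α f x - fracInt α g x := by
  simp only [fracInt, sub_div]
  rw [integral_sub hf hg, mul_sub]

theorem fracInt_congr {α x : ℝ} {f g : ℝ → ℝ} (h : EqOn f g (Iio x)) :
    fracInt α f x = fracInt α g x := by
  rw [fracInt, fracInt]
  congr 1
  exact setIntegral_congr_fun measurableSet_Iio fun y hy => by simp only [h hy]

theorem integrableOn_kernel_congr {α x : ℝ} {f g : ℝ → ℝ} (h : EqOn f g (Iio x))
    (hf : IntegrableOn (fun y => f y / (x - y) ^ α) (Iio x)) :
    IntegrableOn (fun y => g y / (x - y) ^ α) (Iio x) :=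
  hf.congr_fun (fun y hy => by simp only [h hy]) measurableSet_Iio

theorem fracInt_comp_add (α s : ℝ) (g : ℝ → ℝ) (x : ℝ) :
    fracInt α (fun y => g (y + s)) x = fracInt α g (x + s) := by
  simp only [fracInt_eq_Ioi]
  congr 2
  ext z
  rw [sub_add_eq_add_sub]

theorem integrableOn_kernel_comp_add {α s x : ℝ} {g : ℝ → ℝ}
    (h : IntegrableOn (fun y => g y / (x + s - y) ^ α) (Iio (x + s))) :
    IntegrableOn (fun y => g (y + s) / (x - y) ^ α) (Iio x) := by
  have h := (integrableOn_kernel_iff α g (x + s)).1 h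
  refine (integrableOn_kernel_iff α (fun y => g (y + s)) x).2 ?_
  simpa only [sub_add_eq_add_sub] using h

theorem integrableOn_kernel_comp_div {α l x : ℝ} {g : ℝ → ℝ} (hl : 0 < l)
    (h : IntegrableOn (fun y => g y / (x / l - y) ^ α) (Iio (x / l))) :
    IntegrableOn (fun y => g (y / l) / (x - y) ^ α) (Iio x) := by
  have h := (integrableOn_kernel_iff α g (x / l)).1 h
  refine (integrableOn_kernel_iff α (fun y => g (y / l)) x).2 ?_
  have h2 := (integrableOn_Ioi_comp_mul_left_iff
    (fun z => g (x / l - z) * z ^ (-α)) 0 (inv_pos.2 hl)).2 (by simpa using h)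
  have h3 := h2.const_mul (l ^ (-α))
  refine IntegrableOn.congr_fun h3 (fun z hz => ?_) measurableSet_Ioi
  have hz' : 0 < z := hz
  rw [Real.mul_rpow (inv_pos.2 hl).le hz'.le, Real.inv_rpow hl.le]
  have : l ^ (-α) ≠ 0 := (Real.rpow_pos_of_pos hl _).ne'
  rw [show x / l - l⁻¹ * z = (x - z) / l by field_simp]
  field_simp

theorem fracInt_comp_div {α l : ℝ} (g : ℝ → ℝ) (x : ℝ) (hl : 0 < l) :
    fracInt α (fun y => g (y / l)) x = l ^ (1 - α) * fracInt α g (x / l) := by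
  simp only [fracInt_eq_Ioi]
  have h2 := integral_comp_mul_left_Ioi (fun z => g (x / l - z) * z ^ (-α)) 0 (inv_pos.2 hl)
  simp only [mul_zero, inv_inv, smul_eq_mul] at h2
  have h3 : ∫ z in Ioi (0 : ℝ), g ((x - z) / l) * z ^ (-α) =
      l ^ (-α) * ∫ z in Ioi (0 : ℝ), g (x / l - l⁻¹ * z) * (l⁻¹ * z) ^ (-α) := by
    rw [← integral_const_mul]
    refine setIntegral_congr_fun measurableSet_Ioi fun z hz => ?_
    have hz' : 0 < z := hz
    rw [Real.mul_rpow (inv_pos.2 hl).le hz'.le, Real.inv_rpow hl.le]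
    have : l ^ (-α) ≠ 0 := (Real.rpow_pos_of_pos hl _).ne'
    rw [show x / l - l⁻¹ * z = (x - z) / l by field_simp]
    field_simp
  rw [h3, h2, show (1 - α) = -α + 1 by ring, Real.rpow_add hl, Real.rpow_one]
  ring

theorem continuousAt_fracInt {α μ C T x : ℝ} {g : ℝ → ℝ} (hα1 : α < 1) (hμ : 0 < μ)
    (hg : ContinuousOn g (Iio T)) (hb : ∀ y < T, |g y| ≤ C * Real.exp (μ * y)) (hx : x < T) :
    ContinuousAt (fracInt α g) x := by
  have : fracInt α g = fun x => (1 / Real.Gamma (1 - α)) *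
      ∫ z in Ioi (0 : ℝ), g (x - z) * z ^ (-α) := funext fun x => fracInt_eq_Ioi α g x
  rw [this]
  refine ContinuousAt.mul continuousAt_const ?_
  have hC : 0 ≤ C := by
    have := (abs_nonneg _).trans (hb x hx)
    exact nonneg_of_mul_nonneg_left this (Real.exp_pos _)
  refine continuousAt_of_dominated (bound := fun z => C * Real.exp (μ * T) *
    (Real.exp (-(μ * z)) * z ^ (-α))) ?_ ?_ ?_ ?_
  · filter_upwards [Iio_mem_nhds hx] with y hy
    exact (integrableOn_kernel_of_exp_bound hα1 hμ (hg.mono (Iio_subset_Iio (le_of_lt hy)))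
      fun w hw => hb w (hw.trans hy)).aestronglyMeasurable
  · filter_upwards [Iio_mem_nhds hx] with y hy
    refine (ae_restrict_iff' measurableSet_Ioi).2 (Eventually.of_forall fun z hz => ?_)
    have hz' : 0 < z := hz
    have hy' : y < T := hy
    have h0 : 0 < z ^ (-α) := Real.rpow_pos_of_pos hz' _
    have := hb (y - z) (by linarith)
    rw [exp_sub_mul] at this
    rw [Real.norm_eq_abs, abs_mul, abs_of_pos h0]
    calc |g (y - z)| * z ^ (-α) ≤ C * (Real.exp (μ * y) * Real.exp (-(μ * z))) * z ^ (-α) := by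
          gcongr
      _ ≤ C * (Real.exp (μ * T) * Real.exp (-(μ * z))) * z ^ (-α) := by gcongr
      _ = _ := by ring
  · exact (integrableOn_exp_mul_rpow hα1 hμ).const_mul _
  · refine (ae_restrict_iff' measurableSet_Ioi).2 (Eventually.of_forall fun z hz => ?_)
    have hz' : 0 < z := hz
    refine ContinuousAt.mul ?_ continuousAt_const
    have : ContinuousAt g (x - z) := hg.continuousAt (Iio_mem_nhds (by linarith))
    exact ContinuousAt.comp (f := fun x => x - z) (g := g) this (by fun_prop)

/-- After the substitution `y = x - z` the singularity sits at `z = 0` independently of `x`, so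
differentiation falls on `g` alone and the exponential bound supplies the dominating function. -/
theorem hasDerivAt_fracInt {α μ C T x : ℝ} {g g' : ℝ → ℝ} (hα1 : α < 1) (hμ : 0 < μ)
    (hg : ∀ y < T, HasDerivAt g (g' y) y) (hg' : ContinuousOn g' (Iio T))
    (hb : ∀ y < T, |g y| ≤ C * Real.exp (μ * y)) (hb' : ∀ y < T, |g' y| ≤ C * Real.exp (μ * y))
    (hx : x < T) :
    HasDerivAt (fracInt α g) (fracInt α g' x) x := by
  have : fracInt α g = fun x => (1 / Real.Gamma (1 - α)) *
      ∫ z in Ioi (0 : ℝ), g (x - z) * z ^ (-α) := funext fun x => fracInt_eq_Ioi α g x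
  rw [this, fracInt_eq_Ioi]
  refine HasDerivAt.const_mul _ ?_
  have hC : 0 ≤ C := by
    have := (abs_nonneg _).trans (hb x hx)
    exact nonneg_of_mul_nonneg_left this (Real.exp_pos _)
  have hgc : ContinuousOn g (Iio T) := fun y hy => (hg y hy).continuousAt.continuousWithinAt
  refine (hasDerivAt_integral_of_dominated_loc_of_deriv_le (s := Iio T)
    (F := fun x z => g (x - z) * z ^ (-α)) (F' := fun x z => g' (x - z) * z ^ (-α))
    (bound := fun z => C * Real.exp (μ * T) * (Real.exp (-(μ * z)) * z ^ (-α)))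
    (Iio_mem_nhds hx) ?_ ?_ ?_ ?_ ?_ ?_).2
  · filter_upwards [Iio_mem_nhds hx] with y hy
    exact (integrableOn_kernel_of_exp_bound hα1 hμ (hgc.mono (Iio_subset_Iio (le_of_lt hy)))
      fun w hw => hb w (hw.trans hy)).aestronglyMeasurable
  · exact integrableOn_kernel_of_exp_bound hα1 hμ (hgc.mono (Iio_subset_Iio (le_of_lt hx)))
      fun w hw => hb w (hw.trans hx)
  · exact (integrableOn_kernel_of_exp_bound hα1 hμ (hg'.mono (Iio_subset_Iio (le_of_lt hx)))
      fun w hw => hb' w (hw.trans hx)).aestronglyMeasurable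
  · refine (ae_restrict_iff' measurableSet_Ioi).2 (Eventually.of_forall fun z hz y hy => ?_)
    have hz' : 0 < z := hz
    have hy' : y < T := hy
    have h0 : 0 < z ^ (-α) := Real.rpow_pos_of_pos hz' _
    have := hb' (y - z) (by linarith)
    rw [exp_sub_mul] at this
    rw [Real.norm_eq_abs, abs_mul, abs_of_pos h0]
    calc |g' (y - z)| * z ^ (-α) ≤ C * (Real.exp (μ * y) * Real.exp (-(μ * z))) * z ^ (-α) := by
          gcongr
      _ ≤ C * (Real.exp (μ * T) * Real.exp (-(μ * z))) * z ^ (-α) := by gcongr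
      _ = _ := by ring
  · exact (integrableOn_exp_mul_rpow hα1 hμ).const_mul _
  · refine (ae_restrict_iff' measurableSet_Ioi).2 (Eventually.of_forall fun z hz y hy => ?_)
    have hz' : 0 < z := hz
    have hy' : y < T := hy
    refine HasDerivAt.mul_const ?_ _
    exact (hg (y - z) (by linarith)).comp_sub_const y z

/-! ### Half-line solutions with general coefficients, and forward uniqueness. -/

/-- `u` is a `C²` solution on `(-∞, T)` of `A u'' + B D^α[u] = H(u)`. -/
structure GenSol (α A B : ℝ) (H : ℝ → ℝ) (T : ℝ) (u : ℝ → ℝ) : Prop where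
  contDiffOn : ContDiffOn ℝ 2 u (Iio T)
  integrable : ∀ x < T, IntegrableOn (fun y => deriv u y / (x - y) ^ α) (Iio x)
  equation : ∀ x < T, A * deriv (deriv u) x + B * fracInt α (deriv u) x = H (u x)

theorem contDiffOn_two_iff {T : ℝ} {u : ℝ → ℝ} :
    ContDiffOn ℝ 2 u (Iio T) ↔ DifferentiableOn ℝ u (Iio T) ∧
      DifferentiableOn ℝ (deriv u) (Iio T) ∧ ContinuousOn (deriv (deriv u)) (Iio T) := by
  rw [show (2 : WithTop ℕ∞) = 1 + 1 by norm_num, contDiffOn_succ_iff_deriv_of_isOpen isOpen_Iio,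
    show (1 : WithTop ℕ∞) = 0 + 1 by norm_num, contDiffOn_succ_iff_deriv_of_isOpen isOpen_Iio,
    contDiffOn_zero]
  simp

section

variable {α A B T : ℝ} {H : ℝ → ℝ} {u v : ℝ → ℝ}

theorem GenSol.hasDerivAt (hu : GenSol α A B H T u) {x : ℝ} (hx : x < T) :
    HasDerivAt u (deriv u x) x :=
  ((contDiffOn_two_iff.1 hu.contDiffOn).1.differentiableAt (Iio_mem_nhds hx)).hasDerivAt

theorem GenSol.hasDerivAt_deriv (hu : GenSol α A B H T u) {x : ℝ} (hx : x < T) :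
    HasDerivAt (deriv u) (deriv (deriv u) x) x :=
  ((contDiffOn_two_iff.1 hu.contDiffOn).2.1.differentiableAt (Iio_mem_nhds hx)).hasDerivAt

theorem GenSol.continuousOn_deriv2 (hu : GenSol α A B H T u) :
    ContinuousOn (deriv (deriv u)) (Iio T) :=
  (contDiffOn_two_iff.1 hu.contDiffOn).2.2

theorem GenSol.continuousOn_deriv (hu : GenSol α A B H T u) :
    ContinuousOn (deriv u) (Iio T) :=
  (contDiffOn_two_iff.1 hu.contDiffOn).2.1.continuousOn

theorem GenSol.continuousOn (hu : GenSol α A B H T u) : ContinuousOn u (Iio T) :=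
  hu.contDiffOn.continuousOn

theorem GenSol.mono (hu : GenSol α A B H T u) {T' : ℝ} (h : T' ≤ T) : GenSol α A B H T' u :=
  ⟨hu.contDiffOn.mono (Iio_subset_Iio h), fun x hx => hu.integrable x (hx.trans_le h),
    fun x hx => hu.equation x (hx.trans_le h)⟩

theorem eqOn_deriv_of_eqOn {u v : ℝ → ℝ} {T : ℝ} (h : EqOn u v (Iio T)) :
    EqOn (deriv u) (deriv v) (Iio T) := fun x hx => by
  have : u =ᶠ[𝓝 x] v := by
    filter_upwards [Iio_mem_nhds hx] with y hy using h hy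
  exact this.deriv_eq

theorem GenSol.congr (hu : GenSol α A B H T u) (h : EqOn v u (Iio T)) : GenSol α A B H T v := by
  have h1 := eqOn_deriv_of_eqOn h
  have h2 := eqOn_deriv_of_eqOn h1
  refine ⟨hu.contDiffOn.congr h, fun x hx => ?_, fun x hx => ?_⟩
  · exact integrableOn_kernel_congr (fun y hy => (h1 (lt_trans hy hx)).symm) (hu.integrable x hx)
  · rw [h2 hx, h hx, fracInt_congr fun y hy => h1 (lt_trans hy hx)]
    exact hu.equation x hx

theorem GenSol.congr_fun (hu : GenSol α A B H T u) {H' : ℝ → ℝ} (h : ∀ x < T, H' (u x) = H (u x)) :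
    GenSol α A B H' T u :=
  ⟨hu.contDiffOn, hu.integrable, fun x hx => by rw [hu.equation x hx, h x hx]⟩

theorem GenSol.comp_add (hu : GenSol α A B H T u) (s : ℝ) :
    GenSol α A B H (T - s) (fun x => u (x + s)) := by
  have h1 : deriv (fun x => u (x + s)) = fun x => deriv u (x + s) :=
    funext fun x => deriv_comp_add_const u s x
  have h2 : deriv (fun x => deriv u (x + s)) = fun x => deriv (deriv u) (x + s) :=
    funext fun x => deriv_comp_add_const (deriv u) s x
  refine ⟨hu.contDiffOn.comp (by fun_prop) fun x hx => ?_, fun x hx => ?_, fun x hx => ?_⟩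
  · simp only [mem_Iio] at hx ⊢; linarith
  · rw [h1]
    exact integrableOn_kernel_comp_add (hu.integrable (x + s) (by linarith))
  · rw [h1, h2, fracInt_comp_add]
    exact hu.equation (x + s) (by linarith)

theorem deriv_comp_div (u : ℝ → ℝ) (l : ℝ) :
    deriv (fun x => u (x / l)) = fun x => l⁻¹ * deriv u (x / l) := by
  funext x
  have := deriv_comp_mul_left l⁻¹ u x
  simp only [smul_eq_mul] at this
  simpa only [div_eq_inv_mul] using this

/-- Under `x ↦ x / l` the fractional integral contributes `l^{1-α}` and the inner derivative `l⁻¹`,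
so `D^α` scales like `l^{-α}`. This trades the coefficients `(τ, 1)` for a normalised pair. -/
theorem GenSol.comp_div (hu : GenSol α A B H T u) {l : ℝ} (hl : 0 < l) :
    GenSol α (A * l ^ 2) (B * l ^ α) H (T * l) (fun x => u (x / l)) := by
  have h1 := deriv_comp_div u l
  have h2 : deriv (fun x => l⁻¹ * deriv u (x / l)) =
      fun x => l⁻¹ * (l⁻¹ * deriv (deriv u) (x / l)) := by
    funext x
    rw [deriv_const_mul_field, deriv_comp_div]
  refine ⟨hu.contDiffOn.comp (by fun_prop) fun x hx => ?_, fun x hx => ?_, fun x hx => ?_⟩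
  · simp only [mem_Iio] at hx ⊢; exact (div_lt_iff₀ hl).2 hx
  · rw [h1]
    have := integrableOn_kernel_comp_div hl (hu.integrable (x / l) ((div_lt_iff₀ hl).2 hx))
    simpa only [mul_div_assoc, IntegrableOn] using this.const_mul l⁻¹
  · rw [h1, h2, fracInt_const_mul, fracInt_comp_div _ _ hl,
      ← hu.equation (x / l) ((div_lt_iff₀ hl).2 hx), Real.rpow_sub hl, Real.rpow_one]
    have : l ^ α ≠ 0 := (Real.rpow_pos_of_pos hl _).ne'
    field_simp

end

theorem abs_le_exp_of_abs_deriv_le {f f' : ℝ → ℝ} {a b s μ : ℝ} (hμ : 0 < μ) (hs : 0 ≤ s)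
    (hf : ∀ x ∈ Icc a b, HasDerivAt f (f' x) x) (ha : f a = 0)
    (hb : ∀ x ∈ Icc a b, |f' x| ≤ s * Real.exp (μ * x)) :
    ∀ x ∈ Icc a b, |f x| ≤ s / μ * Real.exp (μ * x) := by
  have hB : ∀ x, HasDerivAt (fun x => s / μ * Real.exp (μ * x)) (s * Real.exp (μ * x)) x := by
    intro x
    have := (((hasDerivAt_id x).const_mul μ).exp).const_mul (s / μ)
    refine this.congr_deriv ?_
    simp only [id, mul_one]
    field_simp
  intro x hx
  refine image_norm_le_of_norm_deriv_right_le_deriv_boundary (f := f) (f' := f')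
    (fun y hy => (hf y hy).continuousAt.continuousWithinAt)
    (fun y hy => (hf y (Ico_subset_Icc_self hy)).hasDerivWithinAt) ?_ hB
    (fun y hy => hb y (Ico_subset_Icc_self hy)) hx
  simp only [ha, norm_zero]
  positivity

/-- In the norm weighted by `e^{-μx}` each integration gains `μ⁻¹` and the fractional integral gains
`μ^{α-1}`; a large rate `μ` makes the total smaller than the leading coefficient. Both forward
uniqueness and existence use this one constant. -/
theorem contraction_const_lt {α A B L μ : ℝ} (hα1 : α < 1) (hB : 0 ≤ B)
    (hL : 0 ≤ L) (hμ : 1 ≤ μ) (h : L + B < A * μ) :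
    L / μ / μ + B * (μ⁻¹ * μ ^ (α - 1)) < A := by
  have hμ0 : 0 < μ := by linarith
  have h1 : L / μ / μ ≤ L / μ := div_le_self (by positivity) hμ
  have h2 : μ ^ (α - 1) ≤ 1 := Real.rpow_le_one_of_one_le_of_nonpos hμ (by linarith)
  have h3 : B * (μ⁻¹ * μ ^ (α - 1)) ≤ B * (μ⁻¹ * 1) := by gcongr
  have h4 : (L + B) / μ < A := (div_lt_iff₀ hμ0).2 h
  have h5 : (L + B) / μ = L / μ + B * (μ⁻¹ * 1) := by field_simp
  linarith

/-- Solutions of an equation with Lipschitz nonlinearity that agree on a half-line agree as long as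
both exist. -/
theorem GenSol.eqOn {α A B L T ξ : ℝ} {H u v : ℝ → ℝ} (hα1 : α < 1) (hA : 0 < A)
    (hB : 0 ≤ B) (hL : ∀ x y, |H x - H y| ≤ L * |x - y|)
    (hu : GenSol α A B H T u) (hv : GenSol α A B H T v) (h : EqOn u v (Iio ξ)) :
    EqOn u v (Iio T) := by
  have hL0 : 0 ≤ L := by
    have := (abs_nonneg _).trans (hL 1 0)
    simpa using this
  obtain ⟨μ, hμ1, hμ⟩ : ∃ μ : ℝ, 1 ≤ μ ∧ L + B < A * μ := by
    refine ⟨max 1 ((L + B) / A + 1), le_max_left _ _, ?_⟩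
    have : (L + B) / A < max 1 ((L + B) / A + 1) := (lt_add_one _).trans_le (le_max_right _ _)
    rw [div_lt_iff₀ hA] at this
    linarith
  have hμ0 : 0 < μ := by linarith
  have hq := contraction_const_lt (α := α) hα1 hB hL0 hμ1 hμ
  intro x₀ hx₀
  simp only [mem_Iio] at hx₀
  rcases lt_or_ge x₀ ξ with hlt | hge
  · exact h hlt
  set d2 : ℝ → ℝ := fun x => deriv (deriv u) x - deriv (deriv v) x with hd2
  set d1 : ℝ → ℝ := fun x => deriv u x - deriv v x with hd1
  have e1 := eqOn_deriv_of_eqOn h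
  have e2 := eqOn_deriv_of_eqOn e1
  have hsub : Icc (ξ - 1) x₀ ⊆ Iio T := fun x hx => lt_of_le_of_lt hx.2 hx₀
  -- The weighted second derivative of the difference is evaluated at its maximum `m`. Integrating
  -- twice from the half-line of agreement controls all other terms of the equation by the value at
  -- `m`.
  obtain ⟨m, hm, hmax⟩ := (isCompact_Icc (a := ξ - 1) (b := x₀)).exists_isMaxOn
    (f := fun x => |d2 x| * Real.exp (-(μ * x)))
    ⟨x₀, ⟨by linarith, le_rfl⟩⟩ (by
      refine ContinuousOn.mul ?_ (by fun_prop)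
      exact ((hu.continuousOn_deriv2.sub hv.continuousOn_deriv2).mono hsub).abs)
  set s := |d2 m| * Real.exp (-(μ * m)) with hs
  have hs0 : 0 ≤ s := by positivity
  have hz1 : ∀ x < ξ, d1 x = 0 := fun x hx => by simp only [hd1, e1 hx, sub_self]
  have hz2 : ∀ x < ξ, d2 x = 0 := fun x hx => by simp only [hd2, e2 hx, sub_self]
  have b2 : ∀ x ∈ Icc (ξ - 1) x₀, |d2 x| ≤ s * Real.exp (μ * x) := by
    intro x hx
    have := hmax hx
    simp only [mem_ofPred_eq] at this
    calc |d2 x| = |d2 x| * Real.exp (-(μ * x)) * Real.exp (μ * x) := by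
          rw [mul_assoc, ← Real.exp_add]; simp
      _ ≤ s * Real.exp (μ * x) := by gcongr
  have b1 := abs_le_exp_of_abs_deriv_le (f := d1) (f' := d2) hμ0 hs0
    (fun x hx => (hu.hasDerivAt_deriv (hsub hx)).sub (hv.hasDerivAt_deriv (hsub hx)))
    (hz1 _ (by linarith)) b2
  have b0 := abs_le_exp_of_abs_deriv_le (f := fun x => u x - v x) (f' := d1) hμ0
    (by positivity)
    (fun x hx => (hu.hasDerivAt (hsub hx)).sub (hv.hasDerivAt (hsub hx)))
    (by simp [h (show ξ - 1 < ξ by linarith)]) b1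
  have hmT := hsub hm
  have bf : |fracInt α d1 m| ≤ s / μ * μ ^ (α - 1) * Real.exp (μ * m) := by
    refine abs_fracInt_le_of_exp_bound hα1 hμ0 fun y hy => ?_
    rcases lt_or_ge y ξ with h1 | h1
    · rw [hz1 y h1, abs_zero]; positivity
    · exact b1 y ⟨by linarith, hy.le.trans hm.2⟩
  have heq : A * d2 m = (H (u m) - H (v m)) - B * fracInt α d1 m := by
    have h1 := hu.equation m hmT
    have h2 := hv.equation m hmT
    rw [hd1, fracInt_sub (hu.integrable m hmT) (hv.integrable m hmT), ← h1, ← h2]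
    simp only [hd2]
    ring
  -- The bracket is strictly less than `A`, so this inequality is only possible if the maximum
  -- vanishes.
  have hmain : A * |d2 m| ≤ (L / μ / μ + B * (μ⁻¹ * μ ^ (α - 1))) * (s * Real.exp (μ * m)) := by
    calc A * |d2 m| = |A * d2 m| := by rw [abs_mul, abs_of_pos hA]
      _ ≤ |H (u m) - H (v m)| + |B * fracInt α d1 m| := by rw [heq]; exact abs_sub _ _
      _ ≤ L * (s / μ / μ * Real.exp (μ * m)) +
          B * (s / μ * μ ^ (α - 1) * Real.exp (μ * m)) := by
        rw [abs_mul, abs_of_nonneg hB]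
        have := b0 m hm
        refine add_le_add ((hL _ _).trans ?_) ?_ <;> gcongr
      _ = _ := by field_simp
  have hsm : s * Real.exp (μ * m) = |d2 m| := by
    rw [hs, mul_assoc, ← Real.exp_add]; simp
  rw [hsm] at hmain
  have hd0 : |d2 m| = 0 := by
    by_contra hne
    have : 0 < |d2 m| := lt_of_le_of_ne (abs_nonneg _) (Ne.symm hne)
    nlinarith
  have hs00 : s = 0 := by rw [hs, hd0, zero_mul]
  have := b0 x₀ ⟨by linarith, le_rfl⟩
  rw [hs00] at this
  simp only [zero_div, zero_mul] at this
  exact sub_eq_zero.1 (abs_eq_zero.1 (le_antisymm this (abs_nonneg _)))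

/-! ### The truncated nonlinearity. -/

/-- Truncation of a real number to `[-N, N]`. -/
def clip (N u : ℝ) : ℝ := max (-N) (min N u)

theorem abs_clip_sub_le (N x y : ℝ) : |clip N x - clip N y| ≤ |x - y| := by
  unfold clip
  refine (abs_max_sub_max_le_max _ _ _ _).trans ?_
  rw [sub_self, abs_zero]
  refine max_le (abs_nonneg _) ((abs_min_sub_min_le_max _ _ _ _).trans ?_)
  rw [sub_self, abs_zero]
  exact max_le (abs_nonneg _) le_rfl

theorem abs_clip_le {N : ℝ} (hN : 0 ≤ N) (x : ℝ) : |clip N x| ≤ N := by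
  unfold clip
  rw [abs_le]
  exact ⟨le_max_left _ _, max_le (by linarith) (min_le_left _ _)⟩

theorem clip_eq_self {N x : ℝ} (h : |x| ≤ N) : clip N x = x := by
  rw [abs_le] at h
  unfold clip
  rw [min_eq_right h.2, max_eq_right h.1]

theorem continuous_clip (N : ℝ) : Continuous (clip N) := by
  unfold clip; fun_prop

theorem continuous_h (φm φp : ℝ) : Continuous (h φm φp) := by
  unfold h; fun_prop

/-- The nonlinearity with its argument truncated to `[-N, N]`. -/
noncomputable def hcut (φm φp N u : ℝ) : ℝ := h φm φp (clip N u)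

theorem continuous_hcut (φm φp N : ℝ) : Continuous (hcut φm φp N) :=
  (continuous_h φm φp).comp (continuous_clip N)

theorem hcut_eq {φm φp N u : ℝ} (hu : |u| ≤ N) : hcut φm φp N u = h φm φp u := by
  rw [hcut, clip_eq_self hu]

theorem h_sub_h (φm φp x y : ℝ) :
    h φm φp x - h φm φp y = (x ^ 2 + x * y + y ^ 2 - waveSpeed φm φp) * (x - y) := by
  unfold h; ring

theorem abs_hcut_sub_le {φm φp N : ℝ} (hN : 0 ≤ N) (x y : ℝ) :
    |hcut φm φp N x - hcut φm φp N y| ≤ (3 * N ^ 2 + |waveSpeed φm φp|) * |x - y| := by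
  unfold hcut
  rw [h_sub_h, abs_mul]
  have h1 := abs_clip_le hN x
  have h2 := abs_clip_le hN y
  refine mul_le_mul ?_ (abs_clip_sub_le N x y) (abs_nonneg _) (by positivity)
  set X := clip N x
  set Y := clip N y
  have e1 : |X ^ 2| ≤ N ^ 2 := by rw [abs_pow]; gcongr
  have e2 : |Y ^ 2| ≤ N ^ 2 := by rw [abs_pow]; gcongr
  have e3 : |X * Y| ≤ N ^ 2 := by rw [abs_mul, sq]; gcongr
  calc |X ^ 2 + X * Y + Y ^ 2 - waveSpeed φm φp|
      ≤ |X ^ 2| + |X * Y| + |Y ^ 2| + |waveSpeed φm φp| :=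
        (abs_sub _ _).trans (add_le_add_left ((abs_add_le _ _).trans
          (add_le_add_left (abs_add_le _ _) _)) _)
    _ ≤ _ := by linarith

theorem exists_abs_hcut_le {φm φp N : ℝ} (hN : 0 ≤ N) : ∃ C, 0 ≤ C ∧ ∀ x, |hcut φm φp N x| ≤ C := by
  obtain ⟨C, hC⟩ := (isCompact_Icc (a := -N) (b := N)).exists_bound_of_continuousOn
    (continuous_h φm φp).continuousOn
  have hb : ∀ x, |hcut φm φp N x| ≤ C := fun x => hC _ (abs_le.1 (abs_clip_le hN x))
  exact ⟨C, (abs_nonneg _).trans (hb 0), hb⟩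

/-! ### Record values: interpolation, dominance of the cubic, and finite-time blow-down. -/

/-- Landau-type interpolation: on a window of length `δ` the mean value theorem gives a point with
slope at most `2M / δ`, and the second derivative can change the slope by at most `Q δ`. -/
theorem abs_deriv_le_of_abs_deriv2_le {u u' u'' : ℝ → ℝ} {c y δ M Q : ℝ} (hδ : 0 < δ)
    (hu : ∀ x ∈ Icc (y - δ) y, HasDerivAt u (u' x) x)
    (hu' : ∀ x ∈ Icc (y - δ) y, HasDerivAt u' (u'' x) x)
    (hM : ∀ x ∈ Icc (y - δ) y, |u x - c| ≤ M) (hQ : ∀ x ∈ Icc (y - δ) y, |u'' x| ≤ Q) :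
    |u' y| ≤ 2 * M / δ + Q * δ := by
  obtain ⟨z, hz, hz'⟩ := exists_hasDerivAt_eq_slope u u' (by linarith : y - δ < y)
    (fun x hx => (hu x hx).continuousAt.continuousWithinAt)
    (fun x hx => hu x (Ioo_subset_Icc_self hx))
  have hyI : y ∈ Icc (y - δ) y := ⟨by linarith, le_rfl⟩
  have hyI' : y - δ ∈ Icc (y - δ) y := ⟨le_rfl, by linarith⟩
  have hzI := Ioo_subset_Icc_self hz
  have h1 : ‖u' y - u' z‖ ≤ Q * ‖y - z‖ :=
    Convex.norm_image_sub_le_of_norm_hasDerivWithin_le (s := Icc (y - δ) y)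
      (fun x hx => (hu' x hx).hasDerivWithinAt) hQ (convex_Icc _ _) hzI hyI
  have hQ0 : 0 ≤ Q := (abs_nonneg _).trans (hQ y hyI)
  have h2 : |u' z| ≤ 2 * M / δ := by
    rw [hz', sub_sub_cancel, abs_div, abs_of_pos hδ]
    gcongr
    have := abs_sub_le (u y) c (u (y - δ))
    have e := hM _ hyI'
    rw [abs_sub_comm] at e
    linarith [hM y hyI]
  have h3 : ‖y - z‖ ≤ δ := by
    rw [Real.norm_eq_abs, abs_of_nonneg (by linarith [hz.2])]
    linarith [hz.1]
  have h4 : |u' y| ≤ |u' y - u' z| + |u' z| := by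
    have := abs_add_le (u' y - u' z) (u' z)
    simpa using this
  have h5 : Q * ‖y - z‖ ≤ Q * δ := by gcongr
  rw [Real.norm_eq_abs] at h1
  linarith

/-- The kernel is split at distance `δ`. Near the singularity the derivative bound is used; far from
it an integration by parts moves the derivative onto the kernel, so that only the size of `u`
matters. The boundary term and the remaining integral each cost `M δ^{-α}`. -/
theorem abs_fracInt_deriv_le {α x δ M P : ℝ} {u u' : ℝ → ℝ} (hα0 : 0 < α) (hα1 : α < 1)
    (hδ : 0 < δ) (hu : ∀ y < x, HasDerivAt u (u' y) y)
    (hint : IntegrableOn (fun y => u' y / (x - y) ^ α) (Iio x))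
    (hM : ∀ y < x, |u y| ≤ M) (hP : ∀ y < x, |u' y| ≤ P) :
    |fracInt α u' x| ≤
      1 / Real.Gamma (1 - α) * (P * (δ ^ (1 - α) / (1 - α)) + 2 * M * δ ^ (-α)) := by
  have hΓ : 0 < Real.Gamma (1 - α) := Real.Gamma_pos_of_pos (by linarith)
  have hint' := (integrableOn_kernel_iff α u' x).1 hint
  have hsplit : Ioi (0 : ℝ) = Ioc 0 δ ∪ Ioi δ := (Ioc_union_Ioi_eq_Ioi hδ.le).symm
  have hi1 : IntegrableOn (fun z => u' (x - z) * z ^ (-α)) (Ioc 0 δ) :=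
    hint'.mono_set Ioc_subset_Ioi_self
  have hi2 : IntegrableOn (fun z => u' (x - z) * z ^ (-α)) (Ioi δ) :=
    hint'.mono_set (Ioi_subset_Ioi hδ.le)
  rw [fracInt_eq_Ioi, abs_mul, abs_of_pos (by positivity : 0 < 1 / Real.Gamma (1 - α)), hsplit,
    setIntegral_union (Ioc_disjoint_Ioi le_rfl) measurableSet_Ioi hi1 hi2]
  have hM0 : 0 ≤ M := (abs_nonneg _).trans (hM (x - 1) (by linarith))
  refine mul_le_mul_of_nonneg_left ((abs_add_le _ _).trans (add_le_add ?_ ?_)) (by positivity)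
  · have hI : IntervalIntegrable (fun z : ℝ => z ^ (-α)) volume 0 δ :=
      intervalIntegral.intervalIntegrable_rpow' (by linarith)
    have hval : ∫ z in Ioc 0 δ, z ^ (-α) = δ ^ (1 - α) / (1 - α) := by
      rw [← intervalIntegral.integral_of_le hδ.le, integral_rpow (Or.inl (by linarith)),
        Real.zero_rpow (by linarith)]
      rw [show -α + 1 = 1 - α by ring, sub_zero]
    rw [← hval, ← integral_const_mul, ← Real.norm_eq_abs]
    refine norm_integral_le_of_norm_le
      (((intervalIntegrable_iff_integrableOn_Ioc_of_le hδ.le).1 hI).const_mul P) ?_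
    refine (ae_restrict_iff' measurableSet_Ioc).2 (Eventually.of_forall fun z hz => ?_)
    have h0 : 0 < z ^ (-α) := Real.rpow_pos_of_pos hz.1 _
    rw [Real.norm_eq_abs, abs_mul, abs_of_pos h0]
    exact mul_le_mul_of_nonneg_right (hP _ (by linarith [hz.1])) h0.le
  · have hGi : IntegrableOn (fun z : ℝ => z ^ (-α - 1)) (Ioi δ) :=
      integrableOn_Ioi_rpow_of_lt (by linarith) hδ
    have hGv : ∫ z in Ioi δ, z ^ (-α - 1) = δ ^ (-α) / α := by
      rw [integral_Ioi_rpow_of_lt (by linarith) hδ]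
      rw [show -α - 1 + 1 = -α by ring, neg_div_neg_eq]
    have hbd : ∀ z ∈ Ioi δ, ‖α * z ^ (-α - 1) * u (x - z)‖ ≤ α * M * z ^ (-α - 1) := by
      intro z hz
      have hz0 : 0 < z := hδ.trans hz
      have h0 : 0 < z ^ (-α - 1) := Real.rpow_pos_of_pos hz0 _
      rw [norm_mul, Real.norm_eq_abs, Real.norm_eq_abs, abs_of_pos (by positivity)]
      calc α * z ^ (-α - 1) * |u (x - z)| ≤ α * z ^ (-α - 1) * M := by
            have := hM (x - z) (by linarith)
            gcongr
        _ = _ := by ring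
    have hFi : IntegrableOn (fun z : ℝ => α * z ^ (-α - 1) * u (x - z)) (Ioi δ) := by
      refine Integrable.mono' (hGi.const_mul (α * M)) ?_
        ((ae_restrict_iff' measurableSet_Ioi).2 (Eventually.of_forall hbd))
      refine ContinuousOn.aestronglyMeasurable (fun z hz => ?_) measurableSet_Ioi
      have hz0 : 0 < z := hδ.trans hz
      refine ContinuousAt.continuousWithinAt (ContinuousAt.mul ?_ ?_)
      · exact continuousAt_const.mul (Real.continuousAt_rpow_const z _ (Or.inl hz0.ne'))
      · exact ContinuousAt.comp (f := fun z => x - z) (g := u)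
          (hu (x - z) (by linarith)).continuousAt (by fun_prop)
    -- The derivative of the boundary term for the integration by parts on `(δ, ∞)`.
    have hder : ∀ z ∈ Ici δ, HasDerivAt (fun z => -(u (x - z) * z ^ (-α)))
        (u' (x - z) * z ^ (-α) + α * z ^ (-α - 1) * u (x - z)) z := by
      intro z hz
      have hz0 : 0 < z := lt_of_lt_of_le hδ hz
      have h1 : HasDerivAt (fun z => u (x - z)) (-u' (x - z)) z :=
        (hu (x - z) (by linarith)).comp_const_sub x z
      have h2 : HasDerivAt (fun z : ℝ => z ^ (-α)) (-α * z ^ (-α - 1)) z :=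
        Real.hasDerivAt_rpow_const (Or.inl hz0.ne')
      refine (h1.mul h2).neg.congr_deriv ?_
      ring
    have hlim : Tendsto (fun z => -(u (x - z) * z ^ (-α))) atTop (𝓝 0) := by
      have h0 : Tendsto (fun z : ℝ => M * z ^ (-α)) atTop (𝓝 0) := by
        simpa using (tendsto_rpow_neg_atTop hα0).const_mul M
      refine squeeze_zero_norm' ?_ h0
      filter_upwards [eventually_gt_atTop (0 : ℝ)] with z hz
      have h0 : 0 < z ^ (-α) := Real.rpow_pos_of_pos hz _
      rw [norm_neg, Real.norm_eq_abs, abs_mul, abs_of_pos h0]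
      exact mul_le_mul_of_nonneg_right (hM _ (by linarith)) h0.le
    have hft := integral_Ioi_of_hasDerivAt_of_tendsto' hder (hi2.add hFi) hlim
    have h6 : ∫ z in Ioi δ, (u' (x - z) * z ^ (-α) + α * z ^ (-α - 1) * u (x - z)) =
        (∫ z in Ioi δ, u' (x - z) * z ^ (-α)) + ∫ z in Ioi δ, α * z ^ (-α - 1) * u (x - z) :=
      integral_add hi2 hFi
    rw [h6] at hft
    have h7 : |∫ z in Ioi δ, α * z ^ (-α - 1) * u (x - z)| ≤ M * δ ^ (-α) := by
      rw [← Real.norm_eq_abs]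
      refine (norm_integral_le_of_norm_le (hGi.const_mul (α * M))
        ((ae_restrict_iff' measurableSet_Ioi).2 (Eventually.of_forall hbd))).trans ?_
      rw [integral_const_mul, hGv]
      field_simp
      exact le_rfl
    have h8 : |u (x - δ) * δ ^ (-α)| ≤ M * δ ^ (-α) := by
      have h0 : 0 < δ ^ (-α) := Real.rpow_pos_of_pos hδ _
      rw [abs_mul, abs_of_pos h0]
      exact mul_le_mul_of_nonneg_right (hM _ (by linarith)) h0.le
    have h9 : ∫ z in Ioi δ, u' (x - z) * z ^ (-α) =
        u (x - δ) * δ ^ (-α) - ∫ z in Ioi δ, α * z ^ (-α - 1) * u (x - z) := by linarith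
    rw [h9]
    refine (abs_sub _ _).trans ?_
    linarith

theorem exists_abs_h_le (φm φp : ℝ) : ∃ C, 0 ≤ C ∧ ∀ M, 1 ≤ M → ∀ u, |u| ≤ M →
    |h φm φp u| ≤ C * M ^ 3 := by
  refine ⟨|waveSpeed φm φp| * (1 + |φm|) + 1 + |φm| ^ 3, by positivity, fun M hM u hu => ?_⟩
  have hM3 : M ≤ M ^ 3 := by nlinarith [mul_self_nonneg M]
  have hM31 : 1 ≤ M ^ 3 := by linarith
  have h1 : |u - φm| ≤ (1 + |φm|) * M ^ 3 := by
    have := abs_sub u φm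
    linarith [mul_le_mul_of_nonneg_left hM31 (abs_nonneg φm)]
  have h2 : |u ^ 3| ≤ M ^ 3 := by rw [abs_pow]; gcongr
  have h3 : |φm ^ 3| ≤ |φm| ^ 3 * M ^ 3 := by
    rw [abs_pow]
    exact le_mul_of_one_le_right (by positivity) hM31
  unfold h
  calc |-waveSpeed φm φp * (u - φm) + u ^ 3 - φm ^ 3|
      ≤ |waveSpeed φm φp| * |u - φm| + |u ^ 3| + |φm ^ 3| := by
        refine (abs_sub _ _).trans (add_le_add_left ((abs_add_le _ _).trans ?_) _)
        rw [abs_mul, abs_neg]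
    _ ≤ |waveSpeed φm φp| * ((1 + |φm|) * M ^ 3) + M ^ 3 + |φm| ^ 3 * M ^ 3 := by gcongr
    _ = _ := by ring

set_option maxHeartbeats 1000000 in
/-- At a record minimum of large modulus the cubic term dominates the non-local one, uniformly in the
coefficients. -/
theorem exists_record_bound {α A₀ B₁ : ℝ} (φm φp : ℝ) (hα0 : 0 < α) (hα1 : α < 1) (hA₀ : 0 < A₀)
    (hB₁ : 0 ≤ B₁) : ∃ N₀, 1 ≤ N₀ ∧ ∀ A B T x X P₀ u, A₀ ≤ A → 0 ≤ B → B ≤ B₁ →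
      GenSol α A B (h φm φp) T u → x < T → (∀ y < X, |deriv u y| ≤ P₀) →
      (∀ y ≤ x, |u y| ≤ -u x) → N₀ ≤ -u x → A * deriv (deriv u) x ≤ (u x) ^ 3 / 4 := by
  have hΓ : 0 < Real.Gamma (1 - α) := Real.Gamma_pos_of_pos (by linarith)
  obtain ⟨Ch, hCh0, hCh⟩ := exists_abs_h_le φm φp
  have h1α : 0 < 1 - α := by linarith
  set G := 1 / Real.Gamma (1 - α) with hG
  have hG0 : 0 < G := by positivity
  set K := max 1 ((Ch + B₁ * (G * (1 / (1 - α) + 2))) / A₀) with hK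
  have hK1 : 1 ≤ K := le_max_left _ _
  have hKA : Ch + B₁ * (G * (1 / (1 - α) + 2)) ≤ K * A₀ := by
    rw [← div_le_iff₀ hA₀]; exact le_max_right _ _
  set K2 := G * (2 * (4 * K + 1) / (1 - α) + 2) with hK2
  have hK20 : 0 ≤ K2 := by positivity
  set C3 := |waveSpeed φm φp| * (1 + |φm|) + |φm| ^ 3 with hC3
  have hC30 : 0 ≤ C3 := by positivity
  refine ⟨max 1 (4 / 3 * (C3 + B₁ * K2)), le_max_left _ _, ?_⟩
  intro A B T x X P₀ u hA hB hBB hu hx hP₀ hrec hN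
  obtain ⟨M, hM⟩ : ∃ M, M = -u x := ⟨_, rfl⟩
  rw [← hM] at hrec hN
  have hM1 : 1 ≤ M := (le_max_left _ _).trans hN
  have hM0 : 0 < M := by linarith
  have hA0 : 0 < A := by linarith
  -- the least bound of the derivative
  have hbdd : BddAbove ((fun y => |deriv u y|) '' Iic x) := by
    obtain ⟨C, hC⟩ := (isCompact_Icc (a := X - 1) (b := x)).exists_bound_of_continuousOn
      (hu.continuousOn_deriv.mono fun y hy => lt_of_le_of_lt hy.2 hx)
    refine ⟨max P₀ C, ?_⟩
    rintro _ ⟨y, hy, rfl⟩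
    rcases lt_or_ge y X with h1 | h1
    · exact (hP₀ y h1).trans (le_max_left _ _)
    · exact (hC y ⟨by linarith, hy⟩).trans (le_max_right _ _)
  obtain ⟨P, hPdef⟩ : ∃ P, P = sSup ((fun y => |deriv u y|) '' Iic x) := ⟨_, rfl⟩
  have hP : ∀ y ≤ x, |deriv u y| ≤ P := fun y hy => hPdef ▸ le_csSup hbdd ⟨y, hy, rfl⟩
  have hP0 : 0 ≤ P := (abs_nonneg _).trans (hP x le_rfl)
  -- The fractional term is split at distance `1 / M`: the near part costs `P M^{α-1}` and the far
  -- part `M^{1+α}`, both below `M³` once `P = O(M²)`.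
  have hMinv : 0 < M⁻¹ := inv_pos.2 hM0
  have hpow1 : (M⁻¹) ^ (1 - α) = M ^ (α - 1) := by
    rw [Real.inv_rpow hM0.le, ← Real.rpow_neg hM0.le, neg_sub]
  have hpow2 : M * (M⁻¹) ^ (-α) = M ^ (1 + α) := by
    rw [Real.inv_rpow hM0.le, ← Real.rpow_neg hM0.le, neg_neg, Real.rpow_add hM0, Real.rpow_one]
  have hfr : ∀ P', (∀ y ≤ x, |deriv u y| ≤ P') → ∀ y ≤ x, |fracInt α (deriv u) y| ≤
      G * (P' * (M ^ (α - 1) / (1 - α)) + 2 * M ^ (1 + α)) := by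
    intro P' hP' y hy
    have := abs_fracInt_deriv_le (u := u) (u' := deriv u) (M := M) (P := P') hα0 hα1 hMinv
      (fun z hz => hu.hasDerivAt ((hz.trans_le hy).trans hx)) (hu.integrable y (hy.trans_lt hx))
      (fun z hz => hrec z (hz.le.trans hy)) (fun z hz => hP' z (hz.le.trans hy))
    rwa [hpow1, mul_assoc 2, hpow2] at this
  have hle1 : M ^ (α - 1) ≤ 1 := Real.rpow_le_one_of_one_le_of_nonpos hM1 (by linarith)
  have hle3 : M ^ (1 + α) ≤ M ^ 3 := by
    rw [← Real.rpow_natCast]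
    exact Real.rpow_le_rpow_of_exponent_le hM1 (by push_cast; linarith)
  -- A crude bound from the equation, still containing the unknown bound `P` of the derivative.
  have hQ : ∀ y ≤ x, |deriv (deriv u) y| ≤ K * (M ^ 3 + P) := by
    intro y hy
    have e := hu.equation y (hy.trans_lt hx)
    have e1 := hfr P hP y hy
    have e2 := hCh M hM1 (u y) (hrec y hy)
    have e3 : A * |deriv (deriv u) y| ≤ Ch * M ^ 3 + B₁ * (G * (1 / (1 - α) + 2)) * (M ^ 3 + P) := by
      calc A * |deriv (deriv u) y| = |h φm φp (u y) - B * fracInt α (deriv u) y| := by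
            rw [← e, add_sub_cancel_right, abs_mul, abs_of_pos hA0]
        _ ≤ |h φm φp (u y)| + B * |fracInt α (deriv u) y| := by
            refine (abs_sub _ _).trans ?_
            rw [abs_mul, abs_of_nonneg hB]
        _ ≤ Ch * M ^ 3 + B₁ * (G * (P * (1 / (1 - α)) + 2 * M ^ 3)) := by
            refine add_le_add e2 (mul_le_mul hBB (e1.trans ?_) (abs_nonneg _) hB₁)
            gcongr
        _ ≤ Ch * M ^ 3 + B₁ * (G * ((1 / (1 - α) + 2) * (M ^ 3 + P))) := by
            gcongr
            have : 0 ≤ 1 / (1 - α) * M ^ 3 := by positivity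
            linarith
        _ = _ := by ring
    have e4 : A₀ * |deriv (deriv u) y| ≤ K * A₀ * (M ^ 3 + P) := by
      have h1 : A₀ * |deriv (deriv u) y| ≤ A * |deriv (deriv u) y| := by gcongr
      have h2 : Ch * M ^ 3 + B₁ * (G * (1 / (1 - α) + 2)) * (M ^ 3 + P) ≤
          (Ch + B₁ * (G * (1 / (1 - α) + 2))) * (M ^ 3 + P) := by
        have : 0 ≤ Ch * P := by positivity
        linarith
      have h3 : (Ch + B₁ * (G * (1 / (1 - α) + 2))) * (M ^ 3 + P) ≤ K * A₀ * (M ^ 3 + P) := by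
        gcongr
      linarith
    have : A₀ * |deriv (deriv u) y| ≤ A₀ * (K * (M ^ 3 + P)) := by linarith
    exact le_of_mul_le_mul_left this hA₀
  -- With a window of length `1 / (2 K M)` the contribution of `P` through the second derivative is
  -- at most `P / 2`. It is absorbed on the left because `P` is the least bound, leaving `P =
  -- O(M²)`.
  have hstep : P ≤ (4 * K + 1) * M ^ 2 + P / 2 := by
    refine hPdef.trans_le ?_
    refine csSup_le ⟨_, x, self_mem_Iic, rfl⟩ ?_
    rintro _ ⟨y, hy, rfl⟩
    have hδ : 0 < 1 / (2 * K * M) := by positivity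
    have := abs_deriv_le_of_abs_deriv2_le (u := u) (u' := deriv u) (u'' := deriv (deriv u))
      (c := 0) (y := y) (M := M) (Q := K * (M ^ 3 + P)) hδ
      (fun z hz => hu.hasDerivAt ((hz.2.trans hy).trans_lt hx))
      (fun z hz => hu.hasDerivAt_deriv ((hz.2.trans hy).trans_lt hx))
      (fun z hz => by simpa using hrec z (hz.2.trans hy)) (fun z hz => hQ z (hz.2.trans hy))
    refine this.trans ?_
    have e1 : 2 * M / (1 / (2 * K * M)) + K * (M ^ 3 + P) * (1 / (2 * K * M)) =
        4 * K * M ^ 2 + M ^ 2 / 2 + P / (2 * M) := by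
      field_simp
      ring
    have e2 : P / (2 * M) ≤ P / 2 := by gcongr; linarith
    rw [e1]
    linarith [sq_nonneg M]
  have hPM : ∀ y ≤ x, |deriv u y| ≤ 2 * (4 * K + 1) * M ^ 2 := fun y hy =>
    (hP y hy).trans (by linarith)
  have hF : |fracInt α (deriv u) x| ≤ K2 * M ^ (1 + α) := by
    refine (hfr _ hPM x le_rfl).trans (le_of_eq ?_)
    have : M ^ 2 * M ^ (α - 1) = M ^ (1 + α) := by
      rw [← Real.rpow_natCast, ← Real.rpow_add hM0]
      congr 1
      push_cast
      ring
    rw [hK2, ← this]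
    ring
  have hM13 : M ≤ M ^ (1 + α) := by
    conv_lhs => rw [← Real.rpow_one M]
    exact Real.rpow_le_rpow_of_exponent_le hM1 (by linarith)
  have hM33 : M ^ (1 + α) * M ≤ M ^ 3 := by
    have h1 : M ^ 3 = M ^ (1 + α) * M ^ (2 - α) := by
      rw [← Real.rpow_natCast, ← Real.rpow_add hM0]
      congr 1
      push_cast
      ring
    have h2 : M ≤ M ^ (2 - α) := by
      conv_lhs => rw [← Real.rpow_one M]
      exact Real.rpow_le_rpow_of_exponent_le hM1 (by linarith)
    rw [h1]
    gcongr
  have hh : h φm φp (u x) ≤ -M ^ 3 + C3 * M := by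
    have hux : u x = -M := by rw [hM, neg_neg]
    rw [hux]
    unfold h
    have e1 : waveSpeed φm φp * (M + φm) ≤ |waveSpeed φm φp| * ((1 + |φm|) * M) := by
      refine (le_abs_self _).trans ?_
      rw [abs_mul]
      gcongr
      refine (abs_add_le _ _).trans ?_
      rw [abs_of_pos hM0]
      linarith [mul_le_mul_of_nonneg_left hM1 (abs_nonneg φm)]
    have e2 : -φm ^ 3 ≤ |φm| ^ 3 * M := by
      refine (neg_le_abs _).trans ?_
      rw [abs_pow]
      exact le_mul_of_one_le_right (by positivity) hM1
    have : -waveSpeed φm φp * (-M - φm) + (-M) ^ 3 - φm ^ 3 =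
      -M ^ 3 + waveSpeed φm φp * (M + φm) - φm ^ 3 := by ring
    rw [this, hC3]
    linarith
  have e := hu.equation x hx
  have hBF : -(B * fracInt α (deriv u) x) ≤ B₁ * (K2 * M ^ (1 + α)) := by
    refine (neg_le_abs _).trans ?_
    rw [abs_mul, abs_of_nonneg hB]
    gcongr
  -- The threshold `N₀` was fixed so that all lower-order terms consume at most three quarters of
  -- `M³`; the remaining quarter is the one in the conclusion.
  have hfin : (C3 + B₁ * K2) * M ^ (1 + α) ≤ 3 / 4 * M ^ 3 := by
    have h1 : C3 + B₁ * K2 ≤ 3 / 4 * M := by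
      have := (le_max_right _ _).trans hN
      linarith
    calc (C3 + B₁ * K2) * M ^ (1 + α) ≤ 3 / 4 * M * M ^ (1 + α) := by gcongr
      _ ≤ _ := by linarith
  have hC3M : C3 * M ≤ C3 * M ^ (1 + α) := by gcongr
  have hux : (u x) ^ 3 = -M ^ 3 := by rw [hM]; ring
  rw [hux]
  linarith

theorem le_of_hasDerivAt_nonneg {f f' : ℝ → ℝ} {a b : ℝ} (hab : a ≤ b)
    (hf : ∀ x ∈ Icc a b, HasDerivAt f (f' x) x) (h0 : ∀ x ∈ Icc a b, 0 ≤ f' x) : f a ≤ f b := by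
  refine monotoneOn_of_hasDerivWithinAt_nonneg (f' := f') (convex_Icc a b)
    (fun x hx => (hf x hx).continuousAt.continuousWithinAt)
    (fun x hx => (hf x (interior_subset hx)).hasDerivWithinAt)
    (fun x hx => h0 x (interior_subset hx)) ⟨le_rfl, hab⟩ ⟨hab, le_rfl⟩ hab

theorem le_of_hasDerivAt_nonpos {f f' : ℝ → ℝ} {a b : ℝ} (hab : a ≤ b)
    (hf : ∀ x ∈ Icc a b, HasDerivAt f (f' x) x) (h0 : ∀ x ∈ Icc a b, f' x ≤ 0) : f b ≤ f a := by
  have := le_of_hasDerivAt_nonneg (f := fun x => -f x) (f' := fun x => -f' x) hab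
    (fun x hx => (hf x hx).neg) (fun x hx => by linarith [h0 x hx])
  linarith

/-- A solution that attains a sufficiently low record decreases from then on. -/
theorem GenSol.after_record {α A B T X P₀ N₀ x₁ : ℝ} {H u : ℝ → ℝ} (hu : GenSol α A B H T u)
    (hA : 0 < A) (hN₀ : 1 ≤ N₀)
    (hrec : ∀ x < T, (∀ y < X, |deriv u y| ≤ P₀) →
      (∀ y ≤ x, |u y| ≤ -u x) → N₀ ≤ -u x → A * deriv (deriv u) x ≤ (u x) ^ 3 / 4)
    (hP₀ : ∀ y < X, |deriv u y| ≤ P₀) (h1 : ∀ y ≤ x₁, |u y| ≤ -u x₁) (hN : N₀ ≤ -u x₁)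
    (hx₁ : x₁ < T) :
    ∀ x ∈ Ico x₁ T, deriv u x ≤ 0 ∧ u x ≤ -N₀ ∧ A * deriv (deriv u) x ≤ (u x) ^ 3 / 4 := by
  -- At a record no earlier value is lower, so a positive derivative is impossible.
  have hstart : deriv u x₁ ≤ 0 := by
    by_contra! hpos
    have h2 : ∀ᶠ y in 𝓝[<] x₁, 0 < slope u x₁ y := by
      have := (hasDerivAt_iff_tendsto_slope.1 (hu.hasDerivAt hx₁)).mono_left
        (nhdsWithin_mono x₁ (fun y (hy : y < x₁) => (ne_of_lt hy : y ≠ x₁)))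
      exact this.eventually (lt_mem_nhds hpos)
    obtain ⟨y, hy, hyx⟩ := (h2.and self_mem_nhdsWithin).exists
    have hyx' : y < x₁ := hyx
    rw [slope_def_field] at hy
    have h3 := (abs_le.1 (h1 y hyx'.le)).1
    rw [neg_neg] at h3
    have : (u y - u x₁) / (y - x₁) ≤ 0 :=
      div_nonpos_of_nonneg_of_nonpos (by linarith) (by linarith)
    linarith
  -- as long as `u` has decreased, the conclusion holds
  have key : ∀ x ∈ Ico x₁ T, (∀ y ∈ Icc x₁ x, deriv u y ≤ 0) →
      u x ≤ -N₀ ∧ A * deriv (deriv u) x ≤ (u x) ^ 3 / 4 := by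
    intro x hx hneg
    have hmono : ∀ y ∈ Icc x₁ x, u x ≤ u y := fun y hy =>
      le_of_hasDerivAt_nonpos hy.2
        (fun z hz => hu.hasDerivAt (hz.2.trans_lt hx.2))
        (fun z hz => hneg z ⟨hy.1.trans hz.1, hz.2⟩)
    have hxx := hmono x₁ ⟨le_rfl, hx.1⟩
    refine ⟨by linarith, hrec x hx.2 hP₀ (fun y hy => ?_) (by linarith)⟩
    rcases le_total y x₁ with hy1 | hy1
    · linarith [h1 y hy1]
    · have e1 := hmono y ⟨hy1, hy⟩
      have e2 : u y ≤ u x₁ := le_of_hasDerivAt_nonpos hy1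
        (fun z hz => hu.hasDerivAt ((hz.2.trans hy).trans_lt hx.2))
        (fun z hz => hneg z ⟨hz.1, hz.2.trans hy⟩)
      rw [abs_le]
      constructor <;> linarith
  have hall : ∀ x ∈ Ico x₁ T, deriv u x ≤ 0 := by
    intro x hx
    by_contra! hbad
    -- At the infimum of the points with positive slope, the solution has only decreased, so the
    -- slope is nonpositive and the second derivative negative. The slope is then negative just to
    -- the right, which contradicts the choice of the infimum.
    set S := {y | y ∈ Icc x₁ x ∧ 0 < deriv u y} with hS
    have hne : S.Nonempty := ⟨x, ⟨hx.1, le_rfl⟩, hbad⟩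
    have hbb : BddBelow S := ⟨x₁, fun y hy => hy.1.1⟩
    set i := sInf S with hi
    have hix : i ≤ x := csInf_le hbb ⟨⟨hx.1, le_rfl⟩, hbad⟩
    have hi1 : x₁ ≤ i := le_csInf hne fun y hy => hy.1.1
    have hiT : i < T := hix.trans_lt hx.2
    have hlt : ∀ y ∈ Ico x₁ i, deriv u y ≤ 0 := by
      intro y hy
      by_contra! hp
      have := csInf_le hbb (show y ∈ S from ⟨⟨hy.1, hy.2.le.trans hix⟩, hp⟩)
      exact absurd hy.2 (not_lt.2 this)
    have hcont : ContinuousAt (deriv u) i := (hu.hasDerivAt_deriv hiT).continuousAt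
    have hii : deriv u i ≤ 0 := by
      rcases eq_or_lt_of_le hi1 with h | h
      · rw [← h]; exact hstart
      · refine le_of_tendsto (hcont.tendsto.mono_left (nhdsWithin_le_nhds (s := Iio i))) ?_
        filter_upwards [Ioo_mem_nhdsLT h] with y hy using hlt y ⟨hy.1.le, hy.2⟩
    obtain ⟨k1, k2⟩ := key i ⟨hi1, hiT⟩ fun y hy => by
      rcases eq_or_lt_of_le hy.2 with h | h
      · rw [h]; exact hii
      · exact hlt y ⟨hy.1, h⟩
    have hneg2 : deriv (deriv u) i < 0 := by
      have : (u i) ^ 3 ≤ (-N₀) ^ 3 := (Odd.pow_le_pow (n := 3) (by decide)).2 k1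
      have h3 : 0 < N₀ ^ 3 := by positivity
      have h4 : A * deriv (deriv u) i < 0 := by
        have : (-N₀) ^ 3 = -N₀ ^ 3 := by ring
        linarith
      by_contra! h5
      linarith [mul_nonneg hA.le h5]
    have h2 : ∀ᶠ y in 𝓝[>] i, slope (deriv u) i y < 0 := by
      have := (hasDerivAt_iff_tendsto_slope.1 (hu.hasDerivAt_deriv hiT)).mono_left
        (nhdsWithin_mono i (fun y (hy : i < y) => (ne_of_gt hy : y ≠ i)))
      exact this.eventually (gt_mem_nhds hneg2)
    obtain ⟨e, he, hee⟩ := mem_nhdsGT_iff_exists_Ioo_subset.1 h2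
    have he' : i < e := he
    obtain ⟨y, hyS, hye⟩ := exists_lt_of_csInf_lt hne he'
    have hyi : i ≤ y := csInf_le hbb hyS
    rcases eq_or_lt_of_le hyi with h | h
    · have := hyS.2
      rw [← h] at this
      linarith
    · have := hee ⟨h, hye⟩
      rw [mem_ofPred_eq, slope_def_field] at this
      have h5 : deriv u y - deriv u i < 0 := by
        by_contra! h6
        have : 0 ≤ (deriv u y - deriv u i) / (y - i) := div_nonneg h6 (by linarith)
        linarith
      linarith [hyS.2]
  intro x hx
  exact ⟨hall x hx, key x hx fun y hy => hall y ⟨hy.1, hy.2.trans_lt hx.2⟩⟩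

/-- The differential inequality `κ p³ ≤ p''` has no increasing global solution with `p ≥ 1`. -/
theorem not_global_of_cubic {p p' p'' : ℝ → ℝ} {κ a : ℝ} (hκ : 0 < κ)
    (hp : ∀ x, a ≤ x → HasDerivAt p (p' x) x) (hp' : ∀ x, a ≤ x → HasDerivAt p' (p'' x) x)
    (h1 : ∀ x, a ≤ x → 1 ≤ p x) (h0 : ∀ x, a ≤ x → 0 ≤ p' x)
    (h2 : ∀ x, a ≤ x → κ * p x ^ 3 ≤ p'' x) : False := by
  -- Waiting one unit of length makes the slope at least `κ`; at `a` it might vanish.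
  set b := a + 1 with hb
  have hpos : κ ≤ p' b := by
    have := le_of_hasDerivAt_nonneg (f := fun x => p' x - κ * x) (f' := fun x => p'' x - κ)
      (by linarith : a ≤ b)
      (fun x hx => by
        exact ((hp' x hx.1).sub ((hasDerivAt_id x).const_mul κ)).congr_deriv (by simp))
      (fun x hx => by
        have e1 := h2 x hx.1
        have e2 : 1 ≤ p x ^ 3 := one_le_pow₀ (h1 x hx.1)
        have e3 : κ * 1 ≤ κ * p x ^ 3 := by gcongr
        linarith)
    have e4 := h0 a le_rfl
    simp only [hb] at this ⊢
    linarith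
  have hpb : 1 ≤ p b := h1 b (by linarith)
  -- The first condition starts the comparison `c p² ≤ p'` at `b`; the second makes `p'² - c² p⁴`
  -- nondecreasing, so the comparison persists.
  obtain ⟨c, hc0, hc1, hc2⟩ : ∃ c : ℝ, 0 < c ∧ c * p b ^ 2 ≤ p' b ∧ 2 * c ^ 2 ≤ κ := by
    refine ⟨min (κ / p b ^ 2) (min 1 (κ / 2)), by positivity, ?_, ?_⟩
    · have : min (κ / p b ^ 2) (min 1 (κ / 2)) ≤ κ / p b ^ 2 := min_le_left _ _
      rw [le_div_iff₀ (by positivity)] at this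
      linarith
    · set m := min (κ / p b ^ 2) (min 1 (κ / 2))
      have e1 : m ≤ 1 := (min_le_right _ _).trans (min_le_left _ _)
      have e2 : m ≤ κ / 2 := (min_le_right _ _).trans (min_le_right _ _)
      have e3 : 0 < m := by positivity
      nlinarith
  have hE : ∀ x, b ≤ x → c * p x ^ 2 ≤ p' x := by
    intro x hx
    have := le_of_hasDerivAt_nonneg (f := fun x => p' x ^ 2 - c ^ 2 * p x ^ 4)
      (f' := fun x => 2 * p' x * (p'' x - 2 * c ^ 2 * p x ^ 3)) hx
      (fun y hy => by
        have ha : a ≤ y := by linarith [hy.1]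
        refine (((hp' y ha).pow 2).sub (((hp y ha).pow 4).const_mul (c ^ 2))).congr_deriv ?_
        simp only [Nat.cast_ofNat]
        ring)
      (fun y hy => by
        have ha : a ≤ y := by linarith [hy.1]
        have e1 := h0 y ha
        have e2 := h2 y ha
        have e3 : 2 * c ^ 2 * p y ^ 3 ≤ κ * p y ^ 3 := by
          have := h1 y ha
          gcongr
        have : 0 ≤ p'' y - 2 * c ^ 2 * p y ^ 3 := by linarith
        positivity)
    have e1 : (c * p b ^ 2) ^ 2 ≤ p' b ^ 2 := by gcongr
    have e2 : (c * p x ^ 2) ^ 2 ≤ p' x ^ 2 := by nlinarith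
    exact (sq_le_sq₀ (by positivity) (h0 x (by linarith))).1 e2
  -- From `c p² ≤ p'` the function `1/p + c x` is nonincreasing, which bounds the length of the
  -- interval.
  have hinv : ∀ x, b ≤ x → c * (x - b) ≤ 1 := by
    intro x hx
    have := le_of_hasDerivAt_nonpos (f := fun x => (p x)⁻¹ + c * x)
      (f' := fun x => -p' x / p x ^ 2 + c) hx
      (fun y hy => by
        have ha : a ≤ y := by linarith [hy.1]
        have hpy := h1 y ha
        exact (((hp y ha).inv (by linarith)).add
          ((hasDerivAt_id y).const_mul c)).congr_deriv (by simp))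
      (fun y hy => by
        have ha : a ≤ y := by linarith [hy.1]
        have hpy := h1 y ha
        have e1 := hE y hy.1
        have : c ≤ p' y / p y ^ 2 := by rwa [le_div_iff₀ (by positivity)]
        rw [neg_div]
        linarith)
    have e1 : (p b)⁻¹ ≤ 1 := inv_le_one_of_one_le₀ hpb
    have e2 : 0 < (p x)⁻¹ := inv_pos.2 (by linarith [h1 x (by linarith)])
    linarith
  have := hinv (b + 2 / c) (by linarith [div_pos two_pos hc0])
  rw [add_sub_cancel_left, mul_div_cancel₀ _ hc0.ne'] at this
  norm_num at this

/-! ### The local limit equation. -/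

/-- The primitive of `h` that vanishes at `φm`. -/
noncomputable def potential (φm φp u : ℝ) : ℝ :=
  (u - φm) ^ 2 * ((u + φm) ^ 2 - 2 * φp * (φp + φm)) / 4

theorem hasDerivAt_potential (φm φp u : ℝ) :
    HasDerivAt (potential φm φp) (h φm φp u) u := by
  have h1 := ((hasDerivAt_id u).sub_const φm).pow 2
  have h2 := (((hasDerivAt_id u).add_const φm).pow 2).sub_const (2 * φp * (φp + φm))
  refine ((h1.mul h2).div_const 4).congr_deriv ?_
  simp only [id, Pi.pow_apply]
  unfold h waveSpeed
  push_cast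
  ring

theorem lt_of_deriv_neg_of_tendsto {u u' : ℝ → ℝ} {c x : ℝ} (hlim : Tendsto u atBot (𝓝 c))
    (hu : ∀ y ≤ x, HasDerivAt u (u' y) y) (hneg : ∀ y < x, u' y < 0) : u x < c := by
  have hanti : StrictAntiOn u (Iic x) := by
    refine strictAntiOn_of_deriv_neg (convex_Iic x)
      (fun y hy => (hu y hy).continuousAt.continuousWithinAt) fun y hy => ?_
    rw [interior_Iic] at hy
    rw [(hu y hy.le).deriv]
    exact hneg y hy
  have h1 : u (x - 1) ≤ c := by
    refine ge_of_tendsto hlim ?_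
    filter_upwards [eventually_le_atBot (x - 1)] with y hy
    exact hanti.antitoneOn (show y ≤ x by linarith) (show x - 1 ≤ x by linarith) hy
  exact (hanti (show x - 1 ≤ x by linarith) self_mem_Iic (by linarith)).trans_le h1

/-- In the limit equation `A v'' = h(v)` the trajectory leaving `φm` crosses every level below. -/
theorem ode_escape {α A φm φp N N' X : ℝ} {v : ℝ → ℝ} (hA : 0 < A) (hφm : 0 < φm)
    (hφp : φp < 0) (hs : 0 < φp + φm) (hmN : φm < N') (hNN : N' < N)
    (hv : ∀ T, GenSol α A 0 (hcut φm φp N) T v) (hlim : Tendsto v atBot (𝓝 φm))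
    (hlim' : Tendsto (deriv v) atBot (𝓝 0)) (hX : ∀ x ≤ X, deriv v x < 0) :
    ∃ ξ, v ξ ≤ -N' ∧ ∀ y ≤ ξ, -N' ≤ v y ∧ v y ≤ φm := by
  have hd : ∀ x, HasDerivAt v (deriv v x) x := fun x =>
    (hv (x + 1)).hasDerivAt (by linarith)
  have hd' : ∀ x, HasDerivAt (deriv v) (deriv (deriv v) x) x := fun x =>
    (hv (x + 1)).hasDerivAt_deriv (by linarith)
  have hc : Continuous v := continuous_iff_continuousAt.2 fun x => (hd x).continuousAt
  have hc' : Continuous (deriv v) := continuous_iff_continuousAt.2 fun x => (hd' x).continuousAt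
  have hκ : 0 < -(2 * φp * (φp + φm)) := by
    have := mul_pos (neg_pos.2 hφp) hs
    linarith
  -- Since `φp < 0 < φp + φm`, the constant in the factored potential is positive, so the potential
  -- vanishes at `φm` only. There is no turning point for the trajectory.
  have hpot : ∀ u, -(2 * φp * (φp + φm)) / 4 * (u - φm) ^ 2 ≤ potential φm φp u := by
    intro u
    unfold potential
    have : 0 ≤ (u - φm) ^ 2 * (u + φm) ^ 2 := by positivity
    linarith
  -- While `v` stays in `[-N, N]` the truncation is invisible and the energy is constant; its value
  -- is `0` by the limits at `-∞`.
  have henergy : ∀ x, (∀ y ≤ x, |v y| ≤ N) → A / 2 * deriv v x ^ 2 = potential φm φp (v x) := by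
    intro x hx
    have hE : ∀ y ≤ x, HasDerivAt (fun y => A / 2 * deriv v y ^ 2 - potential φm φp (v y)) 0 y := by
      intro y hy
      have e := (hv (y + 1)).equation y (by linarith)
      rw [hcut_eq (hx y hy), zero_mul, add_zero] at e
      have h1 := (((hd' y).pow 2).const_mul (A / 2)).sub
        ((hasDerivAt_potential φm φp (v y)).comp y (hd y))
      refine h1.congr_deriv ?_
      rw [← e]
      push_cast
      ring
    have hconst : ∀ y ≤ x, A / 2 * deriv v y ^ 2 - potential φm φp (v y) =
        A / 2 * deriv v x ^ 2 - potential φm φp (v x) := by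
      intro y hy
      have hm : ∀ z ∈ Icc y x, z ≤ x := fun z hz => hz.2
      exact le_antisymm
        (le_of_hasDerivAt_nonneg hy (fun z hz => hE z (hm z hz)) fun _ _ => le_rfl)
        (le_of_hasDerivAt_nonpos hy (fun z hz => hE z (hm z hz)) fun _ _ => le_rfl)
    have hl : Tendsto (fun y => A / 2 * deriv v y ^ 2 - potential φm φp (v y)) atBot
        (𝓝 (A / 2 * 0 ^ 2 - potential φm φp φm)) :=
      ((hlim'.pow 2).const_mul _).sub
        ((hasDerivAt_potential φm φp φm).continuousAt.tendsto.comp hlim)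
    have hl2 : Tendsto (fun y => A / 2 * deriv v y ^ 2 - potential φm φp (v y)) atBot
        (𝓝 (A / 2 * deriv v x ^ 2 - potential φm φp (v x))) := by
      refine tendsto_const_nhds.congr' ?_
      filter_upwards [eventually_le_atBot x] with y hy using (hconst y hy).symm
    have := tendsto_nhds_unique hl hl2
    have h0 : potential φm φp φm = 0 := by simp [potential]
    rw [h0] at this
    linarith
  -- At a first zero of the slope the energy identity would make the potential vanish at a value
  -- strictly below `φm`.
  have hdec : ∀ x, (∀ y ≤ x, -N' < v y) → ∀ y ≤ x, deriv v y < 0 := by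
    intro x hx
    by_contra! hbad
    set S := {y | y ≤ x ∧ 0 ≤ deriv v y} with hS
    have hbb : BddBelow S := ⟨X, fun y hy => by
      by_contra! h
      linarith [hX y h.le, hy.2]⟩
    have hcl : IsClosed S := isClosed_Iic.inter (isClosed_le continuous_const hc')
    obtain ⟨hi1, hi2⟩ := hcl.csInf_mem hbad hbb
    set i := sInf S with hi
    have hlt : ∀ y < i, deriv v y < 0 := by
      intro y hy
      by_contra! h
      exact absurd (csInf_le hbb (show y ∈ S from ⟨hy.le.trans hi1, h⟩)) (not_le.2 hy)
    have hi0 : deriv v i = 0 := by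
      refine le_antisymm ?_ hi2
      refine le_of_tendsto (hc'.continuousAt.tendsto.mono_left
        (nhdsWithin_le_nhds (s := Iio i))) ?_
      filter_upwards [self_mem_nhdsWithin] with y hy using (hlt y hy).le
    have hvm : ∀ y ≤ i, v y < φm := fun y hy =>
      lt_of_deriv_neg_of_tendsto hlim (fun z _ => hd z) fun z hz => hlt z (hz.trans_le hy)
    have e := henergy i fun y hy => by
      rw [abs_le]
      constructor
      · linarith [hx y (hy.trans hi1)]
      · linarith [hvm y hy]
    rw [hi0] at e
    have e2 := hpot (v i)
    have e3 : 0 < (v i - φm) ^ 2 := by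
      have := hvm i le_rfl
      nlinarith
    have e4 : 0 < -(2 * φp * (φp + φm)) / 4 * (v i - φm) ^ 2 := by positivity
    linarith
  have hup : ∀ x, (∀ y < x, -N' < v y) → ∀ y ≤ x, v y < φm := by
    intro x hx y hy
    refine lt_of_deriv_neg_of_tendsto hlim (fun z _ => hd z) fun z hz => ?_
    exact hdec z (fun w hw => hx w ((hw.trans_lt hz).trans_le hy)) z le_rfl
  have hcross : ∃ x, v x ≤ -N' := by
    by_contra! hno
    have hneg : ∀ x, deriv v x < 0 := fun x => hdec x (fun y _ => hno y) x le_rfl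
    have hvX : v X < φm := hup X (fun y _ => hno y) X le_rfl
    obtain ⟨r, hr⟩ : ∃ r, r = -(2 * φp * (φp + φm)) / 4 * (v X - φm) ^ 2 * (2 / A) := ⟨_, rfl⟩
    have hr0 : 0 < r := by
      have : 0 < (v X - φm) ^ 2 := by nlinarith
      rw [hr]
      positivity
    -- Below `v X` the potential is bounded away from zero, hence so is the slope, and the level
    -- `-N'` is reached in finite length.
    have hslope : ∀ x ≥ X, deriv v x ≤ -√r := by
      intro x hx
      have h1 : v x ≤ v X := le_of_hasDerivAt_nonpos hx (fun z _ => hd z) fun z _ => (hneg z).le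
      have e := henergy x fun y hy => by
        rw [abs_le]
        constructor
        · linarith [hno y]
        · linarith [hup x (fun y _ => hno y) y hy]
      have e2 := hpot (v x)
      have e3 : (v X - φm) ^ 2 ≤ (v x - φm) ^ 2 := by nlinarith
      have e4 : r ≤ (deriv v x) ^ 2 := by
        have e5 : -(2 * φp * (φp + φm)) / 4 * (v X - φm) ^ 2 ≤ A / 2 * deriv v x ^ 2 := by
          rw [e]
          refine le_trans ?_ e2
          gcongr
        calc r ≤ A / 2 * deriv v x ^ 2 * (2 / A) := by rw [hr]; gcongr
          _ = _ := by field_simp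
      have e6 := Real.abs_le_sqrt (x := √r) (y := deriv v x ^ 2) (by rwa [Real.sq_sqrt hr0.le])
      rw [Real.sqrt_sq_eq_abs, abs_of_neg (hneg x), abs_of_nonneg (Real.sqrt_nonneg _)] at e6
      linarith
    have hsr : 0 < √r := Real.sqrt_pos.2 hr0
    set x := X + (v X + N') / √r with hxdef
    have hxX : X ≤ x := by
      have : 0 ≤ (v X + N') / √r := div_nonneg (by linarith [hno X]) hsr.le
      linarith
    have := le_of_hasDerivAt_nonpos (f := fun x => v x + √r * x) (f' := fun x => deriv v x + √r)
      hxX (fun z _ => ((hd z).add ((hasDerivAt_id z).const_mul (√r))).congr_deriv (by simp))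
      fun z hz => by linarith [hslope z hz.1]
    have e : √r * x = √r * X + (v X + N') := by
      rw [hxdef]; field_simp
    linarith [hno x]
  set S := {x | v x ≤ -N'} with hS
  have hev : ∀ᶠ x in atBot, -N' < v x := hlim.eventually (lt_mem_nhds (by linarith))
  obtain ⟨Y, hY⟩ := eventually_atBot.1 hev
  have hbb : BddBelow S := ⟨Y, fun y hy => by
    by_contra! h
    exact absurd (hY y h.le) (not_lt.2 hy)⟩
  have hcl : IsClosed S := isClosed_le hc continuous_const
  have hmem : v (sInf S) ≤ -N' := hcl.csInf_mem hcross hbb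
  have hlt : ∀ y < sInf S, -N' < v y := fun y hy => by
    by_contra! h
    exact absurd (csInf_le hbb (show y ∈ S from h)) (not_le.2 hy)
  refine ⟨sInf S, hmem, fun y hy => ⟨?_, (hup _ hlt y hy).le⟩⟩
  rcases eq_or_lt_of_le hy with h | h
  · rw [h]
    refine ge_of_tendsto (hc.continuousAt.tendsto.mono_left
      (nhdsWithin_le_nhds (s := Iio (sInf S)))) ?_
    filter_upwards [self_mem_nhdsWithin] with y hy using (hlt y hy).le
  · exact (hlt y h).le

/-! ### Formal expansion in powers of `e^x`, continuous in the parameter. -/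

/-- The slope of `h` at `φm`. -/
noncomputable def slopeAt (φm φp : ℝ) : ℝ := 3 * φm ^ 2 - waveSpeed φm φp

theorem h_add (φm φp s : ℝ) :
    h φm φp (φm + s) = slopeAt φm φp * s + 3 * φm * s ^ 2 + s ^ 3 := by
  unfold h slopeAt; ring

/-- The symbol `A k² + B k^α`, with `A = a - B`, at the exponent `k`. -/
noncomputable def symb (α a B : ℝ) (k : ℕ) : ℝ := (a - B) * (k : ℝ) ^ 2 + B * (k : ℝ) ^ α

theorem symb_one (α a B : ℝ) : symb α a B 1 = a := by simp [symb]

/-- Non-resonance: the symbol equals `a` at the exponent `1` and strictly exceeds it at every larger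
integer exponent, so each higher coefficient of the expansion is determined. -/
theorem symb_sub_pos {α a B : ℝ} (hα : 0 < α) (hB : 0 ≤ B) (hBa : B < a) {k : ℕ} (hk : 2 ≤ k) :
    0 < symb α a B k - a := by
  have h1 : (2 : ℝ) ≤ k := by exact_mod_cast hk
  have h2 : 1 ≤ (k : ℝ) ^ α := Real.one_le_rpow (by linarith) hα.le
  have h3 : 0 < (a - B) * ((k : ℝ) ^ 2 - 1) := mul_pos (by linarith) (by nlinarith)
  have h4 : 0 ≤ B * ((k : ℝ) ^ α - 1) := mul_nonneg hB (by linarith)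
  unfold symb
  linarith

section

variable {b : ℝ}

/-- The symbol as a continuous function of the parameter. -/
noncomputable def symbC (b α a : ℝ) (k : ℕ) : C(Icc 0 b, ℝ) :=
  ⟨fun p => symb α a p k, by unfold symb; fun_prop⟩

-- With `y = e^x`, the operator multiplies `y^k` by the symbol at `k`, so matching powers is a
-- triangular system solved by induction on the order. Taking coefficients in the ring of continuous
-- functions on `[0, b]` carries continuity in the parameter along. The normalisation `-1` of the
-- linear term selects the branch leaving `φm` downwards.
open Polynomial in
theorem exists_ansatz_polynomial {α a : ℝ} (m : ℝ) (hα : 0 < α) (hb : b < a) (K : ℕ) (hK : 1 ≤ K) :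
    ∃ S : C(Icc 0 b, ℝ)[X], S.natDegree ≤ K ∧ S.coeff 0 = 0 ∧ S.coeff 1 = -1 ∧
      X ^ (K + 1) ∣ C (ContinuousMap.const _ a) * S + C (ContinuousMap.const _ m) * S ^ 2 + S ^ 3 -
        ∑ k ∈ Finset.range (K + 1), monomial k (symbC b α a k * S.coeff k) := by
  induction K, hK using Nat.le_induction with
  | base =>
    refine ⟨-X, ?_, by simp, by simp, ?_⟩
    · rw [natDegree_neg]; exact natDegree_X_le
    · have h1 : symbC b α a 1 = ContinuousMap.const _ a := by
        ext p; exact symb_one α a p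
      refine ⟨C (ContinuousMap.const _ m) - X, ?_⟩
      simp only [Finset.sum_range_succ, Finset.range_zero, Finset.sum_empty, coeff_neg,
        coeff_X_zero, coeff_X_one, h1, neg_zero, mul_zero, mul_neg, mul_one, map_zero, map_neg,
        ← C_mul_X_eq_monomial]
      ring
  | succ K hK ih =>
    obtain ⟨S, hdeg, h0, h1, Q, hQ⟩ := ih
    have hne : ∀ p : Icc 0 b, symbC b α a (K + 1) p - a ≠ 0 := fun p =>
      (symb_sub_pos hα p.2.1 (p.2.2.trans_lt hb) (by omega)).ne'
    -- The first uncancelled coefficient of the residual divided by the non-resonance factor.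
    let d : C(Icc 0 b, ℝ) := ⟨fun p => Q.coeff 0 p / (symbC b α a (K + 1) p - a),
      ((Q.coeff 0).continuous).div ((symbC b α a (K + 1)).continuous.sub continuous_const) hne⟩
    have hd : (symbC b α a (K + 1) - ContinuousMap.const _ a) * d = Q.coeff 0 := by
      ext p
      exact mul_div_cancel₀ _ (hne p)
    refine ⟨S + monomial (K + 1) d, ?_, ?_, ?_, ?_⟩
    · refine (natDegree_add_le _ _).trans (max_le (by omega) (natDegree_monomial_le _))
    · rw [coeff_add, h0, coeff_monomial, if_neg (by omega), add_zero]
    · rw [coeff_add, h1, coeff_monomial, if_neg (by omega), add_zero]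
    · have hcK : S.coeff (K + 1) = 0 := coeff_eq_zero_of_natDegree_lt (by omega)
      rw [Finset.sum_range_succ]
      have hsum : ∑ k ∈ Finset.range (K + 1),
          monomial k (symbC b α a k * (S + monomial (K + 1) d).coeff k) =
          ∑ k ∈ Finset.range (K + 1), monomial k (symbC b α a k * S.coeff k) := by
        refine Finset.sum_congr rfl fun k hk => ?_
        rw [Finset.mem_range] at hk
        rw [coeff_add, coeff_monomial, if_neg (by omega), add_zero]
      have hXS : X ∣ S := X_dvd_iff.2 h0
      obtain ⟨S1, hS1⟩ := hXS
      obtain ⟨Q1, hQ1⟩ := X_dvd_sub_C (p := Q)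
      rw [hsum, coeff_add, hcK, zero_add, coeff_monomial, if_pos rfl,
        ← C_mul_X_pow_eq_monomial, ← C_mul_X_pow_eq_monomial]
      have hd' : C (symbC b α a (K + 1) * d) = C (ContinuousMap.const _ a) * C d + C (Q.coeff 0) := by
        rw [← hd, ← C_mul, ← C_add]
        congr 1
        ring
      rw [hd']
      have hQ' : Q = X * Q1 + C (Q.coeff 0) := by rw [← hQ1]; ring
      set q0 := C (Q.coeff 0)
      -- The explicit cofactor: the old one after its constant term is cancelled, plus the cross
      -- terms of the square and the cube. Since `S` is divisible by `X`, these cross terms carry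
      -- one extra power.
      refine ⟨Q1 + C (ContinuousMap.const _ m) * (2 * S1 * C d + C d ^ 2 * X ^ K) +
        (3 * S1 ^ 2 * X * C d + 3 * S1 * X ^ (K + 1) * C d ^ 2 + X ^ (2 * K + 1) * C d ^ 3), ?_⟩
      have hQ2 := hQ
      rw [hQ'] at hQ2
      have : C (ContinuousMap.const _ a) * (S + C d * X ^ (K + 1)) +
          C (ContinuousMap.const _ m) * (S + C d * X ^ (K + 1)) ^ 2 + (S + C d * X ^ (K + 1)) ^ 3 -
          (∑ k ∈ Finset.range (K + 1), monomial k (symbC b α a k * S.coeff k) +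
            (C (ContinuousMap.const _ a) * C d + q0) * X ^ (K + 1)) =
          (C (ContinuousMap.const _ a) * S + C (ContinuousMap.const _ m) * S ^ 2 + S ^ 3 -
            ∑ k ∈ Finset.range (K + 1), monomial k (symbC b α a k * S.coeff k)) +
          C (ContinuousMap.const _ m) * (2 * S * C d * X ^ (K + 1) + (C d * X ^ (K + 1)) ^ 2) +
          (3 * S ^ 2 * (C d * X ^ (K + 1)) + 3 * S * (C d * X ^ (K + 1)) ^ 2 +
            (C d * X ^ (K + 1)) ^ 3) - q0 * X ^ (K + 1) := by ring
      rw [this, hQ2, hS1]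
      ring

/-- The value at `(p, y)` of the polynomial in `y` of degree at most `K` with coefficients `c`. -/
noncomputable def polyVal (K : ℕ) (c : ℕ → C(Icc 0 b, ℝ)) (p : Icc 0 b) (y : ℝ) : ℝ :=
  ∑ k ∈ Finset.range (K + 1), c k p * y ^ k

theorem exists_ansatz {α a : ℝ} (m : ℝ) (hα : 0 < α) (hb : b < a) (K : ℕ) (hK : 1 ≤ K) :
    ∃ (c : ℕ → C(Icc 0 b, ℝ)) (q : Icc 0 b × ℝ → ℝ), c 0 = 0 ∧ c 1 = -1 ∧ Continuous q ∧
      ∀ p y, a * polyVal K c p y + m * polyVal K c p y ^ 2 + polyVal K c p y ^ 3 -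
        polyVal K (fun k => symbC b α a k * c k) p y = y ^ (K + 1) * q (p, y) := by
  obtain ⟨S, hdeg, h0, h1, Q, hQ⟩ := exists_ansatz_polynomial (b := b) m hα hb K hK
  let ev : Icc 0 b → C(Icc 0 b, ℝ) →+* ℝ := fun p =>
    { toFun := fun f => f p
      map_one' := rfl
      map_mul' := fun _ _ => rfl
      map_zero' := rfl
      map_add' := fun _ _ => rfl }
  have hev : ∀ p f, ev p f = f p := fun _ _ => rfl
  refine ⟨S.coeff, fun q => Q.eval₂ (ev q.1) q.2, h0, h1, ?_, fun p y => ?_⟩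
  · simp only [Polynomial.eval₂_eq_sum_range, hev]
    refine continuous_finsetSum _ fun k _ => ?_
    exact ((Q.coeff k).continuous.comp continuous_fst).mul (continuous_snd.pow k)
  · have := congrArg (Polynomial.eval₂ (ev p) y) hQ
    have hS : Polynomial.eval₂ (ev p) y S = polyVal K S.coeff p y := by
      rw [Polynomial.eval₂_eq_sum_range' (ev p) (Nat.lt_succ_of_le hdeg)]
      rfl
    simp only [Polynomial.eval₂_sub, Polynomial.eval₂_add, Polynomial.eval₂_mul,
      Polynomial.eval₂_pow, Polynomial.eval₂_C, Polynomial.eval₂_X, Polynomial.eval₂_finsetSum,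
      Polynomial.eval₂_monomial, hS, hev, ContinuousMap.const_apply] at this
    exact this

theorem abs_polyVal_le_max (K : ℕ) (c : ℕ → C(Icc 0 b, ℝ)) (p : Icc 0 b) {y : ℝ} (hy : 0 ≤ y) :
    |polyVal K c p y| ≤ (∑ k ∈ Finset.range (K + 1), ‖c k‖) * max 1 (y ^ K) := by
  rw [polyVal, Finset.sum_mul]
  refine (Finset.abs_sum_le_sum_abs _ _).trans (Finset.sum_le_sum fun k hk => ?_)
  rw [abs_mul, abs_of_nonneg (pow_nonneg hy k)]
  have h1 : |c k p| ≤ ‖c k‖ := (c k).norm_coe_le_norm p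
  have h2 : y ^ k ≤ max 1 (y ^ K) := by
    rcases le_total y 1 with h | h
    · exact (pow_le_one₀ hy h).trans (le_max_left _ _)
    · rw [Finset.mem_range] at hk
      exact (pow_le_pow_right₀ h (by omega)).trans (le_max_right _ _)
  exact mul_le_mul h1 h2 (pow_nonneg hy k) (norm_nonneg _)

theorem abs_polyVal_le_mul (K : ℕ) (c : ℕ → C(Icc 0 b, ℝ)) (h0 : c 0 = 0) (p : Icc 0 b) {y : ℝ}
    (hy : 0 ≤ y) (hy1 : y ≤ 1) :
    |polyVal K c p y| ≤ (∑ k ∈ Finset.range (K + 1), ‖c k‖) * y := by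
  rw [polyVal, Finset.sum_mul]
  refine (Finset.abs_sum_le_sum_abs _ _).trans (Finset.sum_le_sum fun k hk => ?_)
  rw [abs_mul, abs_of_nonneg (pow_nonneg hy k)]
  rcases Nat.eq_zero_or_pos k with h | h
  · subst h
    simp [h0]
  · have h1 : |c k p| ≤ ‖c k‖ := (c k).norm_coe_le_norm p
    have h2 : y ^ k ≤ y := pow_le_of_le_one hy hy1 (by omega)
    exact mul_le_mul h1 h2 (pow_nonneg hy k) (norm_nonneg _)

theorem continuous_polyVal (K : ℕ) (c : ℕ → C(Icc 0 b, ℝ)) :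
    Continuous fun q : Icc 0 b × ℝ => polyVal K c q.1 q.2 := by
  unfold polyVal
  refine continuous_finsetSum _ fun k _ => ?_
  exact ((c k).continuous.comp continuous_fst).mul (continuous_snd.pow k)

theorem hasDerivAt_polyVal_exp (K : ℕ) (c : ℕ → C(Icc 0 b, ℝ)) (p : Icc 0 b) (x : ℝ) :
    HasDerivAt (fun x => polyVal K c p (Real.exp x))
      (polyVal K (fun k => (k : ℝ) • c k) p (Real.exp x)) x := by
  unfold polyVal
  have : ∀ k ∈ Finset.range (K + 1), HasDerivAt (fun x => c k p * Real.exp x ^ k)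
      (((k : ℝ) • c k) p * Real.exp x ^ k) x := by
    intro k _
    have h1 : ∀ x : ℝ, Real.exp x ^ k = Real.exp (k * x) := fun x => (Real.exp_nat_mul x k).symm
    simp only [h1, ContinuousMap.smul_apply, smul_eq_mul]
    refine ((((hasDerivAt_id x).const_mul (k : ℝ)).exp).const_mul (c k p)).congr_deriv ?_
    simp only [id, mul_one]
    ring
  exact HasDerivAt.fun_sum this

/-- Termwise evaluation on exponentials. The constant coefficient must vanish, as a nonzero constant
is not integrable against the kernel at `-∞`. -/
theorem integrableOn_fracInt_polyVal {α : ℝ} (hα1 : α < 1) (K : ℕ) (c : ℕ → C(Icc 0 b, ℝ))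
    (p : Icc 0 b) (h0 : c 0 = 0) (x : ℝ) :
    IntegrableOn (fun y => polyVal K c p (Real.exp y) / (x - y) ^ α) (Iio x) ∧
    fracInt α (fun y => polyVal K c p (Real.exp y)) x =
      ∑ k ∈ Finset.range (K + 1), (k : ℝ) ^ (α - 1) * c k p * Real.exp x ^ k := by
  have hterm : ∀ k ∈ Finset.range (K + 1),
      IntegrableOn (fun y => c k p * Real.exp y ^ k / (x - y) ^ α) (Iio x) ∧
      fracInt α (fun y => c k p * Real.exp y ^ k) x =
        (k : ℝ) ^ (α - 1) * c k p * Real.exp x ^ k := by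
    intro k _
    rcases Nat.eq_zero_or_pos k with h | h
    · subst h
      constructor <;> simp [h0, fracInt]
    · have hk : (0 : ℝ) < k := Nat.cast_pos.2 h
      have h1 : ∀ x : ℝ, Real.exp x ^ k = Real.exp (k * x) := fun x => (Real.exp_nat_mul x k).symm
      simp only [h1]
      constructor
      · refine (integrableOn_kernel_iff α (fun y => c k p * Real.exp (k * y)) x).2
          (integrableOn_kernel_of_exp_bound (C := |c k p|)
            (g := fun y => c k p * Real.exp (k * y)) hα1 hk (by fun_prop) fun y _ => ?_)
        rw [abs_mul, abs_of_pos (Real.exp_pos _)]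
      · rw [fracInt_const_mul, fracInt_exp hα1 hk]
        ring
  unfold polyVal
  constructor
  · simp only [Finset.sum_div]
    exact integrable_finsetSum _ fun k hk => (hterm k hk).1
  · rw [fracInt]
    simp only [Finset.sum_div]
    rw [integral_finsetSum _ fun k hk => (hterm k hk).1, Finset.mul_sum]
    exact Finset.sum_congr rfl fun k hk => (hterm k hk).2

end

/-! ### Causal convolutions and the fixed point in a weighted space. -/

open BoundedContinuousFunction

section

variable {P : Type*} [TopologicalSpace P]

theorem integrableOn_conv {κ : ℝ → ℝ} (hκ : IntegrableOn κ (Ioi 0)) (F : (ℝ × P) →ᵇ ℝ) (x : ℝ)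
    (p : P) : IntegrableOn (fun z => κ z * F (x - z, p)) (Ioi 0) := by
  refine Integrable.mul_bdd (c := ‖F‖) hκ ?_ (Eventually.of_forall fun z => F.norm_coe_le_norm _)
  exact (Continuous.aestronglyMeasurable (by fun_prop))

/-- Causal convolution in the first variable with an integrable kernel on `(0, ∞)`. -/
noncomputable def conv [FirstCountableTopology P] (κ : ℝ → ℝ) (hκ : IntegrableOn κ (Ioi 0))
    (F : (ℝ × P) →ᵇ ℝ) : (ℝ × P) →ᵇ ℝ :=
  BoundedContinuousFunction.ofNormedAddCommGroup
    (fun q => ∫ z in Ioi (0 : ℝ), κ z * F (q.1 - z, q.2))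
    (by
      refine continuous_of_dominated (bound := fun z => ‖κ z‖ * ‖F‖) ?_ ?_ ?_ ?_
      · exact fun q => (integrableOn_conv hκ F q.1 q.2).aestronglyMeasurable
      · refine fun q => Eventually.of_forall fun z => ?_
        rw [norm_mul]
        exact mul_le_mul_of_nonneg_left (F.norm_coe_le_norm _) (norm_nonneg _)
      · exact hκ.norm.mul_const _
      · refine Eventually.of_forall fun z => ?_
        fun_prop)
    ((∫ z in Ioi (0 : ℝ), ‖κ z‖) * ‖F‖)
    (fun q => by
      rw [← integral_mul_const]
      refine norm_integral_le_of_norm_le (hκ.norm.mul_const _) (Eventually.of_forall fun z => ?_)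
      rw [norm_mul]
      exact mul_le_mul_of_nonneg_left (F.norm_coe_le_norm _) (norm_nonneg _))

variable [FirstCountableTopology P]

theorem conv_apply {κ : ℝ → ℝ} (hκ : IntegrableOn κ (Ioi 0)) (F : (ℝ × P) →ᵇ ℝ) (x : ℝ) (p : P) :
    conv κ hκ F (x, p) = ∫ z in Ioi (0 : ℝ), κ z * F (x - z, p) := rfl

theorem conv_sub {κ : ℝ → ℝ} (hκ : IntegrableOn κ (Ioi 0)) (F G : (ℝ × P) →ᵇ ℝ) :
    conv κ hκ (F - G) = conv κ hκ F - conv κ hκ G := by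
  ext ⟨x, p⟩
  rw [BoundedContinuousFunction.sub_apply, conv_apply, conv_apply, conv_apply,
    ← integral_sub (integrableOn_conv hκ F x p) (integrableOn_conv hκ G x p)]
  refine integral_congr_ae (Eventually.of_forall fun z => ?_)
  simp only [BoundedContinuousFunction.sub_apply]
  ring

theorem norm_conv_le {κ : ℝ → ℝ} (hκ : IntegrableOn κ (Ioi 0)) (F : (ℝ × P) →ᵇ ℝ) :
    ‖conv κ hκ F‖ ≤ (∫ z in Ioi (0 : ℝ), ‖κ z‖) * ‖F‖ :=
  BoundedContinuousFunction.norm_ofNormedAddCommGroup_le _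
    (mul_nonneg (integral_nonneg fun _ => norm_nonneg _) (norm_nonneg _)) _

end

/-- The kernel of integration in the space weighted by `e^{μ x}`. -/
noncomputable def expKernel (μ z : ℝ) : ℝ := Real.exp (-(μ * z))

/-- The kernel of fractional integration in the space weighted by `e^{μ x}`. -/
noncomputable def fracKernel (α μ z : ℝ) : ℝ :=
  1 / Real.Gamma (1 - α) * (Real.exp (-(μ * z)) * z ^ (-α))

theorem integrableOn_expKernel {μ : ℝ} (hμ : 0 < μ) : IntegrableOn (expKernel μ) (Ioi 0) := by
  unfold expKernel
  simpa only [neg_mul] using exp_neg_integrableOn_Ioi 0 hμ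

theorem integral_norm_expKernel {μ : ℝ} (hμ : 0 < μ) :
    ∫ z in Ioi (0 : ℝ), ‖expKernel μ z‖ = μ⁻¹ := by
  have : ∀ z, ‖expKernel μ z‖ = Real.exp (-μ * z) := fun z => by
    rw [expKernel, Real.norm_eq_abs, abs_of_pos (Real.exp_pos _), neg_mul]
  simp only [this]
  rw [integral_exp_mul_Ioi (by linarith) 0]
  simp [neg_div_neg_eq]

theorem integrableOn_fracKernel {α μ : ℝ} (hα1 : α < 1) (hμ : 0 < μ) :
    IntegrableOn (fracKernel α μ) (Ioi 0) :=
  (integrableOn_exp_mul_rpow hα1 hμ).const_mul _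

theorem integral_norm_fracKernel {α μ : ℝ} (hα1 : α < 1) (hμ : 0 < μ) :
    ∫ z in Ioi (0 : ℝ), ‖fracKernel α μ z‖ = μ ^ (α - 1) := by
  have hΓ : 0 < Real.Gamma (1 - α) := Real.Gamma_pos_of_pos (by linarith)
  have : ∀ z ∈ Ioi (0 : ℝ), ‖fracKernel α μ z‖ = fracKernel α μ z := fun z hz => by
    have : 0 < z ^ (-α) := Real.rpow_pos_of_pos hz _
    rw [Real.norm_eq_abs, abs_of_pos]
    unfold fracKernel
    positivity
  rw [setIntegral_congr_fun measurableSet_Ioi this]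
  unfold fracKernel
  rw [integral_const_mul, integral_exp_mul_rpow hα1 hμ]
  field_simp

section

variable {P : Type*} [TopologicalSpace P] [FirstCountableTopology P]

/-- Conjugating by `e^{μx}` adds the factor `e^{-μz}` to the kernel, which makes the fractional
integral a bounded operator on bounded continuous functions. -/
theorem fracInt_eq_conv {α μ : ℝ} (hα1 : α < 1) (hμ : 0 < μ) (F : (ℝ × P) →ᵇ ℝ) (p : P) (x : ℝ) :
    IntegrableOn (fun y => Real.exp (μ * y) * F (y, p) / (x - y) ^ α) (Iio x) ∧
    fracInt α (fun y => Real.exp (μ * y) * F (y, p)) x =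
      Real.exp (μ * x) * conv (fracKernel α μ) (integrableOn_fracKernel hα1 hμ) F (x, p) := by
  constructor
  · refine (integrableOn_kernel_iff α (fun y => Real.exp (μ * y) * F (y, p)) x).2
      (integrableOn_kernel_of_exp_bound (C := ‖F‖) (μ := μ)
        (g := fun y => Real.exp (μ * y) * F (y, p)) hα1 hμ
        (Continuous.continuousOn (by fun_prop)) fun y _ => ?_)
    rw [abs_mul, abs_of_pos (Real.exp_pos _), mul_comm]
    exact mul_le_mul_of_nonneg_right (F.norm_coe_le_norm _) (Real.exp_pos _).le
  · rw [fracInt_eq_Ioi, conv_apply, ← integral_const_mul, ← integral_const_mul]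
    refine setIntegral_congr_fun measurableSet_Ioi fun z _ => ?_
    simp only [exp_sub_mul, fracKernel]
    ring

/-- The weighted convolution is the primitive starting from `-∞`, written in the conjugated
variable; two of them recover `r` from `r''`. -/
theorem hasDerivAt_conv_expKernel {μ : ℝ} (hμ : 0 < μ) (F : (ℝ × P) →ᵇ ℝ) (p : P) (x : ℝ) :
    HasDerivAt (fun x => Real.exp (μ * x) * conv (expKernel μ) (integrableOn_expKernel hμ) F (x, p))
      (Real.exp (μ * x) * F (x, p)) x := by
  have hc : Continuous fun y => Real.exp (μ * y) * F (y, p) := by fun_prop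
  have hrep : ∀ x, Real.exp (μ * x) * conv (expKernel μ) (integrableOn_expKernel hμ) F (x, p) =
      ∫ y in Iic x, Real.exp (μ * y) * F (y, p) := by
    intro x
    rw [integral_Iic_eq_integral_Iio, setIntegral_Iio_eq_Ioi, conv_apply, ← integral_const_mul]
    refine setIntegral_congr_fun measurableSet_Ioi fun z _ => ?_
    simp only [exp_sub_mul, expKernel]
    ring
  have hint : ∀ x, IntegrableOn (fun y => Real.exp (μ * y) * F (y, p)) (Iic x) := by
    intro x
    refine Integrable.mul_bdd (c := ‖F‖) (integrableOn_exp_mul_Iic hμ x) ?_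
      (Eventually.of_forall fun z => F.norm_coe_le_norm _)
    exact Continuous.aestronglyMeasurable (by fun_prop)
  have h2 : ∀ y, ∫ y in Iic y, Real.exp (μ * y) * F (y, p) =
      (∫ y in Iic x, Real.exp (μ * y) * F (y, p)) +
        ∫ y in x..y, Real.exp (μ * y) * F (y, p) := by
    intro y
    rw [← intervalIntegral.integral_Iic_sub_Iic (hint x) (hint y)]
    ring
  simp only [hrep]
  refine HasDerivAt.congr_of_eventuallyEq ?_ (Eventually.of_forall h2)
  refine HasDerivAt.const_add _ ?_
  exact intervalIntegral.integral_hasDerivAt_right (hc.intervalIntegrable _ _)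
    (hc.stronglyMeasurableAtFilter _ _) hc.continuousAt

end

section FixedPoint

variable {P : Type*} [TopologicalSpace P] [FirstCountableTopology P]

/-- Unique solvability, in the space weighted by `e^{μ x}` and continuously in a parameter, of
`A r'' + B D^α[r] = G(x, p, r)`; the unknown is `F = e^{-μ x} r''`. -/
theorem exists_weighted_solution {α μ A₀ B₁ L C₀ : ℝ} (hα1 : α < 1) (hμ : 1 ≤ μ) (hA₀ : 0 < A₀)
    (hB₁ : 0 ≤ B₁) (hL : 0 ≤ L) (hμA : L + B₁ < A₀ * μ) (A B : P → ℝ) (hAc : Continuous A)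
    (hBc : Continuous B) (hA : ∀ p, A₀ ≤ A p) (hB0 : ∀ p, 0 ≤ B p) (hB : ∀ p, B p ≤ B₁)
    (G : ℝ × P → ℝ → ℝ) (hGc : Continuous fun q : (ℝ × P) × ℝ => G q.1 q.2)
    (hGL : ∀ q w w', |G q w - G q w'| ≤ L * |w - w'|)
    (hG0 : ∀ q, |G q 0| ≤ C₀ * Real.exp (μ * q.1)) :
    ∃ F : (ℝ × P) →ᵇ ℝ, ∀ x p, A p * (Real.exp (μ * x) * F (x, p)) +
      B p * (Real.exp (μ * x) * conv (fracKernel α μ)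
        (integrableOn_fracKernel hα1 (lt_of_lt_of_le one_pos hμ))
        (conv (expKernel μ) (integrableOn_expKernel (lt_of_lt_of_le one_pos hμ)) F) (x, p)) =
      G (x, p) (Real.exp (μ * x) *
        conv (expKernel μ) (integrableOn_expKernel (lt_of_lt_of_le one_pos hμ))
        (conv (expKernel μ) (integrableOn_expKernel (lt_of_lt_of_le one_pos hμ)) F) (x, p)) := by
  have hμ0 : 0 < μ := lt_of_lt_of_le one_pos hμ
  set J : ((ℝ × P) →ᵇ ℝ) → ((ℝ × P) →ᵇ ℝ) :=
    conv (expKernel μ) (integrableOn_expKernel hμ0) with hJ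
  set Jα : ((ℝ × P) →ᵇ ℝ) → ((ℝ × P) →ᵇ ℝ) :=
    conv (fracKernel α μ) (integrableOn_fracKernel hα1 hμ0) with hJα
  have hJs : ∀ F G, J (F - G) = J F - J G := conv_sub _
  have hJαs : ∀ F G, Jα (F - G) = Jα F - Jα G := conv_sub _
  have hJn : ∀ F, ‖J F‖ ≤ μ⁻¹ * ‖F‖ := fun F => by
    have := norm_conv_le (integrableOn_expKernel hμ0) F
    rwa [integral_norm_expKernel hμ0] at this
  have hJαn : ∀ F, ‖Jα F‖ ≤ μ ^ (α - 1) * ‖F‖ := fun F => by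
    have := norm_conv_le (integrableOn_fracKernel hα1 hμ0) F
    rwa [integral_norm_fracKernel hα1 hμ0] at this
  have hAp : ∀ p, 0 < A p := fun p => hA₀.trans_le (hA p)
  -- The equation divided by `A` and by the weight, solved for `F = e^{-μx} r''`; here `r` is
  -- recovered as `e^{μx} J (J F)`.
  set Φ : ((ℝ × P) →ᵇ ℝ) → ℝ × P → ℝ := fun F q =>
    (Real.exp (-(μ * q.1)) * G q (Real.exp (μ * q.1) * J (J F) q) - B q.2 * Jα (J F) q) / A q.2
    with hΦ
  have hρpos : 0 < μ ^ (α - 1) := Real.rpow_pos_of_pos hμ0 _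
  -- The contraction factor is uniform in the parameter, so one fixed point in functions of `(x, p)`
  -- gives the whole family and its joint continuity.
  obtain ⟨ρ, hρ⟩ : ∃ ρ, ρ = (L / μ / μ + B₁ * (μ⁻¹ * μ ^ (α - 1))) / A₀ := ⟨_, rfl⟩
  have hρ0 : 0 ≤ ρ := by rw [hρ]; positivity
  have hρ1 : ρ < 1 := by
    rw [hρ, div_lt_one hA₀]
    exact contraction_const_lt hα1 hB₁ hL hμ hμA
  have hlip : ∀ F F' q, |Φ F q - Φ F' q| ≤ ρ * ‖F - F'‖ := by
    intro F F' q
    have e1 : |Real.exp (-(μ * q.1)) * G q (Real.exp (μ * q.1) * J (J F) q) -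
        Real.exp (-(μ * q.1)) * G q (Real.exp (μ * q.1) * J (J F') q)| ≤
        L / μ / μ * ‖F - F'‖ := by
      rw [← mul_sub, abs_mul, abs_of_pos (Real.exp_pos _)]
      calc _ ≤ Real.exp (-(μ * q.1)) * (L * |Real.exp (μ * q.1) * J (J F) q -
            Real.exp (μ * q.1) * J (J F') q|) := by gcongr; exact hGL _ _ _
        _ = L * |J (J F) q - J (J F') q| := by
          rw [← mul_sub, abs_mul, abs_of_pos (Real.exp_pos _), Real.exp_neg]
          field_simp
        _ ≤ L * (μ⁻¹ * (μ⁻¹ * ‖F - F'‖)) := by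
          gcongr
          have : J (J F) q - J (J F') q = (J (J (F - F'))) q := by rw [hJs, hJs]; rfl
          rw [this]
          refine ((J (J (F - F'))).norm_coe_le_norm q).trans ((hJn _).trans ?_)
          gcongr
          exact hJn _
        _ = _ := by field_simp
    have e2 : |B q.2 * Jα (J F) q - B q.2 * Jα (J F') q| ≤
        B₁ * (μ⁻¹ * μ ^ (α - 1)) * ‖F - F'‖ := by
      rw [← mul_sub, abs_mul, abs_of_nonneg (hB0 _)]
      have : Jα (J F) q - Jα (J F') q = (Jα (J (F - F'))) q := by rw [hJs, hJαs]; rfl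
      rw [this]
      have h3 : |(Jα (J (F - F'))) q| ≤ μ ^ (α - 1) * (μ⁻¹ * ‖F - F'‖) := by
        refine ((Jα (J (F - F'))).norm_coe_le_norm q).trans ((hJαn _).trans ?_)
        gcongr
        exact hJn _
      calc B q.2 * |(Jα (J (F - F'))) q| ≤ B₁ * (μ ^ (α - 1) * (μ⁻¹ * ‖F - F'‖)) :=
            mul_le_mul (hB _) h3 (abs_nonneg _) hB₁
        _ = _ := by ring
    have e3 : Φ F q - Φ F' q =
        ((Real.exp (-(μ * q.1)) * G q (Real.exp (μ * q.1) * J (J F) q) -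
          Real.exp (-(μ * q.1)) * G q (Real.exp (μ * q.1) * J (J F') q)) -
        (B q.2 * Jα (J F) q - B q.2 * Jα (J F') q)) / A q.2 := by
      simp only [hΦ]; ring
    rw [e3, abs_div, abs_of_pos (hAp _), hρ]
    rw [div_mul_eq_mul_div]
    refine div_le_div₀ (by positivity) ((abs_sub _ _).trans ?_) hA₀ (hA _)
    linarith
  have hΦc : ∀ F, Continuous (Φ F) := by
    intro F
    have h1 : Continuous fun q : ℝ × P => G q (Real.exp (μ * q.1) * J (J F) q) :=
      hGc.comp (continuous_id.prodMk (by fun_prop))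
    refine Continuous.div ?_ (hAc.comp continuous_snd) fun q => (hAp _).ne'
    exact ((by fun_prop : Continuous fun q : ℝ × P => Real.exp (-(μ * q.1))).mul h1).sub
      ((hBc.comp continuous_snd).mul (Jα (J F)).continuous)
  have hΦ0 : ∀ q, |Φ 0 q| ≤ C₀ / A₀ := by
    intro q
    have hJ0 : J 0 = 0 := by simpa using hJs 0 0
    have hJα0 : Jα 0 = 0 := by simpa using hJαs 0 0
    have : Φ 0 q = Real.exp (-(μ * q.1)) * G q 0 / A q.2 := by
      simp [hΦ, hJ0, hJα0]
    rw [this, abs_div, abs_of_pos (hAp _), abs_mul, abs_of_pos (Real.exp_pos _)]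
    have h1 : Real.exp (-(μ * q.1)) * |G q 0| ≤ C₀ := by
      calc _ ≤ Real.exp (-(μ * q.1)) * (C₀ * Real.exp (μ * q.1)) := by gcongr; exact hG0 q
        _ = C₀ := by rw [Real.exp_neg]; field_simp
    exact div_le_div₀ ((by positivity : (0 : ℝ) ≤ _).trans h1) h1 hA₀ (hA _)
  let Ψ : ((ℝ × P) →ᵇ ℝ) → ((ℝ × P) →ᵇ ℝ) := fun F =>
    BoundedContinuousFunction.ofNormedAddCommGroup (Φ F) (hΦc F) (ρ * ‖F‖ + C₀ / A₀) (fun q => by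
      have h1 := hlip F 0 q
      rw [sub_zero] at h1
      have h2 : |Φ F q| ≤ |Φ F q - Φ 0 q| + |Φ 0 q| := by
        have := abs_add_le (Φ F q - Φ 0 q) (Φ 0 q)
        simpa using this
      rw [Real.norm_eq_abs]
      linarith [hΦ0 q])
  have hΨ : ∀ F q, Ψ F q = Φ F q := fun _ _ => rfl
  have hcontr : ContractingWith ⟨ρ, hρ0⟩ Ψ := by
    refine ⟨by exact_mod_cast hρ1, LipschitzWith.of_dist_le_mul fun F F' => ?_⟩
    rw [dist_eq_norm, dist_eq_norm]
    refine (BoundedContinuousFunction.norm_le (by positivity)).2 fun q => ?_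
    rw [BoundedContinuousFunction.sub_apply, hΨ, hΨ]
    exact hlip F F' q
  refine ⟨hcontr.fixedPoint, fun x p => ?_⟩
  have hfix := hcontr.fixedPoint_isFixedPt
  set F := hcontr.fixedPoint
  have h1 : Ψ F (x, p) = F (x, p) := by rw [hfix]
  rw [hΨ] at h1
  simp only [hΦ] at h1
  have hApp := hAp p
  rw [div_eq_iff hApp.ne'] at h1
  have h2 : Real.exp (μ * x) * (Real.exp (-(μ * x)) *
      G (x, p) (Real.exp (μ * x) * J (J F) (x, p))) = G (x, p) (Real.exp (μ * x) * J (J F) (x, p)) := by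
    rw [Real.exp_neg]; field_simp
  rw [← h2]
  have h3 : Real.exp (-(μ * x)) * G (x, p) (Real.exp (μ * x) * J (J F) (x, p)) =
      F (x, p) * A p + B p * Jα (J F) (x, p) := by linarith
  rw [h3]
  ring

end FixedPoint

/-! ### The base family: residual of the ansatz and construction of solutions. -/

section

variable {b : ℝ}

theorem abs_polyVal_le_max_mul (K : ℕ) (c : ℕ → C(Icc 0 b, ℝ)) (h0 : c 0 = 0) (p : Icc 0 b)
    {y : ℝ} (hy : 0 ≤ y) :
    |polyVal K c p y| ≤ (∑ k ∈ Finset.range (K + 1), ‖c k‖) * max 1 (y ^ K) * y := by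
  have hC : 0 ≤ ∑ k ∈ Finset.range (K + 1), ‖c k‖ := Finset.sum_nonneg fun _ _ => norm_nonneg _
  rcases le_total y 1 with h | h
  · refine (abs_polyVal_le_mul K c h0 p hy h).trans ?_
    refine mul_le_mul_of_nonneg_right ?_ hy
    exact le_mul_of_one_le_right hC (le_max_left _ _)
  · refine (abs_polyVal_le_max K c p hy).trans ?_
    exact le_mul_of_one_le_right (by positivity) h

/-- Isolates the leading term `-y`; it is applied to the differentiated ansatz to fix the sign of
the slope near `-∞`. -/
theorem abs_polyVal_add_le (K : ℕ) (hK : 1 ≤ K) (c : ℕ → C(Icc 0 b, ℝ)) (h0 : c 0 = 0)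
    (h1 : c 1 = -1) (p : Icc 0 b) {y : ℝ} (hy : 0 ≤ y) (hy1 : y ≤ 1) :
    |polyVal K c p y + y| ≤ (∑ k ∈ Finset.range (K + 1), ‖c k‖) * y ^ 2 := by
  have hs : polyVal K c p y + y =
      ∑ k ∈ Finset.range (K + 1), (c k p * y ^ k + if k = 1 then y else 0) := by
    rw [Finset.sum_add_distrib, Finset.sum_ite_eq' (Finset.range (K + 1)) 1 (fun _ => y),
      if_pos (Finset.mem_range.2 (by omega)), polyVal]
  rw [hs, Finset.sum_mul]
  refine (Finset.abs_sum_le_sum_abs _ _).trans (Finset.sum_le_sum fun k _ => ?_)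
  rcases lt_trichotomy k 1 with h | h | h
  · obtain rfl : k = 0 := by omega
    simp [h0]
  · subst h
    simp only [h1, ContinuousMap.neg_apply, ContinuousMap.one_apply, pow_one, if_true]
    rw [neg_one_mul, neg_add_cancel, abs_zero]
    positivity
  · rw [if_neg (by omega), add_zero, abs_mul, abs_of_nonneg (pow_nonneg hy k)]
    exact mul_le_mul ((c k).norm_coe_le_norm p) (pow_le_pow_of_le_one hy hy1 (by omega))
      (pow_nonneg hy k) (norm_nonneg _)

/-- The residual of the truncated ansatz in the truncated equation. -/
theorem exists_residual_bound {α φm φp N : ℝ} (hN : |φm| + 1 ≤ N) (K : ℕ)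
    (c : ℕ → C(Icc 0 b, ℝ)) (q : Icc 0 b × ℝ → ℝ) (h0 : c 0 = 0) (hq : Continuous q)
    (hcq : ∀ p y, slopeAt φm φp * polyVal K c p y + 3 * φm * polyVal K c p y ^ 2 +
      polyVal K c p y ^ 3 - polyVal K (fun k => symbC b α (slopeAt φm φp) k * c k) p y =
        y ^ (K + 1) * q (p, y)) :
    ∃ C, ∀ p, ∀ y ≥ 0, |hcut φm φp N (φm + polyVal K c p y) -
      polyVal K (fun k => symbC b α (slopeAt φm φp) k * c k) p y| ≤ C * y ^ (K + 1) := by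
  have hN0 : 0 ≤ N := by linarith [abs_nonneg φm]
  obtain ⟨Ch, hCh0, hCh⟩ := exists_abs_hcut_le (φm := φm) (φp := φp) hN0
  set d : ℕ → C(Icc 0 b, ℝ) := fun k => symbC b α (slopeAt φm φp) k * c k with hd
  obtain ⟨Cd, hCd⟩ : ∃ Cd, Cd = ∑ k ∈ Finset.range (K + 1), ‖d k‖ := ⟨_, rfl⟩
  obtain ⟨Cs, hCs⟩ : ∃ Cs, Cs = ∑ k ∈ Finset.range (K + 1), ‖c k‖ := ⟨_, rfl⟩
  have hCd0 : 0 ≤ Cd := hCd ▸ Finset.sum_nonneg fun _ _ => norm_nonneg _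
  have hCs0 : 0 ≤ Cs := hCs ▸ Finset.sum_nonneg fun _ _ => norm_nonneg _
  obtain ⟨Cq, hCq⟩ := (isCompact_univ.prod (isCompact_Icc (a := (0 : ℝ)) (b := 1))
    : IsCompact ((univ : Set (Icc 0 b)) ×ˢ Icc (0 : ℝ) 1)).exists_bound_of_continuousOn
    hq.continuousOn
  -- Three regimes: for `y ≤ 1` with the truncation inactive, the ansatz identity applies. For `y ≤
  -- 1` with it active, the ansatz has size at least `1`, so `Cs * y ≥ 1` and the crude bound
  -- suffices. For `y ≥ 1` everything grows at most like `y^(K+1)`.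
  refine ⟨max Cq ((Ch + Cd) * max 1 (Cs ^ (K + 1))), fun p y hy => ?_⟩
  have hyp : 0 ≤ y ^ (K + 1) := pow_nonneg hy _
  have habs : |hcut φm φp N (φm + polyVal K c p y) - polyVal K d p y| ≤ Ch + Cd * max 1 (y ^ K) := by
    refine (abs_sub _ _).trans (add_le_add (hCh _) ?_)
    rw [hCd]
    exact abs_polyVal_le_max K d p hy
  rcases le_total y 1 with h | h
  · rcases le_or_gt |φm + polyVal K c p y| N with hS | hS
    · rw [hcut_eq hS, h_add, hcq, abs_mul, abs_of_nonneg hyp, mul_comm]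
      refine mul_le_mul_of_nonneg_right ?_ hyp
      exact (hCq (p, y) ⟨mem_univ _, hy, h⟩).trans (le_max_left _ _)
    · have h1 : |polyVal K c p y| ≤ Cs * y := hCs ▸ abs_polyVal_le_mul K c h0 p hy h
      have h2 : 1 ≤ Cs * y := by
        have := abs_add_le φm (polyVal K c p y)
        linarith
      have h3 : 1 ≤ Cs ^ (K + 1) * y ^ (K + 1) := by
        rw [← mul_pow]; exact one_le_pow₀ h2
      have h4 : max 1 (y ^ K) = 1 := max_eq_left (pow_le_one₀ hy h)
      rw [h4, mul_one] at habs
      calc _ ≤ (Ch + Cd) * 1 := by linarith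
        _ ≤ (Ch + Cd) * (Cs ^ (K + 1) * y ^ (K + 1)) := by gcongr
        _ ≤ (Ch + Cd) * (max 1 (Cs ^ (K + 1)) * y ^ (K + 1)) := by
          gcongr; exact le_max_right _ _
        _ = (Ch + Cd) * max 1 (Cs ^ (K + 1)) * y ^ (K + 1) := by ring
        _ ≤ _ := mul_le_mul_of_nonneg_right (le_max_right _ _) hyp
  · have h1 : 1 ≤ y ^ (K + 1) := one_le_pow₀ h
    have h2 : max 1 (y ^ K) ≤ y ^ (K + 1) := max_le h1 (pow_le_pow_right₀ h (by omega))
    calc _ ≤ Ch + Cd * max 1 (y ^ K) := habs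
      _ ≤ Ch * y ^ (K + 1) + Cd * y ^ (K + 1) := by
        gcongr
        exact le_mul_of_one_le_right hCh0 h1
      _ = (Ch + Cd) * 1 * y ^ (K + 1) := by ring
      _ ≤ (Ch + Cd) * max 1 (Cs ^ (K + 1)) * y ^ (K + 1) := by
        gcongr; exact le_max_left _ _
      _ ≤ _ := mul_le_mul_of_nonneg_right (le_max_right _ _) hyp

end

/-- A family of solutions of the truncated equation on the whole line that leave `φm`, depending
continuously on the parameter. -/
theorem exists_base_family {α φm φp b N : ℝ} (hα0 : 0 < α) (hα1 : α < 1) (hb0 : 0 ≤ b)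
    (hb : b < slopeAt φm φp) (hN : |φm| + 1 ≤ N) :
    ∃ v : Icc 0 b → ℝ → ℝ, (Continuous fun q : Icc 0 b × ℝ => v q.1 q.2) ∧
      (∀ (p : Icc 0 b) (T : ℝ), GenSol α (slopeAt φm φp - p) p (hcut φm φp N) T (v p)) ∧
      (∀ T, ∃ C, ∀ p, ∀ x ≤ T, |v p x - φm| ≤ C * Real.exp x ∧
        |deriv (v p) x| ≤ C * Real.exp x ∧ |deriv (deriv (v p)) x| ≤ C * Real.exp x) ∧
      ∃ X, ∀ p, ∀ x ≤ X, deriv (v p) x < 0 := by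
  have hN0 : 0 ≤ N := by linarith [abs_nonneg φm]
  obtain ⟨a, ha⟩ : ∃ a, a = slopeAt φm φp := ⟨_, rfl⟩
  obtain ⟨L, hLdef⟩ : ∃ L, L = 3 * N ^ 2 + |waveSpeed φm φp| := ⟨_, rfl⟩
  have hL0 : 0 ≤ L := by rw [hLdef]; positivity
  have hab : 0 < a - b := by linarith
  -- The order of the ansatz fixes the weight rate `μ = K + 1`, which must beat the Lipschitz
  -- constant of the truncated nonlinearity uniformly for parameters in `[0, b]`.
  obtain ⟨K, hK⟩ := exists_nat_gt (max 1 ((L + b) / (a - b)))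
  have hK1 : 1 ≤ K := by
    have := (le_max_left _ _).trans_lt hK
    exact_mod_cast this.le
  obtain ⟨c, q, h0, h1, hq, hcq⟩ := exists_ansatz (b := b) (3 * φm) hα0 (hb) K hK1
  obtain ⟨C₀, hC₀⟩ := exists_residual_bound (φp := φp) hN K c q h0 hq hcq
  obtain ⟨μ, hμ⟩ : ∃ μ : ℝ, μ = K + 1 := ⟨_, rfl⟩
  have hμ1 : 1 ≤ μ := by rw [hμ]; linarith [(Nat.cast_nonneg K : (0 : ℝ) ≤ K)]
  have hμ0 : 0 < μ := by linarith
  have hμA : L + b < (a - b) * μ := by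
    have h2 := (le_max_right _ _).trans_lt hK
    rw [div_lt_iff₀ hab] at h2
    rw [hμ]
    linarith
  have hexp : ∀ x, Real.exp x ^ (K + 1) = Real.exp (μ * x) := fun x => by
    rw [← Real.exp_nat_mul, hμ]; push_cast; rfl
  set d : ℕ → C(Icc 0 b, ℝ) := fun k => symbC b α (slopeAt φm φp) k * c k with hd
  have hpc : ∀ e : ℕ → C(Icc 0 b, ℝ), Continuous fun q : ℝ × Icc 0 b =>
      polyVal K e q.2 (Real.exp q.1) := fun e =>
    (continuous_polyVal K e).comp
      (continuous_snd.prodMk (Real.continuous_exp.comp continuous_fst))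
  obtain ⟨F, hF⟩ := exists_weighted_solution (P := Icc 0 b) (α := α) (μ := μ) (A₀ := a - b)
    (B₁ := b) (L := L) (C₀ := C₀) hα1 hμ1 hab hb0 hL0 hμA (fun p => a - p) (fun p => p)
    (by fun_prop) (by fun_prop) (fun p => by linarith [p.2.2]) (fun p => p.2.1) (fun p => p.2.2)
    (fun q w => hcut φm φp N (φm + polyVal K c q.2 (Real.exp q.1) + w) -
      polyVal K d q.2 (Real.exp q.1))
    (by
      have e1 := (hpc c).comp (continuous_fst (X := ℝ × Icc 0 b) (Y := ℝ))
      have e2 := (hpc d).comp (continuous_fst (X := ℝ × Icc 0 b) (Y := ℝ))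
      exact ((continuous_hcut φm φp N).comp ((continuous_const.add e1).add continuous_snd)).sub e2)
    (fun q w w' => by
      have := abs_hcut_sub_le (φm := φm) (φp := φp) hN0
        (φm + polyVal K c q.2 (Real.exp q.1) + w) (φm + polyVal K c q.2 (Real.exp q.1) + w')
      rw [sub_sub_sub_cancel_right, hLdef]
      simpa only [add_sub_add_left_eq_sub] using this)
    (fun q => by
      have := hC₀ q.2 (Real.exp q.1) (Real.exp_pos _).le
      rw [hexp] at this
      simpa only [add_zero] using this)
  set J := conv (P := Icc 0 b) (expKernel μ) (integrableOn_expKernel hμ0) with hJ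
  set w1 : Icc 0 b → ℝ → ℝ := fun p x => polyVal K (fun k => (k : ℝ) • c k) p (Real.exp x)
  set w2 : Icc 0 b → ℝ → ℝ :=
    fun p x => polyVal K (fun k => (k : ℝ) • ((k : ℝ) • c k)) p (Real.exp x)
  set v : Icc 0 b → ℝ → ℝ := fun p x =>
    φm + polyVal K c p (Real.exp x) + Real.exp (μ * x) * J (J F) (x, p) with hv
  set v1 : Icc 0 b → ℝ → ℝ := fun p x => w1 p x + Real.exp (μ * x) * J F (x, p) with hv1
  set v2 : Icc 0 b → ℝ → ℝ := fun p x => w2 p x + Real.exp (μ * x) * F (x, p) with hv2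
  have hd1 : ∀ p x, HasDerivAt (v p) (v1 p x) x := fun p x =>
    ((hasDerivAt_polyVal_exp K c p x).const_add φm).add (hasDerivAt_conv_expKernel hμ0 (J F) p x)
  have hd2 : ∀ p x, HasDerivAt (v1 p) (v2 p x) x := fun p x =>
    (hasDerivAt_polyVal_exp K _ p x).add (hasDerivAt_conv_expKernel hμ0 F p x)
  have e1 : ∀ p, deriv (v p) = v1 p := fun p => funext fun x => (hd1 p x).deriv
  have e2 : ∀ p, deriv (v1 p) = v2 p := fun p => funext fun x => (hd2 p x).deriv
  have hv2c : ∀ p, Continuous (v2 p) := fun p => by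
    have := (hpc (fun k => (k : ℝ) • ((k : ℝ) • c k))).comp
      ((continuous_id (X := ℝ)).prodMk (continuous_const (y := p)))
    exact this.add (by fun_prop)
  have hk0 : (fun k : ℕ => (k : ℝ) • c k) 0 = 0 := by simp
  have hexpK : ∀ T x : ℝ, x ≤ T → Real.exp (μ * x) ≤ max 1 (Real.exp T ^ K) * Real.exp x := by
    intro T x hx
    rw [← hexp, pow_succ]
    refine mul_le_mul_of_nonneg_right (le_trans ?_ (le_max_right _ _)) (Real.exp_pos _).le
    gcongr
  refine ⟨v, ?_, fun p T => ?_, fun T => ?_, ?_⟩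
  · have e3 := (hpc c).comp (continuous_swap (X := Icc 0 b) (Y := ℝ))
    have e4 := ((J (J F)).continuous).comp (continuous_swap (X := Icc 0 b) (Y := ℝ))
    exact (continuous_const.add e3).add ((by fun_prop : Continuous fun q : Icc 0 b × ℝ =>
      Real.exp (μ * q.2)).mul e4)
  · have hi1 := fun x => integrableOn_fracInt_polyVal (α := α) hα1 K
      (fun k => (k : ℝ) • c k) p hk0 x
    have hi2 := fun x => fracInt_eq_conv (α := α) hα1 hμ0 (J F) p x
    refine ⟨contDiffOn_two_iff.2 ⟨?_, ?_, ?_⟩, fun x _ => ?_, fun x _ => ?_⟩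
    · exact fun x _ => (hd1 p x).differentiableAt.differentiableWithinAt
    · rw [e1]; exact fun x _ => (hd2 p x).differentiableAt.differentiableWithinAt
    · rw [e1, e2]; exact (hv2c p).continuousOn
    · rw [e1]
      have := (hi1 x).1.add (hi2 x).1
      refine this.congr_fun (fun y _ => ?_) measurableSet_Iio
      simp only [hv1, add_div, Pi.add_apply]
      rfl
    · rw [e1, e2]
      have hfr : fracInt α (v1 p) x = _ := fracInt_add (hi1 x).1 (hi2 x).1
      rw [hfr, (hi1 x).2, (hi2 x).2]
      have hFx := hF x p
      -- Since `k² · c_k` and `k^{α-1} · k · c_k` combine into the symbol times `c_k`, the operator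
      -- applied to the ansatz is exactly the polynomial subtracted in the equation for the
      -- remainder.
      have hs : (a - p) * w2 p x + p * ∑ k ∈ Finset.range (K + 1),
          (k : ℝ) ^ (α - 1) * ((k : ℝ) • c k) p * Real.exp x ^ k = polyVal K d p (Real.exp x) := by
        simp only [w2, polyVal, Finset.mul_sum, ← Finset.sum_add_distrib]
        refine Finset.sum_congr rfl fun k _ => ?_
        simp only [hd, ContinuousMap.smul_apply, ContinuousMap.mul_apply, smul_eq_mul]
        rcases Nat.eq_zero_or_pos k with hk | hk
        · subst hk; simp [h0]
        · have hk' : (0 : ℝ) < k := Nat.cast_pos.2 hk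
          have : symbC b α (slopeAt φm φp) k p = (a - p) * (k : ℝ) ^ 2 + p * (k : ℝ) ^ α := by
            rw [ha]; rfl
          rw [this, Real.rpow_sub hk', Real.rpow_one]
          field_simp
      simp only at hFx
      rw [← ha]
      simp only [hv2, hv]
      linarith
  · obtain ⟨S, hS⟩ : ∃ S : (ℕ → C(Icc 0 b, ℝ)) → ℝ, S = fun e =>
      ∑ k ∈ Finset.range (K + 1), ‖e k‖ := ⟨_, rfl⟩
    have hS0 : ∀ e, 0 ≤ S e := fun e => by rw [hS]; exact Finset.sum_nonneg fun _ _ => norm_nonneg _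
    obtain ⟨M, hM⟩ : ∃ M, M = max 1 (Real.exp T ^ K) := ⟨_, rfl⟩
    have hM0 : 0 < M := hM ▸ lt_of_lt_of_le one_pos (le_max_left _ _)
    have hpoly : ∀ e : ℕ → C(Icc 0 b, ℝ), e 0 = 0 → ∀ p, ∀ x ≤ T,
        |polyVal K e p (Real.exp x)| ≤ S e * M * Real.exp x := by
      intro e he p x hx
      refine (abs_polyVal_le_max_mul K e he p (Real.exp_pos x).le).trans ?_
      rw [hS, hM]
      have : 0 ≤ ∑ k ∈ Finset.range (K + 1), ‖e k‖ := Finset.sum_nonneg fun _ _ => norm_nonneg _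
      gcongr
    have hrem : ∀ (E : BoundedContinuousFunction (ℝ × Icc 0 b) ℝ) p, ∀ x ≤ T,
        |Real.exp (μ * x) * E (x, p)| ≤ ‖E‖ * M * Real.exp x := by
      intro E p x hx
      rw [abs_mul, abs_of_pos (Real.exp_pos _)]
      calc _ ≤ (M * Real.exp x) * ‖E‖ :=
            mul_le_mul (hM ▸ hexpK T x hx) (E.norm_coe_le_norm _) (abs_nonneg _) (by positivity)
        _ = _ := by ring
    set c1 : ℕ → C(Icc 0 b, ℝ) := fun k => (k : ℝ) • c k
    set c2 : ℕ → C(Icc 0 b, ℝ) := fun k => (k : ℝ) • ((k : ℝ) • c k)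
    have hc10 : c1 0 = 0 := hk0
    have hc20 : c2 0 = 0 := by simp [c2]
    refine ⟨(S c + S c1 + S c2 + ‖F‖ + ‖J F‖ + ‖J (J F)‖) * M, fun p x hx => ?_⟩
    have hex := Real.exp_pos x
    have hMe : 0 < M * Real.exp x := by positivity
    have n0 := mul_nonneg (hS0 c) hMe.le
    have n1 := mul_nonneg (hS0 c1) hMe.le
    have n2 := mul_nonneg (hS0 c2) hMe.le
    have m0 := mul_nonneg (norm_nonneg F) hMe.le
    have m1 := mul_nonneg (norm_nonneg (J F)) hMe.le
    have m2 := mul_nonneg (norm_nonneg (J (J F))) hMe.le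
    rw [e1, e2]
    refine ⟨?_, ?_, ?_⟩
    · have : v p x - φm = polyVal K c p (Real.exp x) + Real.exp (μ * x) * J (J F) (x, p) := by
        simp only [hv]; ring
      rw [this]
      refine (abs_add_le _ _).trans ?_
      linarith [hpoly c h0 p x hx, hrem (J (J F)) p x hx]
    · refine (abs_add_le _ _).trans ?_
      linarith [hpoly c1 hc10 p x hx, hrem (J F) p x hx]
    · refine (abs_add_le _ _).trans ?_
      linarith [hpoly c2 hc20 p x hx, hrem F p x hx]
  · set c1 : ℕ → C(Icc 0 b, ℝ) := fun k => (k : ℝ) • c k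
    have hc11 : c1 1 = -1 := by simp [c1, h1]
    obtain ⟨C, hC⟩ : ∃ C, C = (∑ k ∈ Finset.range (K + 1), ‖c1 k‖) + ‖J F‖ + 1 := ⟨_, rfl⟩
    have hs0 : 0 ≤ ∑ k ∈ Finset.range (K + 1), ‖c1 k‖ := Finset.sum_nonneg fun _ _ => norm_nonneg _
    have hC1 : 1 ≤ C := by rw [hC]; linarith [norm_nonneg (J F)]
    have hC0 : 0 < C := by linarith
    -- Beyond this point to the left `C e^{2x} ≤ e^x / 2`, so the leading term `-e^x` decides the
    -- sign of the slope for all parameters.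
    refine ⟨-Real.log (2 * C), fun p x hx => ?_⟩
    have hex := Real.exp_pos x
    have hxC : Real.exp x * (2 * C) ≤ 1 := by
      have : Real.exp x ≤ Real.exp (-Real.log (2 * C)) := Real.exp_le_exp.2 hx
      rw [Real.exp_neg, Real.exp_log (by positivity)] at this
      calc _ ≤ (2 * C)⁻¹ * (2 * C) := by gcongr
        _ = 1 := by field_simp
    have hx1 : Real.exp x ≤ 1 := by nlinarith
    have b1 := abs_polyVal_add_le K hK1 c1 hk0 hc11 p hex.le hx1
    have b2 : |Real.exp (μ * x) * J F (x, p)| ≤ Real.exp x ^ 2 * ‖J F‖ := by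
      rw [abs_mul, abs_of_pos (Real.exp_pos _), ← hexp]
      exact mul_le_mul (pow_le_pow_of_le_one hex.le hx1 (by omega)) ((J F).norm_coe_le_norm _)
        (abs_nonneg _) (by positivity)
    rw [e1]
    have b3 : v1 p x = (polyVal K c1 p (Real.exp x) + Real.exp x) +
        Real.exp (μ * x) * J F (x, p) - Real.exp x := by
      simp only [hv1, w1]; ring
    have b4 : v1 p x ≤ C * Real.exp x ^ 2 - Real.exp x := by
      rw [b3, hC]
      have := (abs_le.1 b1).2
      have := (abs_le.1 b2).2
      nlinarith [sq_nonneg (Real.exp x)]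
    have b5 : C * Real.exp x ^ 2 ≤ Real.exp x / 2 := by
      have : Real.exp x * (Real.exp x * (2 * C)) ≤ Real.exp x * 1 := by gcongr
      linarith
    linarith

/-! ### Integrability of arbitrary trajectories at `-∞`. -/

/-- The general device for turning a one-sided bound of a primitive into integrability on a
half-line; no limit of the primitive need be known beforehand. -/
theorem integrableOn_Iic_deriv_of_nonneg {f f' : ℝ → ℝ} {a m : ℝ}
    (hf : ∀ x ≤ a, HasDerivAt f (f' x) x) (hc : ContinuousOn f' (Iic a))
    (h0 : ∀ x ≤ a, 0 ≤ f' x) (hm : ∀ x ≤ a, m ≤ f x) :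
    IntegrableOn f' (Iic a) ∧ ∫ x in Iic a, f' x ≤ f a - m := by
  have hi : ∀ x ≤ a, IntervalIntegrable f' volume x a := fun x hx =>
    (hc.mono (by rw [uIcc_of_le hx]; exact Icc_subset_Iic_self)).intervalIntegrable
  have hval : ∀ x ≤ a, ∫ y in x..a, f' y = f a - f x := fun x hx =>
    intervalIntegral.integral_eq_sub_of_hasDerivAt
      (fun y hy => hf y (by rw [uIcc_of_le hx] at hy; exact hy.2)) (hi x hx)
  have hint : IntegrableOn f' (Iic a) := by
    refine integrableOn_Iic_of_intervalIntegral_norm_bounded (l := atTop) (a := fun n : ℕ => a - n)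
      (f a - m) a
      (fun n => (intervalIntegrable_iff_integrableOn_Ioc_of_le (by simp)).1 (hi _ (by simp)))
      (tendsto_atBot_add_const_left _ _
        (tendsto_neg_atTop_atBot.comp tendsto_natCast_atTop_atTop)) ?_
    refine Eventually.of_forall fun n => ?_
    have hn : a - n ≤ a := by simp
    have : ∫ y in (a - n)..a, ‖f' y‖ = ∫ y in (a - n)..a, f' y := by
      refine intervalIntegral.integral_congr fun y hy => ?_
      rw [uIcc_of_le hn] at hy
      simp only [Real.norm_eq_abs]
      exact abs_of_nonneg (h0 y hy.2)
    rw [this, hval _ hn]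
    linarith [hm (a - n) hn]
  refine ⟨hint, ?_⟩
  refine le_of_tendsto (intervalIntegral_tendsto_integral_Iic a hint tendsto_id) ?_
  filter_upwards [eventually_le_atBot a] with x hx
  rw [id, hval x hx]
  linarith [hm x hx]

/-- `u` decreases from `φm` on `(-∞, X)`, with bounded first and second derivatives. -/
structure Leaving (φm : ℝ) (X C : ℝ) (u : ℝ → ℝ) : Prop where
  lim : Tendsto u atBot (𝓝 φm)
  neg : ∀ x < X, deriv u x < 0
  bd1 : ∀ x < X, |deriv u x| ≤ C
  bd2 : ∀ x < X, |deriv (deriv u) x| ≤ C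

/-- Interpolation between the small oscillation of `u` and the bounded second derivative, on a
window proportional to `ε`. -/
theorem Leaving.tendsto_deriv {α A B T φm X C : ℝ} {H u : ℝ → ℝ} (h : Leaving φm X C u)
    (hu : GenSol α A B H T u) : Tendsto (deriv u) atBot (𝓝 0) := by
  have hC : 0 ≤ C := (abs_nonneg _).trans (h.bd1 (X - 1) (by linarith))
  rw [Metric.tendsto_nhds]
  intro ε hε
  set δ := ε / (2 * (C + 1)) with hδ
  have hδ0 : 0 < δ := by positivity
  have hM0 : 0 < ε * δ / 8 := by positivity
  have hev : ∀ᶠ x in atBot, |u x - φm| < ε * δ / 8 := by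
    have := (Metric.tendsto_nhds.1 h.lim) _ hM0
    simpa only [Real.dist_eq] using this
  obtain ⟨Y, hY⟩ := eventually_atBot.1 hev
  filter_upwards [eventually_le_atBot Y, eventually_lt_atBot X, eventually_lt_atBot T] with
    x hxY hxX hxT
  have := abs_deriv_le_of_abs_deriv2_le (u := u) (u' := deriv u) (u'' := deriv (deriv u))
    (c := φm) (y := x) (M := ε * δ / 8) (Q := C) hδ0
    (fun z hz => hu.hasDerivAt (hz.2.trans_lt hxT))
    (fun z hz => hu.hasDerivAt_deriv (hz.2.trans_lt hxT))
    (fun z hz => (hY z (hz.2.trans hxY)).le) (fun z hz => h.bd2 z (hz.2.trans_lt hxX))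
  rw [Real.dist_eq, sub_zero]
  refine this.trans_lt ?_
  have e1 : 2 * (ε * δ / 8) / δ = ε / 4 := by field_simp; norm_num
  have e2 : C * δ ≤ ε / 2 := by
    have : C * δ = C / (C + 1) * (ε / 2) := by rw [hδ]; field_simp
    rw [this]
    have h3 : C / (C + 1) ≤ 1 := by rw [div_le_one (by linarith)]; linarith
    nlinarith
  rw [e1]
  linarith

/-- `w` is positive on `(-∞, 0]` and small, together with its integral and first moment. -/
structure SmallTail (η : ℝ) (w : ℝ → ℝ) : Prop where
  pos : ∀ x ≤ 0, 0 < w x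
  le : ∀ x ≤ 0, w x ≤ η
  int : IntegrableOn w (Iic 0)
  int_le : ∫ x in Iic 0, w x ≤ η
  moment : IntegrableOn (fun x => -x * w x) (Iic 0)
  moment_le : ∫ x in Iic 0, -x * w x ≤ η

/-- A priori integrability of a monotone trajectory at `-∞`. -/
theorem exists_tail_bound {α A B φm φp X T C : ℝ} {u : ℝ → ℝ} (hα0 : 0 < α) (hα1 : α < 1)
    (hA : 0 < A) (hB : 0 ≤ B) (ha : 0 < slopeAt φm φp)
    (hu : GenSol α A B (h φm φp) T u) (hl : Leaving φm X C u) :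
    ∃ X₁ K, 0 ≤ K ∧ X₁ < T ∧ X₁ < X ∧ (∀ x ≤ X₁, 0 < φm - u x) ∧ ∀ x ≤ X₁,
      IntegrableOn (fun y => φm - u y) (Iic x) ∧
      ∫ y in Iic x, (φm - u y) ≤ K * ((φm - u x) + -deriv u x) := by
  have hΓ : 0 < Real.Gamma (1 - α) := Real.Gamma_pos_of_pos (by linarith)
  obtain ⟨a, hadef⟩ : ∃ a, a = slopeAt φm φp := ⟨_, rfl⟩
  rw [← hadef] at ha
  have h1α : 0 < 1 - α := by linarith
  -- the cut-off length
  obtain ⟨Z, hZ0, hZ⟩ : ∃ Z : ℝ, 0 < Z ∧ B / Real.Gamma (1 - α) * Z ^ (-α) ≤ a / 4 := by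
    have h0 : Tendsto (fun z : ℝ => B / Real.Gamma (1 - α) * z ^ (-α)) atTop (𝓝 0) := by
      simpa using (tendsto_rpow_neg_atTop hα0).const_mul (B / Real.Gamma (1 - α))
    have := h0.eventually (gt_mem_nhds (by positivity : (0 : ℝ) < a / 4))
    obtain ⟨Z, hZ1, hZ2⟩ := (this.and (eventually_gt_atTop (0 : ℝ))).exists
    exact ⟨Z, hZ2, hZ1.le⟩
  have hev : ∀ᶠ x in atBot, φm - u x < a / (6 * (|φm| + 1)) := by
    have h1 : Tendsto (fun x => φm - u x) atBot (𝓝 (φm - φm)) := tendsto_const_nhds.sub hl.lim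
    rw [sub_self] at h1
    exact h1.eventually (gt_mem_nhds (by positivity))
  obtain ⟨Y, hY⟩ := eventually_atBot.1 hev
  set X₁ := min Y (min (X - 1) (T - 1)) with hX₁
  have hX₁Y : X₁ ≤ Y := min_le_left _ _
  have hX₁X : X₁ < X := ((min_le_right _ _).trans (min_le_left _ _)).trans_lt (by linarith)
  have hX₁T : X₁ < T := ((min_le_right _ _).trans (min_le_right _ _)).trans_lt (by linarith)
  set X₂ := min X T with hX₂
  have hX₂X : X₂ ≤ X := min_le_left _ _
  have hX₂T : X₂ ≤ T := min_le_right _ _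
  have hX₁X₂ : X₁ < X₂ := lt_min hX₁X hX₁T
  set q : ℝ → ℝ := fun x => φm - u x with hq
  set q' : ℝ → ℝ := fun x => -deriv u x with hq'
  have hdq : ∀ x < X₂, HasDerivAt q (q' x) x := fun x hx =>
    (hu.hasDerivAt (hx.trans_le hX₂T)).const_sub φm
  have hdq' : ∀ x < X₂, HasDerivAt q' (-deriv (deriv u) x) x := fun x hx =>
    (hu.hasDerivAt_deriv (hx.trans_le hX₂T)).neg
  have hq'pos : ∀ x < X₂, 0 < q' x := fun x hx => neg_pos.2 (hl.neg x (hx.trans_le hX₂X))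
  have hqpos : ∀ x < X₂, 0 < q x := fun x hx => by
    have := lt_of_deriv_neg_of_tendsto hl.lim (u' := deriv u) (x := x)
      (fun y hy => hu.hasDerivAt ((hy.trans_lt hx).trans_le hX₂T))
      fun y hy => hl.neg y ((hy.trans hx).trans_le hX₂X)
    exact sub_pos.2 this
  have hqmono : ∀ x y, x ≤ y → y < X₂ → q x ≤ q y := fun x y hxy hy =>
    le_of_hasDerivAt_nonneg hxy (fun z hz => hdq z (hz.2.trans_lt hy))
      fun z hz => (hq'pos z (hz.2.trans_lt hy)).le
  have hC : ∀ x < X₂, |q' x| ≤ C := fun x hx => by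
    simp only [hq', abs_neg]; exact hl.bd1 x (hx.trans_le hX₂X)
  have hqlim : Tendsto q atBot (𝓝 0) := by
    have h1 : Tendsto (fun x => φm - u x) atBot (𝓝 (φm - φm)) := tendsto_const_nhds.sub hl.lim
    rwa [sub_self] at h1
  have hqc : ContinuousOn q (Iio X₂) := fun x hx => (hdq x hx).continuousAt.continuousWithinAt
  have hq'c : ContinuousOn q' (Iio X₂) := fun x hx => (hdq' x hx).continuousAt.continuousWithinAt
  -- near part of the fractional integral
  have hzi : IntegrableOn (fun z : ℝ => z ^ (-α)) (Ioc 0 Z) :=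
    (intervalIntegrable_iff_integrableOn_Ioc_of_le hZ0.le).1
      (intervalIntegral.intervalIntegrable_rpow' (by linarith))
  have hzv : ∫ z in Ioc 0 Z, z ^ (-α) = Z ^ (1 - α) / (1 - α) := by
    rw [← intervalIntegral.integral_of_le hZ0.le, integral_rpow (Or.inl (by linarith)),
      Real.zero_rpow (by linarith)]
    rw [show -α + 1 = 1 - α by ring, sub_zero]
  have hmeas : ∀ (f : ℝ → ℝ), ContinuousOn f (Iio X₂) → ∀ x < X₂,
      AEStronglyMeasurable (fun z => f (x - z) * z ^ (-α)) (volume.restrict (Ioc 0 Z)) := by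
    intro f hf x hx
    refine ContinuousOn.aestronglyMeasurable (fun z hz => ?_) measurableSet_Ioc
    refine ContinuousAt.continuousWithinAt (ContinuousAt.mul ?_ ?_)
    · exact ContinuousAt.comp (f := fun z => x - z) (g := f)
        (hf.continuousAt (Iio_mem_nhds (by linarith [hz.1]))) (by fun_prop)
    · exact Real.continuousAt_rpow_const z _ (Or.inl hz.1.ne')
  have hbdint : ∀ (f : ℝ → ℝ) (M : ℝ), ContinuousOn f (Iio X₂) → ∀ x < X₂,
      (∀ y < x, |f y| ≤ M) → IntegrableOn (fun z => f (x - z) * z ^ (-α)) (Ioc 0 Z) := by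
    intro f M hf x hx hM
    refine Integrable.mono' (hzi.const_mul M) (hmeas f hf x hx)
      ((ae_restrict_iff' measurableSet_Ioc).2 (Eventually.of_forall fun z hz => ?_))
    have h0 : 0 < z ^ (-α) := Real.rpow_pos_of_pos hz.1 _
    rw [norm_mul, Real.norm_eq_abs, Real.norm_eq_abs, abs_of_pos h0]
    exact mul_le_mul_of_nonneg_right (hM _ (by linarith [hz.1])) h0.le
  -- The near part of the non-local term, `Nf`, is an exact derivative, namely that of `Yf`; it can
  -- therefore be moved into the quantity `Ξ` that is monotone.
  set Yf : ℝ → ℝ := fun x => ∫ z in Ioc 0 Z, q (x - z) * z ^ (-α) with hYf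
  set Nf : ℝ → ℝ := fun x => ∫ z in Ioc 0 Z, q' (x - z) * z ^ (-α) with hNf
  have hqbd : ∀ x < X₂, ∀ y < x, |q y| ≤ q x := fun x hx y hy => by
    rw [abs_of_pos (hqpos y (hy.trans hx))]; exact hqmono y x hy.le hx
  have hYd : ∀ x < X₂, HasDerivAt Yf (Nf x) x := by
    intro x hx
    refine (hasDerivAt_integral_of_dominated_loc_of_deriv_le (s := Iio X₂)
      (F := fun x z => q (x - z) * z ^ (-α)) (F' := fun x z => q' (x - z) * z ^ (-α))
      (bound := fun z => C * z ^ (-α)) (Iio_mem_nhds hx) ?_ ?_ ?_ ?_ ?_ ?_).2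
    · filter_upwards [Iio_mem_nhds hx] with y hy using hmeas q hqc y hy
    · exact hbdint q (q x) hqc x hx (hqbd x hx)
    · exact hmeas q' hq'c x hx
    · refine (ae_restrict_iff' measurableSet_Ioc).2 (Eventually.of_forall fun z hz y hy => ?_)
      have hy' : y < X₂ := hy
      have h0 : 0 < z ^ (-α) := Real.rpow_pos_of_pos hz.1 _
      rw [norm_mul, Real.norm_eq_abs, Real.norm_eq_abs, abs_of_pos h0]
      exact mul_le_mul_of_nonneg_right (hC _ (by linarith [hz.1])) h0.le
    · exact hzi.const_mul C
    · refine (ae_restrict_iff' measurableSet_Ioc).2 (Eventually.of_forall fun z hz y hy => ?_)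
      have hy' : y < X₂ := hy
      exact ((hdq (y - z) (by linarith [hz.1])).comp_sub_const y z).mul_const _
  have hY0 : ∀ x < X₂, 0 ≤ Yf x := fun x hx =>
    setIntegral_nonneg measurableSet_Ioc fun z hz =>
      mul_nonneg (hqpos _ (by linarith [hz.1])).le (Real.rpow_nonneg hz.1.le _)
  have hYle : ∀ x < X₂, Yf x ≤ q x * (Z ^ (1 - α) / (1 - α)) := by
    intro x hx
    rw [← hzv, ← integral_const_mul]
    refine setIntegral_mono_on (hbdint q (q x) hqc x hx (hqbd x hx)) (hzi.const_mul _)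
      measurableSet_Ioc fun z hz => ?_
    exact mul_le_mul_of_nonneg_right (hqmono _ _ (by linarith [hz.1]) hx)
      (Real.rpow_nonneg hz.1.le _)
  -- far part
  have hfar : ∀ x < X₂, ∫ z in Ioi Z, q' (x - z) * z ^ (-α) ≤ Z ^ (-α) * q x := by
    intro x hx
    have hder : ∀ z ∈ Ici Z, HasDerivAt (fun z => -q (x - z)) (q' (x - z)) z := fun z hz => by
      have hz0 : Z ≤ z := hz
      exact ((hdq (x - z) (by linarith)).comp_const_sub x z).neg.congr_deriv (neg_neg _)
    have hp : ∀ z ∈ Ioi Z, 0 ≤ q' (x - z) := fun z hz => by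
      have hz0 : Z < z := hz
      exact (hq'pos _ (by linarith)).le
    have hlim : Tendsto (fun z => -q (x - z)) atTop (𝓝 0) := by
      have : Tendsto (fun z : ℝ => x - z) atTop atBot :=
        tendsto_atBot_add_const_left _ x tendsto_neg_atTop_atBot
      simpa using (hqlim.comp this).neg
    have hi := integrableOn_Ioi_deriv_of_nonneg' hder hp hlim
    have hv := integral_Ioi_of_hasDerivAt_of_nonneg' hder hp hlim
    have hmono : ∫ z in Ioi Z, q' (x - z) * z ^ (-α) ≤ ∫ z in Ioi Z, Z ^ (-α) * q' (x - z) := by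
      have hle : ∀ z ∈ Ioi Z, q' (x - z) * z ^ (-α) ≤ Z ^ (-α) * q' (x - z) := fun z hz => by
        have hz0 : Z < z := hz
        rw [mul_comm]
        exact mul_le_mul_of_nonneg_right
          (Real.rpow_le_rpow_of_nonpos hZ0 hz0.le (by linarith)) (hp z hz)
      refine integral_mono_of_nonneg ?_ (hi.const_mul _) ?_
      · refine (ae_restrict_iff' measurableSet_Ioi).2 (Eventually.of_forall fun z hz => ?_)
        have hz0 : Z < z := hz
        exact mul_nonneg (hp z hz) (Real.rpow_nonneg (by linarith) _)
      · exact (ae_restrict_iff' measurableSet_Ioi).2 (Eventually.of_forall hle)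
    refine hmono.trans ?_
    rw [integral_const_mul, hv, zero_sub, neg_neg]
    exact mul_le_mul_of_nonneg_left (hqmono _ _ (by linarith) hx) (Real.rpow_nonneg hZ0.le _)
  have hfrac : ∀ x < X₂, -fracInt α (deriv u) x ≤
      1 / Real.Gamma (1 - α) * (Nf x + Z ^ (-α) * q x) := by
    intro x hx
    have hint := (integrableOn_kernel_iff α (deriv u) x).1 (hu.integrable x (hx.trans_le hX₂T))
    have hint' : IntegrableOn (fun z => q' (x - z) * z ^ (-α)) (Ioi 0) := by
      refine hint.neg.congr_fun (fun z _ => ?_) measurableSet_Ioi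
      simp only [Pi.neg_apply, hq', neg_mul]
    have hneg : -fracInt α (deriv u) x =
        1 / Real.Gamma (1 - α) * ∫ z in Ioi (0 : ℝ), q' (x - z) * z ^ (-α) := by
      rw [fracInt_eq_Ioi, ← mul_neg, ← integral_neg]
      simp only [hq', neg_mul]
    rw [hneg, ← Ioc_union_Ioi_eq_Ioi hZ0.le,
      setIntegral_union (Ioc_disjoint_Ioi le_rfl) measurableSet_Ioi
        (hint'.mono_set Ioc_subset_Ioi_self) (hint'.mono_set (Ioi_subset_Ioi hZ0.le))]
    refine mul_le_mul_of_nonneg_left ?_ (by positivity)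
    exact add_le_add le_rfl (hfar x hx)
  -- the differential inequality
  set Ξ : ℝ → ℝ := fun x => A * q' x + B / Real.Gamma (1 - α) * Yf x with hΞ
  have hΞd : ∀ x < X₂, HasDerivAt Ξ
      (A * (-deriv (deriv u) x) + B / Real.Gamma (1 - α) * Nf x) x := fun x hx =>
    ((hdq' x hx).const_mul A).add ((hYd x hx).const_mul _)
  -- Of the linear term `a q`, one half absorbs the quadratic term near `φm` and one quarter the far
  -- part of the kernel, by the choice of `Z`. The last quarter remains.
  have hineq : ∀ x ≤ X₁, a / 4 * q x ≤
      A * (-deriv (deriv u) x) + B / Real.Gamma (1 - α) * Nf x := by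
    intro x hx
    have hx2 : x < X₂ := hx.trans_lt hX₁X₂
    have hqx := hqpos x hx2
    have e := hu.equation x (hx2.trans_le hX₂T)
    have e1 : h φm φp (u x) = -(a * q x) + 3 * φm * q x ^ 2 - q x ^ 3 := by
      have : u x = φm + -q x := by simp only [hq]; ring
      rw [this, h_add, hadef]
      ring
    have e2 : q x * (6 * (|φm| + 1)) ≤ a := by
      have := hY x (hx.trans hX₁Y)
      rw [lt_div_iff₀ (by positivity)] at this
      exact this.le
    have e3 : 3 * φm * q x ^ 2 ≤ a / 2 * q x := by
      have h1 : φm * q x ≤ (|φm| + 1) * q x :=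
        mul_le_mul_of_nonneg_right (by linarith [le_abs_self φm]) hqx.le
      have h2 : 3 * (φm * q x) ≤ a / 2 := by linarith
      nlinarith
    have e4 : 0 ≤ q x ^ 3 := by positivity
    have e5 := mul_le_mul_of_nonneg_left (hfrac x hx2) hB
    have e6 : B * (1 / Real.Gamma (1 - α) * (Nf x + Z ^ (-α) * q x)) =
        B / Real.Gamma (1 - α) * Nf x + B / Real.Gamma (1 - α) * Z ^ (-α) * q x := by ring
    have e7 : B / Real.Gamma (1 - α) * Z ^ (-α) * q x ≤ a / 4 * q x :=
      mul_le_mul_of_nonneg_right hZ hqx.le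
    linarith
  set Kc := 4 / a * max A (B / Real.Gamma (1 - α) * (Z ^ (1 - α) / (1 - α))) with hKc
  have hZp : 0 < Z ^ (1 - α) := Real.rpow_pos_of_pos hZ0 _
  refine ⟨X₁, Kc, by positivity, hX₁T, hX₁X, fun x hx => hqpos x (hx.trans_lt hX₁X₂),
    fun x hx => ?_⟩
  have hx2 : x < X₂ := hx.trans_lt hX₁X₂
  -- `∫ q` is controlled by `Ξ`
  have hQd : ∀ y ≤ x, HasDerivAt (fun y => ∫ z in x..y, q z) (q y) y := by
    intro y hy
    have hsub : uIcc x y ⊆ Iio X₂ := fun z hz => by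
      rw [uIcc_of_ge hy] at hz
      exact hz.2.trans_lt hx2
    refine intervalIntegral.integral_hasDerivAt_right ((hqc.mono hsub).intervalIntegrable) ?_
      (hdq y (hy.trans_lt hx2)).continuousAt
    exact hqc.stronglyMeasurableAtFilter isOpen_Iio y (hy.trans_lt hx2)
  have hres := integrableOn_Iic_deriv_of_nonneg (f := fun y => ∫ z in x..y, q z) (f' := q) (a := x)
    (m := -(4 / a * Ξ x)) hQd (hqc.mono (Iic_subset_Iio.2 hx2))
    (fun y hy => (hqpos y (hy.trans_lt hx2)).le) (fun y hy => by
      have hm := le_of_hasDerivAt_nonneg (f := fun y => Ξ y - a / 4 * ∫ z in x..y, q z)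
        (f' := fun y => A * (-deriv (deriv u) y) + B / Real.Gamma (1 - α) * Nf y - a / 4 * q y) hy
        (fun z hz => (hΞd z (hz.2.trans_lt hx2)).sub ((hQd z hz.2).const_mul _))
        (fun z hz => by linarith [hineq z (hz.2.trans hx)])
      simp only [intervalIntegral.integral_same, mul_zero, sub_zero] at hm
      have hΞy : 0 ≤ Ξ y := by
        have := hq'pos y (hy.trans_lt hx2)
        have := hY0 y (hy.trans_lt hx2)
        simp only [hΞ]
        positivity
      have : a / 4 * -(∫ z in x..y, q z) ≤ Ξ x := by linarith
      have h2 : 4 / a * (a / 4 * -(∫ z in x..y, q z)) ≤ 4 / a * Ξ x :=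
        mul_le_mul_of_nonneg_left this (by positivity)
      have h3 : 4 / a * (a / 4 * -(∫ z in x..y, q z)) = -(∫ z in x..y, q z) := by field_simp
      linarith)
  refine ⟨hres.1, hres.2.trans ?_⟩
  simp only [intervalIntegral.integral_same, zero_sub, neg_neg]
  rw [hKc, mul_assoc]
  refine mul_le_mul_of_nonneg_left ?_ (by positivity)
  have f1 : A * q' x ≤ max A (B / Real.Gamma (1 - α) * (Z ^ (1 - α) / (1 - α))) * q' x :=
    mul_le_mul_of_nonneg_right (le_max_left _ _) (hq'pos x hx2).le
  have f2 : B / Real.Gamma (1 - α) * Yf x ≤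
      max A (B / Real.Gamma (1 - α) * (Z ^ (1 - α) / (1 - α))) * q x := by
    calc _ ≤ B / Real.Gamma (1 - α) * (q x * (Z ^ (1 - α) / (1 - α))) :=
          mul_le_mul_of_nonneg_left (hYle x hx2) (by positivity)
      _ = (B / Real.Gamma (1 - α) * (Z ^ (1 - α) / (1 - α))) * q x := by ring
      _ ≤ _ := mul_le_mul_of_nonneg_right (le_max_right _ _) (hqpos x hx2).le
  simp only [hΞ]
  linarith

/-- The slope integrates to `φm - u`, and integrating by parts its first moment is the integral of
`φm - u`, which the tail bound controls. All these quantities vanish as the base point goes to `-∞`.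
-/
theorem exists_smallTail {α A B φm φp X T C η : ℝ} {u : ℝ → ℝ} (hα0 : 0 < α) (hα1 : α < 1)
    (hA : 0 < A) (hB : 0 ≤ B) (ha : 0 < slopeAt φm φp) (hη : 0 < η)
    (hu : GenSol α A B (h φm φp) T u) (hl : Leaving φm X C u) :
    ∃ X₁ < T, ∀ x₀ ≤ X₁, SmallTail η (fun x => -deriv u (x + x₀)) := by
  obtain ⟨X₁, K, hK, hX₁T, hX₁X, hpos, hmain⟩ := exists_tail_bound hα0 hα1 hA hB ha hu hl
  have hqlim : Tendsto (fun x => φm - u x) atBot (𝓝 0) := by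
    have h1 : Tendsto (fun x => φm - u x) atBot (𝓝 (φm - φm)) := tendsto_const_nhds.sub hl.lim
    rwa [sub_self] at h1
  have hq'lim : Tendsto (fun x => -deriv u x) atBot (𝓝 0) := by
    simpa using (hl.tendsto_deriv hu).neg
  have hKlim : Tendsto (fun x => K * ((φm - u x) + -deriv u x)) atBot (𝓝 0) := by
    simpa using (hqlim.add hq'lim).const_mul K
  have hev := ((hqlim.eventually (gt_mem_nhds hη)).and (hq'lim.eventually (gt_mem_nhds hη))).and
    (hKlim.eventually (gt_mem_nhds hη))
  obtain ⟨Y, hY⟩ := eventually_atBot.1 hev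
  refine ⟨min X₁ Y, (min_le_left _ _).trans_lt hX₁T, fun x₀ hx₀ => ?_⟩
  have hx1 : x₀ ≤ X₁ := hx₀.trans (min_le_left _ _)
  have hxY : x₀ ≤ Y := hx₀.trans (min_le_right _ _)
  obtain ⟨hqi, hqle⟩ := hmain x₀ hx1
  have hd : ∀ x ≤ 0, HasDerivAt (fun x => φm - u (x + x₀)) (-deriv u (x + x₀)) x := fun x hx =>
    ((hu.hasDerivAt (by linarith)).comp_add_const x x₀).const_sub φm
  have hcd : ContinuousOn (fun x => -deriv u (x + x₀)) (Iic 0) := by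
    refine ContinuousOn.neg (hu.continuousOn_deriv.comp (by fun_prop) fun x hx => ?_)
    have : x ≤ 0 := hx
    simp only [mem_Iio]
    linarith
  have hneg : ∀ x ≤ 0, 0 < -deriv u (x + x₀) := fun x hx => neg_pos.2 (hl.neg _ (by linarith))
  have hi1 := integrableOn_Iic_deriv_of_nonneg (f := fun x => φm - u (x + x₀)) (m := 0) hd hcd
    (fun x hx => (hneg x hx).le) (fun x hx => (hpos _ (by linarith)).le)
  simp only [zero_add, sub_zero] at hi1
  -- the first moment
  have hshift : ∀ x ≤ 0, ∫ y in Iic (x + x₀), (φm - u y) =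
      (∫ y in Iic x₀, (φm - u y)) + ∫ y in x₀..(x + x₀), (φm - u y) := by
    intro x hx
    rw [← intervalIntegral.integral_Iic_sub_Iic hqi
      (hqi.mono_set (Iic_subset_Iic.2 (by linarith)))]
    ring
  -- A primitive of the moment density: the derivative of the tail integral cancels the term from
  -- differentiating the factor `x`.
  have hQd : ∀ x ≤ 0, HasDerivAt (fun x => (∫ y in Iic x₀, (φm - u y)) +
      (∫ y in x₀..(x + x₀), (φm - u y)) - x * (φm - u (x + x₀)))
      (-x * -deriv u (x + x₀)) x := by
    intro x hx
    have hxT : x + x₀ < T := by linarith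
    have hqc : ContinuousOn (fun y => φm - u y) (Iio T) := continuousOn_const.sub hu.continuousOn
    have hsub : uIcc x₀ (x + x₀) ⊆ Iio T := fun z hz => by
      rw [uIcc_of_ge (by linarith)] at hz
      exact hz.2.trans_lt (by linarith)
    have h1 : HasDerivAt (fun y => ∫ z in x₀..y, (φm - u z)) (φm - u (x + x₀)) (x + x₀) := by
      refine intervalIntegral.integral_hasDerivAt_right ((hqc.mono hsub).intervalIntegrable) ?_
        (hqc.continuousAt (Iio_mem_nhds hxT))
      exact hqc.stronglyMeasurableAtFilter isOpen_Iio _ hxT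
    have h2 := (h1.comp_add_const x x₀).const_add (∫ y in Iic x₀, (φm - u y))
    refine (h2.sub ((hasDerivAt_id x).mul (hd x hx))).congr_deriv ?_
    simp only [id]
    ring
  have hi2 := integrableOn_Iic_deriv_of_nonneg (m := 0) hQd
    ((continuousOn_id.neg).mul hcd)
    (fun x hx => mul_nonneg (by linarith) (hneg x hx).le)
    (fun x hx => by
      rw [← hshift x hx]
      have h1 : 0 ≤ ∫ y in Iic (x + x₀), (φm - u y) :=
        setIntegral_nonneg measurableSet_Iic fun y hy => by
          have hy' : y ≤ x + x₀ := hy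
          exact (hpos y (by linarith)).le
      have h2 : 0 ≤ -x * (φm - u (x + x₀)) :=
        mul_nonneg (by linarith) (hpos _ (by linarith)).le
      linarith)
  simp only [zero_add, zero_mul, sub_zero, intervalIntegral.integral_same, add_zero] at hi2
  refine ⟨hneg, fun x hx => ((hY _ (by linarith)).1.2).le, hi1.1, hi1.2.trans (hY x₀ hxY).1.1.le,
    hi2.1, hi2.2.trans (hqle.trans (hY x₀ hxY).2.le)⟩

/-! ### Positivity and coercivity of the kernel `z^{-α}`. -/

/-- Causal convolution with the exponential kernel `e^{-s z}`. -/
noncomputable def expConv (f : ℝ → ℝ) (s x : ℝ) : ℝ :=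
  ∫ z in Ioi (0 : ℝ), Real.exp (-(s * z)) * f (x - z)

section

variable {f : ℝ → ℝ} {P : ℝ}

theorem hasDerivAt_expConv (hf : Continuous f) (hP : ∀ x, |f x| ≤ P) {s : ℝ} (hs : 0 < s) (x : ℝ) :
    HasDerivAt (expConv f s) (f x - s * expConv f s x) x := by
  let F : BoundedContinuousFunction (ℝ × Unit) ℝ :=
    BoundedContinuousFunction.ofNormedAddCommGroup (fun q => f q.1) (by fun_prop) P
      fun q => hP q.1
  have h1 := hasDerivAt_conv_expKernel hs F () x
  have h2 : HasDerivAt (fun x => Real.exp (-(s * x))) (Real.exp (-(s * x)) * -s) x := by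
    simpa using (((hasDerivAt_id x).const_mul s).neg).exp
  have h3 : expConv f s = fun x => Real.exp (-(s * x)) *
      (Real.exp (s * x) * conv (expKernel s) (integrableOn_expKernel hs) F (x, ())) := by
    funext x
    rw [← mul_assoc, ← Real.exp_add]
    simp only [neg_add_cancel, Real.exp_zero, one_mul]
    rfl
  have h4 : F (x, ()) = f x := rfl
  have h5 : conv (expKernel s) (integrableOn_expKernel hs) F (x, ()) = expConv f s x := rfl
  rw [h3]
  refine (h2.mul h1).congr_deriv ?_
  rw [h4, h5, ← h3, Real.exp_neg]
  field_simp
  ring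

theorem abs_expConv_le (hP : ∀ x, |f x| ≤ P) {s : ℝ} (hs : 0 < s) (x : ℝ) :
    |expConv f s x| ≤ s⁻¹ * P := by
  rw [← integral_norm_expKernel hs, ← integral_mul_const, ← Real.norm_eq_abs, expConv]
  refine norm_integral_le_of_norm_le ((integrableOn_expKernel hs).norm.mul_const P)
    (Eventually.of_forall fun z => ?_)
  rw [norm_mul]
  exact mul_le_mul_of_nonneg_left (hP _) (norm_nonneg _)

/-- The energy identity for `g' = f - s g`. -/
theorem expConv_energy (hf : Continuous f) (hP : ∀ x, |f x| ≤ P) (hi : IntegrableOn f (Iic 0))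
    {s : ℝ} (hs : 0 < s) :
    IntegrableOn (fun x => expConv f s x ^ 2) (Iic 0) ∧
    ∫ x in Iic 0, f x * expConv f s x =
      expConv f s 0 ^ 2 / 2 + s * ∫ x in Iic 0, expConv f s x ^ 2 := by
  set g := expConv f s with hg
  have hd : ∀ x, HasDerivAt g (f x - s * g x) x := hasDerivAt_expConv hf hP hs
  have hgc : Continuous g := continuous_iff_continuousAt.2 fun x => (hd x).continuousAt
  have hgb : ∀ x, |g x| ≤ s⁻¹ * P := abs_expConv_le hP hs
  have hfg : IntegrableOn (fun x => f x * g x) (Iic 0) :=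
    Integrable.mul_bdd (c := s⁻¹ * P) hi hgc.aestronglyMeasurable (Eventually.of_forall hgb)
  have hcfg : Continuous fun x => 2 * (f x * g x) := by fun_prop
  have hQ : ∀ x, HasDerivAt (fun x => ∫ y in (0 : ℝ)..x, 2 * (f y * g y)) (2 * (f x * g x)) x :=
    fun x => intervalIntegral.integral_hasDerivAt_right (hcfg.intervalIntegrable _ _)
      (hcfg.stronglyMeasurableAtFilter _ _) hcfg.continuousAt
  -- Since `(g²)' = 2 f g - 2 s g²`, the difference of the primitive of `2 f g` and `g²` is
  -- nondecreasing and bounded below, which yields square integrability of `g`.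
  have hres := integrableOn_Iic_deriv_of_nonneg
    (f := fun x => (∫ y in (0 : ℝ)..x, 2 * (f y * g y)) - g x ^ 2)
    (f' := fun x => 2 * s * g x ^ 2) (a := 0)
    (m := -(∫ x in Iic 0, ‖2 * (f x * g x)‖) - (s⁻¹ * P) ^ 2)
    (fun x _ => ((hQ x).sub ((hd x).pow 2)).congr_deriv (by
      push_cast
      ring))
    (by fun_prop) (fun x _ => by positivity) (fun x hx => by
      have h1 : ‖∫ y in (0 : ℝ)..x, 2 * (f y * g y)‖ ≤ ∫ x in Iic 0, ‖2 * (f x * g x)‖ := by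
        refine intervalIntegral.norm_integral_le_integral_norm_uIoc.trans ?_
        refine setIntegral_mono_set (hfg.const_mul 2).norm
          (Eventually.of_forall fun _ => norm_nonneg _) (LE.le.eventuallyLE ?_)
        rw [uIoc_of_ge hx]
        exact Ioc_subset_Iic_self
      have h2 := (abs_le.1 h1).1
      have h3 : g x ^ 2 ≤ (s⁻¹ * P) ^ 2 := by
        rw [← sq_abs]
        exact pow_le_pow_left₀ (abs_nonneg _) (hgb x) 2
      linarith)
  have hg2 : IntegrableOn (fun x => g x ^ 2) (Iic 0) := by
    have h1 := hres.1.const_mul (2 * s)⁻¹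
    refine IntegrableOn.congr_fun h1 (fun x _ => ?_) measurableSet_Iic
    field_simp
  refine ⟨hg2, ?_⟩
  have hd2 : ∀ x ∈ Iic (0 : ℝ), HasDerivAt (fun x => g x ^ 2)
      (2 * (f x * g x) - 2 * s * g x ^ 2) x := fun x _ =>
    ((hd x).pow 2).congr_deriv (by push_cast; ring)
  have hint : IntegrableOn (fun x => 2 * (f x * g x) - 2 * s * g x ^ 2) (Iic 0) :=
    (hfg.const_mul 2).sub (hg2.const_mul (2 * s))
  have hlim := tendsto_zero_of_hasDerivAt_of_integrableOn_Iic hd2 hint hg2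
  have hfin := integral_Iic_of_hasDerivAt_of_tendsto' hd2 hint hlim
  have h6 : ∫ x in Iic 0, (2 * (f x * g x) - 2 * s * g x ^ 2) =
      2 * (∫ x in Iic 0, f x * g x) - 2 * s * ∫ x in Iic 0, g x ^ 2 := by
    rw [← integral_const_mul, ← integral_const_mul]
    exact integral_sub (hfg.const_mul 2) (hg2.const_mul (2 * s))
  rw [h6, sub_zero] at hfin
  linarith

theorem expConv_energy_nonneg (hf : Continuous f) (hP : ∀ x, |f x| ≤ P)
    (hi : IntegrableOn f (Iic 0)) {s : ℝ} (hs : 0 < s) :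
    0 ≤ ∫ x in Iic 0, f x * expConv f s x := by
  rw [(expConv_energy hf hP hi hs).2]
  have : 0 ≤ ∫ x in Iic 0, expConv f s x ^ 2 := integral_nonneg fun _ => sq_nonneg _
  positivity

/-- Cauchy–Schwarz, from the nonnegativity of the variance of `g` on the interval. -/
theorem sq_intervalIntegral_le {g : ℝ → ℝ} (hg : Continuous g) {x : ℝ} (hx : x ≤ 0) :
    (∫ y in x..0, g y) ^ 2 ≤ -x * ∫ y in x..0, g y ^ 2 := by
  rcases eq_or_lt_of_le hx with h | h
  · subst h; simp
  · set m := ∫ y in x..0, g y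
    have h1 : 0 ≤ ∫ y in x..0, (g y - m / (-x)) ^ 2 :=
      intervalIntegral.integral_nonneg hx fun _ _ => sq_nonneg _
    have h2 : ∫ y in x..0, (g y - m / (-x)) ^ 2 =
        (∫ y in x..0, g y ^ 2) - 2 * (m / (-x)) * m + (m / (-x)) ^ 2 * (-x) := by
      have e : ∀ y, (g y - m / (-x)) ^ 2 = g y ^ 2 - 2 * (m / (-x)) * g y + (m / (-x)) ^ 2 :=
        fun y => by ring
      simp only [e]
      rw [intervalIntegral.integral_add
          (Continuous.intervalIntegrable (by fun_prop) _ _) (by simp),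
        intervalIntegral.integral_sub (Continuous.intervalIntegrable (by fun_prop) _ _)
          (Continuous.intervalIntegrable (by fun_prop) _ _),
        intervalIntegral.integral_const_mul, intervalIntegral.integral_const]
      simp only [smul_eq_mul]
      ring
    have hx0 : x ≠ 0 := h.ne
    have h3 : (m / (-x)) * m * (-x) = m ^ 2 := by field_simp
    have h4 : (m / (-x)) ^ 2 * (-x) * (-x) = m ^ 2 := by field_simp
    have h5 : 0 ≤ -x * ((∫ y in x..0, g y ^ 2) - 2 * (m / (-x)) * m + (m / (-x)) ^ 2 * (-x)) := by
      rw [← h2]; exact mul_nonneg (by linarith) h1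
    nlinarith

/-- A weighted norm of a function vanishing at `0` is controlled by the energy of `expConv`. -/
theorem weighted_le_energy (hf : Continuous f) (hP : ∀ x, |f x| ≤ P) (hi : IntegrableOn f (Iic 0))
    {d ρ : ℝ → ℝ} {σ s : ℝ} (hd : ∀ x ≤ 0, HasDerivAt d (f x) x) (hd0 : d 0 = 0)
    (hρ0 : ∀ x ≤ 0, 0 ≤ ρ x) (hρσ : ∀ x ≤ 0, ρ x ≤ σ) (hρi : IntegrableOn ρ (Iic 0))
    (hρI : ∫ x in Iic 0, ρ x ≤ σ) (hρm : IntegrableOn (fun x => -x * ρ x) (Iic 0))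
    (hρM : ∫ x in Iic 0, -x * ρ x ≤ σ) (hs1 : 1 ≤ s) (hs2 : s ≤ 2) :
    IntegrableOn (fun x => ρ x * d x ^ 2) (Iic 0) ∧
    ∫ x in Iic 0, ρ x * d x ^ 2 ≤ 15 * σ * ∫ x in Iic 0, f x * expConv f s x := by
  have hs : 0 < s := by linarith
  obtain ⟨hg2, hE⟩ := expConv_energy hf hP hi hs
  obtain ⟨Θ, hΘ⟩ : ∃ Θ, Θ = ∫ x in Iic 0, f x * expConv f s x := ⟨_, rfl⟩
  rw [← hΘ] at hE ⊢
  set g := expConv f s with hg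
  have hgd : ∀ x, HasDerivAt g (f x - s * g x) x := hasDerivAt_expConv hf hP hs
  have hgc : Continuous g := continuous_iff_continuousAt.2 fun x => (hgd x).continuousAt
  obtain ⟨G, hG⟩ : ∃ G, G = ∫ x in Iic 0, g x ^ 2 := ⟨_, rfl⟩
  rw [← hG] at hE
  have hG0 : 0 ≤ G := hG ▸ integral_nonneg fun _ => sq_nonneg _
  have hσ0 : 0 ≤ σ := (hρ0 0 le_rfl).trans (hρσ 0 le_rfl)
  -- Integrating `f = g' + s g` from `x` to `0`, with `d 0 = 0`, gives `d = g - g 0 - s ∫ g`. The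
  -- factor `3` comes from squaring three terms and `4` from `s ≤ 2`.
  have hpt : ∀ x ≤ 0, d x ^ 2 ≤ 3 * (g x ^ 2 + g 0 ^ 2 + 4 * (-x * G)) := by
    intro x hx
    have h1 : ∫ y in x..0, s * g y = (d 0 - g 0) - (d x - g x) :=
      intervalIntegral.integral_eq_sub_of_hasDerivAt (f := fun x => d x - g x)
        (fun y hy => by
          rw [uIcc_of_le hx] at hy
          exact ((hd y hy.2).sub (hgd y)).congr_deriv (by ring))
        (Continuous.intervalIntegrable (by fun_prop) _ _)
    rw [intervalIntegral.integral_const_mul, hd0] at h1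
    have h2 := sq_intervalIntegral_le hgc hx
    have h3 : ∫ y in x..0, g y ^ 2 ≤ G := by
      rw [hG, intervalIntegral.integral_of_le hx]
      exact setIntegral_mono_set hg2 (Eventually.of_forall fun _ => sq_nonneg _)
        (LE.le.eventuallyLE Ioc_subset_Iic_self)
    have h4 : (∫ y in x..0, g y) ^ 2 ≤ -x * G :=
      h2.trans (mul_le_mul_of_nonneg_left h3 (by linarith))
    set m := ∫ y in x..0, g y
    have h5 : d x = g x - g 0 - s * m := by linarith
    have h6 : (s * m) ^ 2 ≤ 4 * (-x * G) := by
      rw [mul_pow]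
      have : s ^ 2 ≤ 4 := by nlinarith
      exact mul_le_mul this h4 (sq_nonneg _) (by norm_num)
    rw [h5]
    nlinarith [sq_nonneg (g x + g 0), sq_nonneg (g x + s * m), sq_nonneg (g 0 - s * m)]
  have hdc : ContinuousOn d (Iic 0) := fun x hx => (hd x hx).continuousAt.continuousWithinAt
  have hρg : IntegrableOn (fun x => ρ x * g x ^ 2) (Iic 0) := by
    refine Integrable.mono' (hg2.const_mul σ)
      (hρi.aestronglyMeasurable.mul (hgc.pow 2).aestronglyMeasurable)
      ((ae_restrict_iff' measurableSet_Iic).2 (Eventually.of_forall fun x hx => ?_))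
    rw [Real.norm_eq_abs, abs_of_nonneg (mul_nonneg (hρ0 x hx) (sq_nonneg _))]
    exact mul_le_mul_of_nonneg_right (hρσ x hx) (sq_nonneg _)
  have hdom : IntegrableOn (fun x => 3 * (ρ x * g x ^ 2 + g 0 ^ 2 * ρ x + 4 * G * (-x * ρ x)))
      (Iic 0) :=
    ((hρg.add (hρi.const_mul (g 0 ^ 2))).add (hρm.const_mul (4 * G))).const_mul 3
  have hle : ∀ x ∈ Iic (0 : ℝ), ρ x * d x ^ 2 ≤
      3 * (ρ x * g x ^ 2 + g 0 ^ 2 * ρ x + 4 * G * (-x * ρ x)) := fun x hx => by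
    have := mul_le_mul_of_nonneg_left (hpt x hx) (hρ0 x hx)
    linarith
  have hint : IntegrableOn (fun x => ρ x * d x ^ 2) (Iic 0) := by
    refine Integrable.mono' hdom (hρi.aestronglyMeasurable.mul
      ((hdc.pow 2).aestronglyMeasurable measurableSet_Iic))
      ((ae_restrict_iff' measurableSet_Iic).2 (Eventually.of_forall fun x hx => ?_))
    rw [Real.norm_eq_abs, abs_of_nonneg (mul_nonneg (hρ0 x hx) (sq_nonneg _))]
    exact hle x hx
  refine ⟨hint, (setIntegral_mono_on hint hdom measurableSet_Iic hle).trans ?_⟩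
  -- The three terms add up to `3σ (5G + g(0)²)`, and `s ≥ 1` bounds this by `15σ` times the energy
  -- `g(0)² / 2 + s G`.
  have hρgI : ∫ x in Iic 0, ρ x * g x ^ 2 ≤ σ * G := by
    rw [hG, ← integral_const_mul]
    exact setIntegral_mono_on hρg (hg2.const_mul σ) measurableSet_Iic fun x hx =>
      mul_le_mul_of_nonneg_right (hρσ x hx) (sq_nonneg _)
  have hsum : ∫ x in Iic 0, 3 * (ρ x * g x ^ 2 + g 0 ^ 2 * ρ x + 4 * G * (-x * ρ x)) =
      3 * ((∫ x in Iic 0, ρ x * g x ^ 2) + g 0 ^ 2 * (∫ x in Iic 0, ρ x) +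
        4 * G * ∫ x in Iic 0, -x * ρ x) := by
    rw [integral_const_mul, ← integral_const_mul (g 0 ^ 2), ← integral_const_mul (4 * G),
      ← integral_add hρg (hρi.const_mul (g 0 ^ 2))]
    congr 1
    exact integral_add (hρg.add (hρi.const_mul (g 0 ^ 2))) (hρm.const_mul (4 * G))
  rw [hsum, hE]
  have k1 : g 0 ^ 2 * ∫ x in Iic 0, ρ x ≤ g 0 ^ 2 * σ :=
    mul_le_mul_of_nonneg_left hρI (sq_nonneg _)
  have k2 : 4 * G * ∫ x in Iic 0, -x * ρ x ≤ 4 * G * σ :=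
    mul_le_mul_of_nonneg_left hρM (by positivity)
  have k3 : 0 ≤ (s - 1) * G * σ := mul_nonneg (mul_nonneg (by linarith) hG0) hσ0
  have k4 : 0 ≤ g 0 ^ 2 * σ := by positivity
  linarith

end

section

variable {f : ℝ → ℝ} {P α : ℝ}

/-- Near the singularity `f` is bounded and the kernel integrable; beyond distance `1` the kernel is
at most `1` and `f` is integrable. The bound does not depend on `x`, which is what Fubini needs. -/
theorem exists_abs_kernel_integral_le (hf : Continuous f) (hP : ∀ x, |f x| ≤ P)
    (hi : IntegrableOn f (Iic 0)) (hα0 : 0 < α) (hα1 : α < 1) :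
    ∃ M, ∀ x ≤ 0, IntegrableOn (fun z => f (x - z) * z ^ (-α)) (Ioi 0) ∧
      ∫ z in Ioi (0 : ℝ), |f (x - z) * z ^ (-α)| ≤ M := by
  have hz1 : IntegrableOn (fun z : ℝ => z ^ (-α)) (Ioc 0 1) :=
    (intervalIntegrable_iff_integrableOn_Ioc_of_le zero_le_one).1
      (intervalIntegral.intervalIntegrable_rpow' (by linarith))
  have hind : Integrable (Set.indicator (Ioc (0 : ℝ) 1) fun z : ℝ => P * z ^ (-α)) :=
    IntegrableOn.integrable_indicator (hz1.const_mul P) measurableSet_Ioc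
  have hshift : ∀ x ≤ 0, IntegrableOn (fun z => |f (x - z)|) (Ioi 0) := fun x hx =>
    ((integrableOn_Iio_iff_Ioi f x).1 (hi.mono_set fun y hy => by
      have : y < x := hy
      simp only [mem_Iic]; linarith)).norm
  have hbd : ∀ x : ℝ, ∀ z ∈ Ioi (0 : ℝ), |f (x - z) * z ^ (-α)| ≤
      Set.indicator (Ioc (0 : ℝ) 1) (fun z : ℝ => P * z ^ (-α)) z + |f (x - z)| := by
    intro x z hz
    have hz0 : 0 < z := hz
    have h0 : 0 < z ^ (-α) := Real.rpow_pos_of_pos hz0 _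
    rw [abs_mul, abs_of_pos h0]
    by_cases h : z ≤ 1
    · rw [indicator_of_mem (show z ∈ Ioc (0 : ℝ) 1 from ⟨hz0, h⟩)]
      have := mul_le_mul_of_nonneg_right (hP (x - z)) h0.le
      linarith [abs_nonneg (f (x - z))]
    · rw [indicator_of_notMem (fun h' => h h'.2), zero_add]
      refine mul_le_of_le_one_right (abs_nonneg _) ?_
      exact Real.rpow_le_one_of_one_le_of_nonpos (le_of_not_ge h) (by linarith)
  have hint : ∀ x ≤ 0, IntegrableOn (fun z => f (x - z) * z ^ (-α)) (Ioi 0) := by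
    intro x hx
    refine Integrable.mono' (hind.integrableOn.add (hshift x hx)) ?_
      ((ae_restrict_iff' measurableSet_Ioi).2 (Eventually.of_forall (hbd x)))
    exact (Measurable.mul (by fun_prop) (measurable_id.pow_const _)).aestronglyMeasurable
  refine ⟨(∫ z in Ioi (0 : ℝ), Set.indicator (Ioc (0 : ℝ) 1) (fun z : ℝ => P * z ^ (-α)) z) +
    ∫ y in Iic 0, |f y|, fun x hx => ⟨hint x hx, ?_⟩⟩
  refine (setIntegral_mono_on (hint x hx).norm (hind.integrableOn.add (hshift x hx))
    measurableSet_Ioi (hbd x)).trans ?_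
  have h1 : ∫ z in Ioi (0 : ℝ), |f (x - z)| ≤ ∫ y in Iic 0, |f y| := by
    rw [← setIntegral_Iio_eq_Ioi (fun y => |f y|) x]
    refine setIntegral_mono_set hi.norm (Eventually.of_forall fun _ => abs_nonneg _)
      (LE.le.eventuallyLE fun y hy => ?_)
    have : y < x := hy
    simp only [mem_Iic]; linarith
  have h2 : ∫ z in Ioi (0 : ℝ), (Set.indicator (Ioc (0 : ℝ) 1) (fun z : ℝ => P * z ^ (-α)) z +
      |f (x - z)|) = (∫ z in Ioi (0 : ℝ), Set.indicator (Ioc (0 : ℝ) 1)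
        (fun z : ℝ => P * z ^ (-α)) z) + ∫ z in Ioi (0 : ℝ), |f (x - z)| :=
    integral_add hind.integrableOn (hshift x hx)
  exact h2.le.trans (add_le_add le_rfl h1)

/-- The quadratic form of the kernel `z^{-α}` as a superposition of those of exponentials. -/
theorem kernel_energy (hf : Continuous f) (hP : ∀ x, |f x| ≤ P) (hi : IntegrableOn f (Iic 0))
    (hα0 : 0 < α) (hα1 : α < 1) :
    IntegrableOn (fun x => f x * ∫ z in Ioi (0 : ℝ), f (x - z) * z ^ (-α)) (Iic 0) ∧
    IntegrableOn (fun s => s ^ (α - 1) * ∫ x in Iic 0, f x * expConv f s x) (Ioi 0) ∧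
    Real.Gamma α * ∫ x in Iic 0, f x * ∫ z in Ioi (0 : ℝ), f (x - z) * z ^ (-α) =
      ∫ s in Ioi (0 : ℝ), s ^ (α - 1) * ∫ x in Iic 0, f x * expConv f s x := by
  obtain ⟨M, hM⟩ := exists_abs_kernel_integral_le hf hP hi hα0 hα1
  set μ₁ : Measure ℝ := volume.restrict (Iic 0) with hμ₁
  set μ₂ : Measure ℝ := volume.restrict (Ioi 0) with hμ₂
  have hprod : ∀ᵐ w ∂(μ₁.prod μ₂), w.1 ≤ 0 ∧ 0 < w.2 := by
    rw [hμ₁, hμ₂, Measure.prod_restrict]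
    exact (ae_restrict_iff' (measurableSet_Iic.prod measurableSet_Ioi)).2
      (Eventually.of_forall fun w hw => ⟨hw.1, hw.2⟩)
  have h1ae : ∀ᵐ x ∂μ₁, x ≤ 0 :=
    (ae_restrict_iff' measurableSet_Iic).2 (Eventually.of_forall fun x hx => hx)
  have h2ae : ∀ᵐ x ∂μ₂, 0 < x :=
    (ae_restrict_iff' measurableSet_Ioi).2 (Eventually.of_forall fun x hx => hx)
  have hfm : Measurable f := hf.measurable
  -- integrability of `f(x) f(x-z) z^{-α}`
  set W : ℝ × ℝ → ℝ := fun w => f w.1 * (f (w.1 - w.2) * w.2 ^ (-α)) with hW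
  have hWm : Measurable W :=
    (hfm.comp measurable_fst).mul
      ((hfm.comp (measurable_fst.sub measurable_snd)).mul (measurable_snd.pow_const _))
  have hWi : Integrable W (μ₁.prod μ₂) := by
    rw [integrable_prod_iff hWm.aestronglyMeasurable]
    refine ⟨?_, ?_⟩
    · filter_upwards [h1ae] with x hx
      exact (hM x hx).1.const_mul (f x)
    · refine Integrable.mono' (hi.norm.mul_const M)
        hWm.aestronglyMeasurable.norm.integral_prod_right' ?_
      filter_upwards [h1ae] with x hx
      have h3 : ∫ z, ‖W (x, z)‖ ∂μ₂ = |f x| * ∫ z in Ioi (0 : ℝ), |f (x - z) * z ^ (-α)| := by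
        rw [← integral_const_mul]
        refine integral_congr_ae (Eventually.of_forall fun z => ?_)
        simp only [hW, norm_mul, Real.norm_eq_abs, abs_mul]
      rw [h3, Real.norm_eq_abs, abs_of_nonneg (mul_nonneg (abs_nonneg _)
        (integral_nonneg fun _ => abs_nonneg _))]
      exact mul_le_mul_of_nonneg_left (hM x hx).2 (abs_nonneg _)
  -- The Gamma integral exhibits `z^{-α}` as a positive mixture of the exponentials `e^{-sz}` with
  -- density `s^{α-1} / Γ(α)`.
  have hs : ∀ z > 0, IntegrableOn (fun s : ℝ => s ^ (α - 1) * Real.exp (-(z * s))) (Ioi 0) ∧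
      ∫ s in Ioi (0 : ℝ), s ^ (α - 1) * Real.exp (-(z * s)) = Real.Gamma α * z ^ (-α) := by
    intro z hz
    have e1 := integrableOn_exp_mul_rpow (α := 1 - α) (μ := z) (by linarith) hz
    have e2 := integral_exp_mul_rpow (α := 1 - α) (μ := z) (by linarith) hz
    rw [show 1 - (1 - α) = α by ring, show 1 - α - 1 = -α by ring] at e2
    rw [← e2]
    simp only [show -(1 - α) = α - 1 by ring] at e1 ⊢
    simp only [mul_comm (_ ^ (α - 1))]
    exact ⟨e1, trivial⟩
  set H : (ℝ × ℝ) → ℝ → ℝ := fun w s =>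
    f w.1 * f (w.1 - w.2) * (s ^ (α - 1) * Real.exp (-(w.2 * s))) with hH
  have hHm : Measurable (Function.uncurry H) := by
    have a1 : Measurable fun q : (ℝ × ℝ) × ℝ => q.1.1 := measurable_fst.comp measurable_fst
    have a2 : Measurable fun q : (ℝ × ℝ) × ℝ => q.1.2 := measurable_snd.comp measurable_fst
    have a3 : Measurable fun q : (ℝ × ℝ) × ℝ => q.2 := measurable_snd
    exact ((hfm.comp a1).mul (hfm.comp (a1.sub a2))).mul
      ((a3.pow_const _).mul (Real.measurable_exp.comp ((a2.mul a3).neg)))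
  have hHi : Integrable (Function.uncurry H) ((μ₁.prod μ₂).prod μ₂) := by
    rw [integrable_prod_iff hHm.aestronglyMeasurable]
    refine ⟨?_, ?_⟩
    · filter_upwards [hprod] with w hw
      exact (hs w.2 hw.2).1.const_mul (f w.1 * f (w.1 - w.2))
    · refine (hWi.norm.const_mul (Real.Gamma α)).congr ?_
      filter_upwards [hprod] with w hw
      have h0 : 0 < w.2 ^ (-α) := Real.rpow_pos_of_pos hw.2 _
      have h4 : ∫ s, ‖Function.uncurry H (w, s)‖ ∂μ₂ = |f w.1 * f (w.1 - w.2)| *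
          ∫ s in Ioi (0 : ℝ), s ^ (α - 1) * Real.exp (-(w.2 * s)) := by
        rw [← integral_const_mul]
        refine setIntegral_congr_fun measurableSet_Ioi fun s hs => ?_
        have hs0 : 0 < s := hs
        simp only [Function.uncurry, hH]
        rw [norm_mul, Real.norm_eq_abs, Real.norm_eq_abs,
          abs_of_nonneg (mul_nonneg (Real.rpow_nonneg hs0.le _) (Real.exp_pos _).le)]
      rw [h4, (hs w.2 hw.2).2]
      simp only [hW, Real.norm_eq_abs]
      rw [← mul_assoc (f w.1), abs_mul _ (w.2 ^ (-α)), abs_of_pos h0]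
      ring
  have hinner : ∀ᵐ s ∂μ₂, ∫ w, H w s ∂(μ₁.prod μ₂) =
      s ^ (α - 1) * ∫ x in Iic 0, f x * expConv f s x := by
    filter_upwards [hHi.prod_left_ae] with s hsi
    have h5 : ∫ w, H w s ∂(μ₁.prod μ₂) = ∫ x, ∫ z, H (x, z) s ∂μ₂ ∂μ₁ := integral_prod _ hsi
    rw [h5, ← integral_const_mul]
    refine integral_congr_ae (Eventually.of_forall fun x => ?_)
    simp only [expConv]
    rw [← mul_assoc, ← integral_const_mul]
    refine integral_congr_ae (Eventually.of_forall fun z => ?_)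
    simp only [hH]
    rw [mul_comm s z]
    ring
  refine ⟨?_, ?_, ?_⟩
  · refine hWi.integral_prod_left.congr (Eventually.of_forall fun x => ?_)
    simp only [hW]
    rw [integral_const_mul]
  · exact hHi.integral_prod_right.congr hinner
  · have h6 := integral_integral_swap hHi
    rw [integral_congr_ae hinner] at h6
    rw [← h6]
    have h7 : ∫ w, ∫ s, H w s ∂μ₂ ∂(μ₁.prod μ₂) = ∫ w, Real.Gamma α * W w ∂(μ₁.prod μ₂) := by
      refine integral_congr_ae ?_
      filter_upwards [hprod] with w hw
      simp only [hH]
      rw [integral_const_mul, (hs w.2 hw.2).2]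
      simp only [hW]
      ring
    rw [h7, integral_const_mul, integral_prod _ hWi]
    congr 1
    refine integral_congr_ae (Eventually.of_forall fun x => ?_)
    simp only [hW]
    rw [integral_const_mul]

/-- Coercivity of the quadratic form of the kernel `z^{-α}`. -/
theorem weighted_le_kernel_energy (hf : Continuous f) (hP : ∀ x, |f x| ≤ P)
    (hi : IntegrableOn f (Iic 0)) (hα0 : 0 < α) (hα1 : α < 1)
    {d ρ : ℝ → ℝ} {σ : ℝ} (hσ : 0 < σ) (hd : ∀ x ≤ 0, HasDerivAt d (f x) x) (hd0 : d 0 = 0)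
    (hρ0 : ∀ x ≤ 0, 0 ≤ ρ x) (hρσ : ∀ x ≤ 0, ρ x ≤ σ) (hρi : IntegrableOn ρ (Iic 0))
    (hρI : ∫ x in Iic 0, ρ x ≤ σ) (hρm : IntegrableOn (fun x => -x * ρ x) (Iic 0))
    (hρM : ∫ x in Iic 0, -x * ρ x ≤ σ) :
    IntegrableOn (fun x => ρ x * d x ^ 2) (Iic 0) ∧
    ∫ x in Iic 0, ρ x * d x ^ 2 ≤ 15 * σ * 2 ^ (1 - α) * (Real.Gamma α *
      ∫ x in Iic 0, f x * ∫ z in Ioi (0 : ℝ), f (x - z) * z ^ (-α)) := by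
  obtain ⟨-, k2, k3⟩ := kernel_energy hf hP hi hα0 hα1
  have hw := fun s (h1 : 1 ≤ s) (h2 : s ≤ 2) =>
    weighted_le_energy hf hP hi hd hd0 hρ0 hρσ hρi hρI hρm hρM h1 h2
  refine ⟨(hw 1 le_rfl (by norm_num)).1, ?_⟩
  obtain ⟨E, hE⟩ : ∃ E, E = ∫ x in Iic 0, ρ x * d x ^ 2 := ⟨_, rfl⟩
  have hE0 : 0 ≤ E := hE ▸ setIntegral_nonneg measurableSet_Iic fun x hx =>
    mul_nonneg (hρ0 x hx) (sq_nonneg _)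
  rw [k3, ← hE]
  have h2p : (0 : ℝ) < 2 ^ (1 - α) := Real.rpow_pos_of_pos two_pos _
  have h2m : (2 : ℝ) ^ (α - 1) = (2 ^ (1 - α))⁻¹ := by
    rw [← Real.rpow_neg two_pos.le, neg_sub]
  -- Every rate `s` contributes a nonnegative energy, so the form is bounded below by the rates in
  -- `(1, 2]`, for which the weighted estimate is uniform.
  have hmono : ∫ s in Ioc (1 : ℝ) 2, s ^ (α - 1) * ∫ x in Iic 0, f x * expConv f s x ≤
      ∫ s in Ioi (0 : ℝ), s ^ (α - 1) * ∫ x in Iic 0, f x * expConv f s x := by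
    refine setIntegral_mono_set k2 ?_ (LE.le.eventuallyLE fun s hs => ?_)
    · refine (ae_restrict_iff' measurableSet_Ioi).2 (Eventually.of_forall fun s hs => ?_)
      exact mul_nonneg (Real.rpow_nonneg (le_of_lt hs) _) (expConv_energy_nonneg hf hP hi hs)
    · exact lt_trans one_pos hs.1
  have hlow : 2 ^ (α - 1) * (E / (15 * σ)) ≤
      ∫ s in Ioc (1 : ℝ) 2, s ^ (α - 1) * ∫ x in Iic 0, f x * expConv f s x := by
    have hc : ∫ s in Ioc (1 : ℝ) 2, (2 : ℝ) ^ (α - 1) * (E / (15 * σ)) =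
        2 ^ (α - 1) * (E / (15 * σ)) := by
      rw [setIntegral_const]
      norm_num
    rw [← hc]
    refine setIntegral_mono_on (integrableOn_const (by simp))
      (k2.mono_set fun s hs => lt_trans one_pos hs.1) measurableSet_Ioc fun s hs => ?_
    have h1 := (hw s hs.1.le hs.2).2
    rw [← hE] at h1
    have h4 : E / (15 * σ) ≤ ∫ x in Iic 0, f x * expConv f s x := by
      rw [div_le_iff₀ (by positivity)]
      linarith
    have hs0 : 0 < s := lt_trans one_pos hs.1
    exact mul_le_mul (Real.rpow_le_rpow_of_nonpos hs0 hs.2 (by linarith)) h4 (by positivity)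
      (Real.rpow_nonneg hs0.le _)
  have hfin := hlow.trans hmono
  rw [h2m] at hfin
  calc E = 15 * σ * 2 ^ (1 - α) * ((2 ^ (1 - α))⁻¹ * (E / (15 * σ))) := by field_simp
    _ ≤ _ := mul_le_mul_of_nonneg_left hfin (by positivity)

end

/-! ### Uniqueness of trajectories up to translation. -/

theorem SmallTail.abs_sub_le {η φm : ℝ} {u : ℝ → ℝ} (h : SmallTail η fun x => -deriv u x)
    (hu : ∀ x ≤ 0, HasDerivAt u (deriv u x) x) (hlim : Tendsto u atBot (𝓝 φm)) :
    ∀ x ≤ 0, |u x - φm| ≤ η := by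
  intro x hx
  have hi : IntegrableOn (deriv u) (Iic x) := by
    have := (h.int.mono_set (Iic_subset_Iic.2 hx)).neg
    exact this.congr_fun (fun y _ => by simp) measurableSet_Iic
  rw [← integral_Iic_of_hasDerivAt_of_tendsto' (f := u) (fun y hy => hu y (le_trans hy hx)) hi hlim]
  refine le_trans ?_ h.int_le
  rw [← Real.norm_eq_abs]
  refine (norm_integral_le_integral_norm _).trans ?_
  have h1 : ∫ y in Iic x, ‖deriv u y‖ = ∫ y in Iic x, -deriv u y := by
    refine setIntegral_congr_fun measurableSet_Iic fun y hy => ?_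
    have := h.pos y (le_trans hy hx)
    simp only [Real.norm_eq_abs]
    exact abs_of_neg (by linarith)
  rw [h1]
  refine setIntegral_mono_set h.int ?_ (LE.le.eventuallyLE (Iic_subset_Iic.2 hx))
  exact (ae_restrict_iff' measurableSet_Iic).2 (Eventually.of_forall fun y hy => (h.pos y hy).le)

/-- Two trajectories with small tails that agree at `0` agree on `(-∞, 0]`. -/
theorem exists_eqOn_of_smallTail {α A B : ℝ} (φm φp : ℝ) (hα0 : 0 < α) (hα1 : α < 1) (hA : 0 < A)
    (hB : 0 < B) :
    ∃ η > 0, ∀ T > 0, ∀ u v : ℝ → ℝ, GenSol α A B (h φm φp) T u → GenSol α A B (h φm φp) T v →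
      Tendsto u atBot (𝓝 φm) → Tendsto v atBot (𝓝 φm) →
      Tendsto (deriv u) atBot (𝓝 0) → Tendsto (deriv v) atBot (𝓝 0) →
      SmallTail η (fun x => -deriv u x) → SmallTail η (fun x => -deriv v x) → u 0 = v 0 →
      EqOn u v (Iio 0) := by
  have hΓ : 0 < Real.Gamma (1 - α) := Real.Gamma_pos_of_pos (by linarith)
  have hΓα : 0 < Real.Gamma α := Real.Gamma_pos_of_pos hα0
  have h2p : (0 : ℝ) < 2 ^ (1 - α) := Real.rpow_pos_of_pos two_pos _
  obtain ⟨M, hM⟩ : ∃ M, M = |φm| + 1 := ⟨_, rfl⟩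
  have hM0 : 0 < M := by rw [hM]; positivity
  obtain ⟨κ, hκ⟩ : ∃ κ, κ = 15 * 2 ^ (1 - α) * Real.Gamma α := ⟨_, rfl⟩
  have hκ0 : 0 < κ := by rw [hκ]; positivity
  obtain ⟨β, hβ⟩ : ∃ β, β = B / Real.Gamma (1 - α) := ⟨_, rfl⟩
  have hβ0 : 0 < β := by rw [hβ]; positivity
  -- The weight `ρ` below is controlled by `6 M η`, and coercivity then has constant `6 M η κ`; this
  -- choice keeps it at most `β`, the strength of the non-local term.
  refine ⟨min 1 (β / (6 * M * κ)), by positivity, ?_⟩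
  intro T hT u v hu hv hul hvl hul' hvl' hus hvs h0
  obtain ⟨η, hη⟩ : ∃ η, η = min 1 (β / (6 * M * κ)) := ⟨_, rfl⟩
  rw [← hη] at hus hvs
  have hη0 : 0 < η := by rw [hη]; positivity
  have hη1 : η ≤ 1 := hη ▸ min_le_left _ _
  have hηκ : κ * (6 * M * η) ≤ β := by
    have : η ≤ β / (6 * M * κ) := hη ▸ min_le_right _ _
    rw [le_div_iff₀ (by positivity)] at this
    linarith
  have hdu : ∀ x ≤ 0, HasDerivAt u (deriv u x) x := fun x hx => hu.hasDerivAt (by linarith)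
  have hdv : ∀ x ≤ 0, HasDerivAt v (deriv v x) x := fun x hx => hv.hasDerivAt (by linarith)
  have hbu : ∀ x ≤ 0, |u x| ≤ M := fun x hx => by
    have h1 := hus.abs_sub_le hdu hul x hx
    have h2 := abs_add_le (u x - φm) φm
    rw [sub_add_cancel] at h2
    linarith
  have hbv : ∀ x ≤ 0, |v x| ≤ M := fun x hx => by
    have h1 := hvs.abs_sub_le hdv hvl x hx
    have h2 := abs_add_le (v x - φm) φm
    rw [sub_add_cancel] at h2
    linarith
  -- The difference of the slopes, frozen to the right of `0`, so that it is continuous and bounded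
  -- on the whole line. Only its values on `(-∞, 0]` enter, by causality.
  set f : ℝ → ℝ := fun x => deriv u (min x 0) - deriv v (min x 0) with hf
  have hf0 : ∀ x ≤ 0, f x = deriv u x - deriv v x := fun x hx => by simp only [hf, min_eq_left hx]
  have hfc : Continuous f := by
    have hm : ∀ x : ℝ, min x 0 ∈ Iio T := fun x => (min_le_right x 0).trans_lt hT
    have hmc : Continuous fun x : ℝ => min x 0 := by fun_prop
    exact (hu.continuousOn_deriv.comp_continuous hmc hm).sub
      (hv.continuousOn_deriv.comp_continuous hmc hm)
  have hfP : ∀ x, |f x| ≤ 2 * η := fun x => by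
    have hm : min x 0 ≤ 0 := min_le_right _ _
    have a1 := hus.pos _ hm
    have a2 := hus.le _ hm
    have a3 := hvs.pos _ hm
    have a4 := hvs.le _ hm
    simp only [hf]
    rw [abs_le]
    constructor <;> linarith
  have hfi : IntegrableOn f (Iic 0) := by
    refine (hvs.int.sub hus.int).congr_fun (fun x hx => ?_) measurableSet_Iic
    rw [hf0 x hx]
    simp only [Pi.sub_apply]
    ring
  set d : ℝ → ℝ := fun x => u x - v x with hd
  have hdd : ∀ x ≤ 0, HasDerivAt d (f x) x := fun x hx => by
    rw [hf0 x hx]; exact (hdu x hx).sub (hdv x hx)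
  have hd0 : d 0 = 0 := by simp only [hd, h0, sub_self]
  -- This weight dominates the derivative of the coefficient `c` in `h(u) - h(v) = c (u - v)`, and
  -- inherits positivity and small tails from the slopes.
  set ρ : ℝ → ℝ := fun x => 3 * M * (-deriv u x + -deriv v x) with hρ
  have hρpos : ∀ x ≤ 0, 0 < ρ x := fun x hx => by
    have a1 := hus.pos x hx
    have a3 := hvs.pos x hx
    simp only [hρ]
    positivity
  have hρle : ∀ x ≤ 0, ρ x ≤ 6 * M * η := fun x hx => by
    have a2 := hus.le x hx
    have a4 := hvs.le x hx
    have : 3 * M * (-deriv u x + -deriv v x) ≤ 3 * M * (η + η) := by gcongr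
    simp only [hρ]
    linarith
  have hρi : IntegrableOn ρ (Iic 0) := (hus.int.add hvs.int).const_mul (3 * M)
  have hρI : ∫ x in Iic 0, ρ x ≤ 6 * M * η := by
    have e : ∫ x in Iic 0, ρ x = 3 * M * ((∫ x in Iic 0, -deriv u x) + ∫ x in Iic 0, -deriv v x) := by
      rw [← integral_add hus.int hvs.int, ← integral_const_mul]
    have a2 := hus.int_le
    have a4 := hvs.int_le
    rw [e]
    have : 3 * M * ((∫ x in Iic 0, -deriv u x) + ∫ x in Iic 0, -deriv v x) ≤ 3 * M * (η + η) := by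
      gcongr
    linarith
  have hρm' : IntegrableOn (fun x => 3 * M * (-x * -deriv u x + -x * -deriv v x)) (Iic 0) :=
    (hus.moment.add hvs.moment).const_mul (3 * M)
  have hρm_eq : ∀ x, -x * ρ x = 3 * M * (-x * -deriv u x + -x * -deriv v x) := fun x => by
    simp only [hρ]; ring
  have hρm : IntegrableOn (fun x => -x * ρ x) (Iic 0) := by simpa only [hρm_eq] using hρm'
  have hρM : ∫ x in Iic 0, -x * ρ x ≤ 6 * M * η := by
    have e : ∫ x in Iic 0, -x * ρ x =
        3 * M * ((∫ x in Iic 0, -x * -deriv u x) + ∫ x in Iic 0, -x * -deriv v x) := by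
      rw [← integral_add hus.moment hvs.moment, ← integral_const_mul]
      simp only [hρm_eq]
    have a2 := hus.moment_le
    have a4 := hvs.moment_le
    rw [e]
    have : 3 * M * ((∫ x in Iic 0, -x * -deriv u x) + ∫ x in Iic 0, -x * -deriv v x) ≤
        3 * M * (η + η) := by gcongr
    linarith
  obtain ⟨hEi, hEle⟩ := weighted_le_kernel_energy hfc hfP hfi hα0 hα1
    (by positivity : 0 < 6 * M * η) hdd hd0 (fun x hx => (hρpos x hx).le) hρle hρi hρI hρm hρM
  obtain ⟨hWi, -, -⟩ := kernel_energy hfc hfP hfi hα0 hα1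
  obtain ⟨E, hE⟩ : ∃ E, E = ∫ x in Iic 0, ρ x * d x ^ 2 := ⟨_, rfl⟩
  set W : ℝ → ℝ := fun x => ∫ z in Ioi (0 : ℝ), f (x - z) * z ^ (-α) with hW
  obtain ⟨D, hD⟩ : ∃ D, D = ∫ x in Iic 0, f x * W x := ⟨_, rfl⟩
  rw [← hE, ← hD] at hEle
  have hE0 : 0 ≤ E := hE ▸ setIntegral_nonneg measurableSet_Iic fun x hx =>
    mul_nonneg (hρpos x hx).le (sq_nonneg _)
  -- the energy balance
  set c : ℝ → ℝ := fun x => u x ^ 2 + u x * v x + v x ^ 2 - waveSpeed φm φp with hc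
  set c' : ℝ → ℝ := fun x => (2 * u x + v x) * deriv u x + (u x + 2 * v x) * deriv v x with hc'
  have hcd : ∀ x ≤ 0, HasDerivAt c (c' x) x := fun x hx => by
    have h1 := hdu x hx
    have h2 := hdv x hx
    refine ((((h1.pow 2).add (h1.mul h2)).add (h2.pow 2)).sub_const _).congr_deriv ?_
    simp only [hc']
    push_cast
    ring
  have hc'ρ : ∀ x ≤ 0, |c' x| ≤ ρ x := fun x hx => by
    have a1 := hus.pos x hx
    have a3 := hvs.pos x hx
    have b1 := hbu x hx
    have b2 := hbv x hx
    have e1 : |2 * u x + v x| ≤ 3 * M := by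
      rw [abs_le] at *
      constructor <;> linarith
    have e2 : |u x + 2 * v x| ≤ 3 * M := by
      rw [abs_le] at *
      constructor <;> linarith
    simp only [hc', hρ]
    refine (abs_add_le _ _).trans ?_
    rw [abs_mul, abs_mul, abs_of_neg (by linarith : deriv u x < 0),
      abs_of_neg (by linarith : deriv v x < 0), mul_add]
    gcongr
  have hfrac : ∀ x ≤ 0, fracInt α (fun y => deriv u y - deriv v y) x =
      1 / Real.Gamma (1 - α) * W x := fun x hx => by
    rw [fracInt_eq_Ioi]
    congr 1
    refine setIntegral_congr_fun measurableSet_Ioi fun z hz => ?_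
    have hz0 : 0 < z := hz
    simp only [hf0 (x - z) (by linarith)]
  have heq : ∀ x ≤ 0, A * (deriv (deriv u) x - deriv (deriv v) x) = c x * d x - β * W x := by
    intro x hx
    have hxT : x < T := by linarith
    have h1 := hu.equation x hxT
    have h2 := hv.equation x hxT
    have h3 := hfrac x hx
    rw [fracInt_sub (hu.integrable x hxT) (hv.integrable x hxT)] at h3
    have h4 : c x * d x = h φm φp (u x) - h φm φp (v x) := by
      rw [h_sub_h]
    have h5 : β * W x = B * (1 / Real.Gamma (1 - α) * W x) := by rw [hβ]; ring
    rw [h4, h5, ← h3]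
    linarith
  -- The energy obtained by multiplying the equation for the difference by its derivative. It tends
  -- to `0` at `-∞` and is nonnegative at `0`, because `d 0 = 0`.
  set Ψ : ℝ → ℝ := fun x => A / 2 * (deriv u x - deriv v x) ^ 2 - c x * d x ^ 2 / 2 with hΨ
  have hΨd : ∀ x ∈ Iic (0 : ℝ), HasDerivAt Ψ (-β * (f x * W x) - c' x * d x ^ 2 / 2) x := by
    intro x hx
    have hx0 : x ≤ 0 := hx
    have h1 := (((hu.hasDerivAt_deriv (by linarith : x < T)).sub
      (hv.hasDerivAt_deriv (by linarith : x < T))).pow 2).const_mul (A / 2)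
    have h2 := ((hcd x hx0).mul ((hdd x hx0).pow 2)).div_const 2
    refine (h1.sub h2).congr_deriv ?_
    have h3 := heq x hx0
    rw [hf0 x hx0]
    simp only [Pi.sub_apply, Pi.pow_apply]
    push_cast
    have h4 : A / 2 * (2 * (deriv u x - deriv v x) ^ (2 - 1) *
        (deriv (deriv u) x - deriv (deriv v) x)) =
        (deriv u x - deriv v x) * (A * (deriv (deriv u) x - deriv (deriv v) x)) := by
      simp only [Nat.add_one_sub_one, pow_one]
      ring
    rw [h4, h3]
    simp only [pow_one]
    ring
  have hc'i : IntegrableOn (fun x => c' x * d x ^ 2 / 2) (Iic 0) := by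
    refine Integrable.mono' (hEi.const_mul (1 / 2)) ?_
      ((ae_restrict_iff' measurableSet_Iic).2 (Eventually.of_forall fun x hx => ?_))
    · have a1 : ContinuousOn u (Iic 0) := hu.continuousOn.mono (Iic_subset_Iio.2 hT)
      have a2 : ContinuousOn v (Iic 0) := hv.continuousOn.mono (Iic_subset_Iio.2 hT)
      have a3 : ContinuousOn (deriv u) (Iic 0) := hu.continuousOn_deriv.mono (Iic_subset_Iio.2 hT)
      have a4 : ContinuousOn (deriv v) (Iic 0) := hv.continuousOn_deriv.mono (Iic_subset_Iio.2 hT)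
      refine ContinuousOn.aestronglyMeasurable ?_ measurableSet_Iic
      fun_prop
    · rw [norm_div, norm_mul, Real.norm_eq_abs, Real.norm_eq_abs, Real.norm_eq_abs,
        abs_of_nonneg (sq_nonneg (d x)), abs_two]
      have := mul_le_mul_of_nonneg_right (hc'ρ x hx) (sq_nonneg (d x))
      linarith
  have hΨi : IntegrableOn (fun x => -β * (f x * W x) - c' x * d x ^ 2 / 2) (Iic 0) :=
    (hWi.const_mul (-β)).sub hc'i
  have hΨlim : Tendsto Ψ atBot (𝓝 0) := by
    have hdl : Tendsto d atBot (𝓝 0) := by simpa using hul.sub hvl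
    have hcl : Tendsto c atBot (𝓝 (φm ^ 2 + φm * φm + φm ^ 2 - waveSpeed φm φp)) :=
      (((hul.pow 2).add (hul.mul hvl)).add (hvl.pow 2)).sub_const _
    have := (((hul'.sub hvl').pow 2).const_mul (A / 2)).sub ((hcl.mul (hdl.pow 2)).div_const 2)
    simpa using this
  have hbal := integral_Iic_of_hasDerivAt_of_tendsto' hΨd hΨi hΨlim
  have hsplit : ∫ x in Iic 0, (-β * (f x * W x) - c' x * d x ^ 2 / 2) =
      -β * D - ∫ x in Iic 0, c' x * d x ^ 2 / 2 := by
    rw [hD, ← integral_const_mul]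
    exact integral_sub (hWi.const_mul (-β)) hc'i
  have hc'le : -(∫ x in Iic 0, c' x * d x ^ 2 / 2) ≤ E / 2 := by
    rw [← integral_neg, hE, ← integral_div]
    refine setIntegral_mono_on hc'i.neg (hEi.div_const 2) measurableSet_Iic fun x hx => ?_
    have h1 := (abs_le.1 (hc'ρ x hx)).1
    have := mul_le_mul_of_nonneg_right h1 (sq_nonneg (d x))
    linarith
  have hΨ0 : 0 ≤ Ψ 0 := by
    simp only [hΨ, hd0]
    have : 0 ≤ A / 2 * (deriv u 0 - deriv v 0) ^ 2 := by positivity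
    linarith
  have hβD : β * D ≤ E / 2 := by
    rw [hsplit, sub_zero] at hbal
    linarith
  have hEκ : E ≤ κ * (6 * M * η) * D := by
    rw [hκ]; linarith
  have hD0 : 0 ≤ D := by
    by_contra! hneg
    have : κ * (6 * M * η) * D < 0 := mul_neg_of_pos_of_neg (by positivity) hneg
    linarith
  -- Coercivity gives `E ≤ β D`, while the balance gives `β D ≤ E / 2`; hence `E = 0`.
  have hED : E ≤ β * D := hEκ.trans (mul_le_mul_of_nonneg_right hηκ hD0)
  have hEz : E = 0 := by linarith
  rw [hE] at hEz
  have hae := (setIntegral_eq_zero_iff_of_nonneg_ae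
    ((ae_restrict_iff' measurableSet_Iic).2 (Eventually.of_forall fun x hx =>
      mul_nonneg (hρpos x hx).le (sq_nonneg (d x)))) hEi).1 hEz
  have hae' : d =ᵐ[volume.restrict (Iio 0)] fun _ => (0 : ℝ) := by
    have h1 := ae_restrict_of_ae_restrict_of_subset Iio_subset_Iic_self hae
    filter_upwards [h1, ae_restrict_mem measurableSet_Iio] with x hx hx0
    have h2 : ρ x * d x ^ 2 = 0 := hx
    have h3 := (hρpos x (le_of_lt hx0)).ne'
    simpa [h3] using h2
  have hfinal := Measure.eqOn_open_of_ae_eq hae' isOpen_Iio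
    (fun x hx => (hdd x (le_of_lt hx)).continuousAt.continuousWithinAt) continuousOn_const
  exact fun x hx => sub_eq_zero.1 (hfinal hx)

/-- Uniqueness up to translation of trajectories near `-∞`. -/
theorem exists_shift_eqOn {α A B φm φp T T' X X' C C' : ℝ} {u v : ℝ → ℝ} (hα0 : 0 < α)
    (hα1 : α < 1) (hA : 0 < A) (hB : 0 < B) (ha : 0 < slopeAt φm φp)
    (hu : GenSol α A B (h φm φp) T u) (hv : GenSol α A B (h φm φp) T' v)
    (hul : Leaving φm X C u) (hvl : Leaving φm X' C' v) :
    ∃ s ξ, ξ < T ∧ ξ + s < T' ∧ EqOn u (fun x => v (x + s)) (Iio ξ) := by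
  obtain ⟨η, hη, hmain⟩ := exists_eqOn_of_smallTail φm φp hα0 hα1 hA hB
  obtain ⟨X₁, hX₁, h1⟩ := exists_smallTail hα0 hα1 hA hB.le ha hη hu hul
  obtain ⟨X₂, hX₂, h2⟩ := exists_smallTail hα0 hα1 hA hB.le ha hη hv hvl
  have hvm : v X₂ < φm := by
    refine lt_of_deriv_neg_of_tendsto hvl.lim (u' := deriv v)
      (fun y hy => hv.hasDerivAt (hy.trans_lt hX₂)) fun y hy => ?_
    have := (h2 X₂ le_rfl).pos (y - X₂) (by linarith)
    simp only [sub_add_cancel] at this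
    linarith
  have hum : ∀ ξ ≤ X₁, u ξ < φm := fun ξ hξ => by
    refine lt_of_deriv_neg_of_tendsto hul.lim (u' := deriv u)
      (fun y hy => hu.hasDerivAt ((hy.trans hξ).trans_lt hX₁)) fun y hy => ?_
    have := (h1 X₁ le_rfl).pos (y - X₁) (by linarith)
    simp only [sub_add_cancel] at this
    linarith
  -- The point is taken so far left that `u ξ` lies between `v X₂` and `φm`, a level that `v` also
  -- attains inside its small tail; the shift aligns these two points.
  obtain ⟨ξ, hξ1, hξ2⟩ := ((eventually_le_atBot X₁).and
    (hul.lim.eventually (lt_mem_nhds hvm))).exists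
  obtain ⟨ζ₀, hζ1, hζ2⟩ := ((eventually_le_atBot X₂).and
    (hvl.lim.eventually (lt_mem_nhds (hum ξ hξ1)))).exists
  obtain ⟨ζ, hζ, hζu⟩ : u ξ ∈ v '' Icc ζ₀ X₂ := by
    refine intermediate_value_Icc' hζ1 (hv.continuousOn.mono fun y hy => ?_) ⟨hξ2.le, hζ2.le⟩
    exact lt_of_le_of_lt hy.2 hX₂
  obtain ⟨δ, hδ⟩ : ∃ δ, δ = min (T - ξ) (T' - ζ) := ⟨_, rfl⟩
  have hδ0 : 0 < δ := by rw [hδ]; exact lt_min (by linarith) (by linarith [hζ.2])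
  have ht1 : Tendsto (fun x : ℝ => x + ξ) atBot atBot := tendsto_atBot_add_const_right _ _ tendsto_id
  have ht2 : Tendsto (fun x : ℝ => x + ζ) atBot atBot := tendsto_atBot_add_const_right _ _ tendsto_id
  have e1 : deriv (fun x => u (x + ξ)) = fun x => deriv u (x + ξ) :=
    funext fun x => deriv_comp_add_const u ξ x
  have e2 : deriv (fun x => v (x + ζ)) = fun x => deriv v (x + ζ) :=
    funext fun x => deriv_comp_add_const v ζ x
  have hfin := hmain δ hδ0 (fun x => u (x + ξ)) (fun x => v (x + ζ))
    ((hu.comp_add ξ).mono (hδ ▸ min_le_left _ _)) ((hv.comp_add ζ).mono (hδ ▸ min_le_right _ _))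
    (hul.lim.comp ht1) (hvl.lim.comp ht2)
    (by rw [e1]; exact (hul.tendsto_deriv hu).comp ht1)
    (by rw [e2]; exact (hvl.tendsto_deriv hv).comp ht2)
    (by rw [e1]; exact h1 ξ hξ1) (by rw [e2]; exact h2 ζ hζ.2) (by simp only [zero_add, hζu])
  refine ⟨ζ - ξ, ξ, by linarith, by linarith [hζ.2], fun x hx => ?_⟩
  have hx' : x < ξ := hx
  have := hfin (show x - ξ < 0 by linarith)
  simp only [sub_add_cancel] at this
  rw [this]
  congr 1
  ring

/-! ### Solutions on half-lines -/

theorem leftRay_coe (T : ℝ) : leftRay (T : EReal) = Iio T := by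
  ext x
  simp [leftRay]

theorem Iio_subset_leftRay {b : EReal} {T : ℝ} (h : (T : EReal) ≤ b) : Iio T ⊆ leftRay b :=
  fun _ hx => lt_of_lt_of_le (EReal.coe_lt_coe_iff.2 hx) h

theorem exists_real_between {b : EReal} {x : ℝ} (hx : x ∈ leftRay b) :
    ∃ T : ℝ, x < T ∧ (T : EReal) < b := by
  obtain ⟨T, h1, h2⟩ := EReal.lt_iff_exists_real_btwn.1 hx
  exact ⟨T, EReal.coe_lt_coe_iff.1 h1, h2⟩

theorem iteratedDeriv_two (u : ℝ → ℝ) : iteratedDeriv 2 u = deriv (deriv u) := by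
  rw [iteratedDeriv_succ, iteratedDeriv_one]

theorem iteratedDeriv_three (u : ℝ → ℝ) : iteratedDeriv 3 u = deriv (deriv (deriv u)) := by
  rw [iteratedDeriv_succ, iteratedDeriv_two]

theorem contDiffOn_three_iff {T : ℝ} {u : ℝ → ℝ} :
    ContDiffOn ℝ 3 u (Iio T) ↔ DifferentiableOn ℝ u (Iio T) ∧ ContDiffOn ℝ 2 (deriv u) (Iio T) := by
  rw [show (3 : WithTop ℕ∞) = 2 + 1 by norm_num, contDiffOn_succ_iff_deriv_of_isOpen isOpen_Iio]
  simp

section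

variable {α φm φp τ : ℝ} {b : EReal} {φ ψ : ℝ → ℝ}

theorem IsSolutionOn.genSol (h : IsSolutionOn α φm φp τ b φ) {T : ℝ} (hT : (T : EReal) ≤ b) :
    GenSol α τ 1 (NonlocalTW.h φm φp) T φ := by
  refine ⟨(h.contDiffOn.mono (Iio_subset_leftRay hT)).of_le (by norm_num),
    fun x hx => h.integrable x (Iio_subset_leftRay hT hx), fun x hx => ?_⟩
  have := h.equation x (Iio_subset_leftRay hT hx)
  rwa [iteratedDeriv_two, fracDeriv_eq_fracInt, ← one_mul (fracInt α (deriv φ) x)] at this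

theorem isSolutionOn_of_genSol {T : ℝ} (h : GenSol α τ 1 (NonlocalTW.h φm φp) T φ)
    (h3 : ContDiffOn ℝ 3 φ (Iio T)) : IsSolutionOn α φm φp τ T φ := by
  refine ⟨by rwa [leftRay_coe], fun x hx => ?_, fun x hx => ?_⟩ <;>
    rw [leftRay_coe] at hx
  · exact h.integrable x hx
  · rw [iteratedDeriv_two, fracDeriv_eq_fracInt, ← one_mul (fracInt α (deriv φ) x)]
    exact h.equation x hx

theorem IsSolutionOn.mono (h : IsSolutionOn α φm φp τ b φ) {b' : EReal} (hb : b' ≤ b) :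
    IsSolutionOn α φm φp τ b' φ := by
  have hs : leftRay b' ⊆ leftRay b := fun x hx => lt_of_lt_of_le hx hb
  exact ⟨h.contDiffOn.mono hs, fun x hx => h.integrable x (hs hx),
    fun x hx => h.equation x (hs hx)⟩

theorem isSolutionOn_of_forall (h : ∀ x ∈ leftRay b, ∃ T : ℝ, x < T ∧ IsSolutionOn α φm φp τ T φ) :
    IsSolutionOn α φm φp τ b φ := by
  refine ⟨fun x hx => ?_, fun x hx => ?_, fun x hx => ?_⟩ <;> obtain ⟨T, hT, hs⟩ := h x hx
  · have := hs.contDiffOn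
    rw [leftRay_coe] at this
    exact (this.contDiffAt (Iio_mem_nhds hT)).contDiffWithinAt
  · exact hs.integrable x (EReal.coe_lt_coe_iff.2 hT)
  · exact hs.equation x (EReal.coe_lt_coe_iff.2 hT)

theorem IsSolutionOn.congr (h : IsSolutionOn α φm φp τ b φ) (he : EqOn ψ φ (leftRay b)) :
    IsSolutionOn α φm φp τ b ψ := by
  refine isSolutionOn_of_forall fun x hx => ?_
  obtain ⟨T, hT, hTb⟩ := exists_real_between hx
  have he' := he.mono (Iio_subset_leftRay hTb.le)
  exact ⟨T, hT, isSolutionOn_of_genSol ((h.genSol hTb.le).congr he')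
    ((h.contDiffOn.mono (Iio_subset_leftRay hTb.le)).congr he')⟩

end

theorem exists_abs_le_of_tendsto_atBot {u : ℝ → ℝ} {φm T T' : ℝ} (hu : ContinuousOn u (Iio T))
    (hlim : Tendsto u atBot (𝓝 φm)) (hT : T' < T) : ∃ M, ∀ x ≤ T', |u x| ≤ M := by
  have h1 := hlim.abs.eventually (gt_mem_nhds (lt_add_one |φm|))
  obtain ⟨Y, hY⟩ := eventually_atBot.1 h1
  obtain ⟨M, hM⟩ := (isCompact_Icc (a := Y) (b := T')).exists_bound_of_continuousOn
    (hu.mono fun x hx => hx.2.trans_lt hT)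
  refine ⟨max M (|φm| + 1), fun x hx => ?_⟩
  rcases le_total x Y with h | h
  · exact (hY x h).le.trans (le_max_right _ _)
  · exact (hM x ⟨h, hx⟩).trans (le_max_left _ _)

/-- On each smaller half-line both solutions are bounded, so the cubic may be replaced by a
Lipschitz truncation without changing either equation. -/
theorem GenSol.eqOn_of_tendsto {α A B φm φp l T ξ : ℝ} {u v : ℝ → ℝ} (hα1 : α < 1) (hA : 0 < A)
    (hB : 0 ≤ B) (hu : GenSol α A B (h φm φp) T u) (hv : GenSol α A B (h φm φp) T v)
    (hul : Tendsto u atBot (𝓝 l)) (hvl : Tendsto v atBot (𝓝 l)) (he : EqOn u v (Iio ξ)) :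
    EqOn u v (Iio T) := by
  intro x hx
  obtain ⟨T', h1, h2⟩ := exists_between (show x < T from hx)
  obtain ⟨M, hM⟩ := exists_abs_le_of_tendsto_atBot hu.continuousOn hul h2
  obtain ⟨M', hM'⟩ := exists_abs_le_of_tendsto_atBot hv.continuousOn hvl h2
  have hN : 0 ≤ max M M' := ((abs_nonneg _).trans (hM T' le_rfl)).trans (le_max_left _ _)
  refine GenSol.eqOn (H := hcut φm φp (max M M')) hα1 hA hB (abs_hcut_sub_le hN)
    ((hu.mono h2.le).congr_fun fun y hy => ?_) ((hv.mono h2.le).congr_fun fun y hy => ?_) he h1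
  · exact hcut_eq ((hM y (le_of_lt hy)).trans (le_max_left _ _))
  · exact hcut_eq ((hM' y (le_of_lt hy)).trans (le_max_right _ _))

/-- A solution with exponential bounds is of class `C³`, with an exponentially bounded third
derivative. -/
theorem GenSol.contDiffOn_three {α A B φm φp T N C : ℝ} {u : ℝ → ℝ} (hα1 : α < 1) (hA : 0 < A)
    (hB : 0 ≤ B) (hu : GenSol α A B (h φm φp) T u) (hN : ∀ x < T, |u x| ≤ N)
    (h1 : ∀ x < T, |deriv u x| ≤ C * Real.exp x)
    (h2 : ∀ x < T, |deriv (deriv u) x| ≤ C * Real.exp x) :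
    ContDiffOn ℝ 3 u (Iio T) ∧
      ∃ C', ∀ x < T, |deriv (deriv (deriv u)) x| ≤ C' * Real.exp x := by
  have h1' : ∀ x < T, |deriv u x| ≤ C * Real.exp (1 * x) := by simpa only [one_mul] using h1
  have h2' : ∀ x < T, |deriv (deriv u) x| ≤ C * Real.exp (1 * x) := by
    simpa only [one_mul] using h2
  set D : ℝ → ℝ := fun x => A⁻¹ * ((3 * u x ^ 2 - waveSpeed φm φp) * deriv u x -
    B * fracInt α (deriv (deriv u)) x) with hD
  have hd : ∀ x < T, HasDerivAt (deriv (deriv u)) (D x) x := by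
    intro x hx
    have e1 : HasDerivAt (fun x => A⁻¹ * (h φm φp (u x) - B * fracInt α (deriv u) x)) (D x) x := by
      have e2 := hasDerivAt_fracInt hα1 one_pos (fun y hy => hu.hasDerivAt_deriv hy)
        hu.continuousOn_deriv2 h1' h2' hx
      have e3 := hu.hasDerivAt hx
      refine HasDerivAt.const_mul _ (HasDerivAt.sub ?_ (e2.const_mul B))
      unfold h
      have e4 := (((e3.sub_const φm).const_mul (-waveSpeed φm φp)).add (e3.pow 3)).sub_const (φm ^ 3)
      refine e4.congr_deriv ?_
      push_cast
      ring
    refine e1.congr_of_eventuallyEq ?_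
    filter_upwards [Iio_mem_nhds hx] with y hy
    rw [← hu.equation y hy]
    field_simp
    ring
  have hder : ∀ x < T, deriv (deriv (deriv u)) x = D x := fun x hx => (hd x hx).deriv
  constructor
  · refine contDiffOn_three_iff.2 ⟨fun x hx => (hu.hasDerivAt hx).differentiableAt.differentiableWithinAt,
      contDiffOn_two_iff.2 ⟨fun x hx =>
        (hu.hasDerivAt_deriv hx).differentiableAt.differentiableWithinAt, fun x hx =>
        (hd x hx).differentiableAt.differentiableWithinAt, ?_⟩⟩
    refine ContinuousOn.congr ?_ fun x hx => hder x hx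
    refine ContinuousOn.mul continuousOn_const (ContinuousOn.sub (ContinuousOn.mul ?_
      hu.continuousOn_deriv) (ContinuousOn.mul continuousOn_const fun x hx =>
      (continuousAt_fracInt hα1 one_pos hu.continuousOn_deriv2 h2' hx).continuousWithinAt))
    exact ((hu.continuousOn.pow 2).const_mul 3).sub continuousOn_const
  · refine ⟨A⁻¹ * ((3 * N ^ 2 + |waveSpeed φm φp|) * C + B * C), fun x hx => ?_⟩
    rw [hder x hx, hD]
    simp only
    have e1 := abs_fracInt_le_of_exp_bound (C := C) (x := x) hα1 one_pos
      (fun y hy => h2' y (hy.trans hx))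
    rw [Real.one_rpow, mul_one, one_mul] at e1
    have e2 : |3 * u x ^ 2 - waveSpeed φm φp| ≤ 3 * N ^ 2 + |waveSpeed φm φp| := by
      refine (abs_sub _ _).trans ?_
      have : |3 * u x ^ 2| ≤ 3 * N ^ 2 := by
        rw [abs_mul, abs_pow, abs_of_pos (by norm_num : (0 : ℝ) < 3)]
        have := hN x hx
        gcongr
      linarith
    rw [abs_mul, abs_of_pos (inv_pos.2 hA), mul_assoc]
    refine mul_le_mul_of_nonneg_left ?_ (inv_pos.2 hA).le
    refine (abs_sub _ _).trans ?_
    rw [abs_mul, abs_mul, abs_of_nonneg hB, add_mul, mul_assoc, mul_assoc]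
    exact add_le_add (mul_le_mul e2 (h1 x hx) (abs_nonneg _) ((abs_nonneg _).trans e2))
      (mul_le_mul_of_nonneg_left e1 hB)

theorem memLp_two_of_exp_bound {f : ℝ → ℝ} {C μ X : ℝ} (hμ : 0 < μ) (hf : ContinuousOn f (Iio X))
    (hb : ∀ x < X, |f x| ≤ C * Real.exp (μ * x)) : MemLp f 2 (volume.restrict (Iio X)) := by
  have hm := hf.aestronglyMeasurable (μ := volume) measurableSet_Iio
  rw [memLp_two_iff_integrable_sq hm]
  have hi : IntegrableOn (fun x => C ^ 2 * Real.exp (2 * μ * x)) (Iio X) :=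
    ((integrableOn_exp_mul_Iic (by positivity : 0 < 2 * μ) X).mono_set Iio_subset_Iic_self).const_mul _
  refine Integrable.mono' hi (hm.pow 2) ((ae_restrict_iff' measurableSet_Iio).2
    (Eventually.of_forall fun x hx => ?_))
  rw [Real.norm_eq_abs, abs_pow]
  refine (pow_le_pow_left₀ (abs_nonneg _) (hb x hx) 2).trans_eq ?_
  rw [mul_pow, ← Real.exp_nat_mul]
  push_cast
  ring_nf

/-! ### Base solutions and their rescaling to the original equation. -/

/-- A global solution, leaving `φm` downwards at exponential rate, of the equation with truncated
nonlinearity. -/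
structure IsBase (α A B φm φp N : ℝ) (v : ℝ → ℝ) : Prop where
  sol : ∀ T, GenSol α A B (hcut φm φp N) T v
  bound : ∀ T, ∃ C, ∀ x ≤ T, |v x - φm| ≤ C * Real.exp x ∧ |deriv v x| ≤ C * Real.exp x ∧
    |deriv (deriv v) x| ≤ C * Real.exp x
  neg : ∃ X, ∀ x ≤ X, deriv v x < 0

theorem tendsto_of_exp_bound {u : ℝ → ℝ} {c C T : ℝ} (h : ∀ x ≤ T, |u x - c| ≤ C * Real.exp x) :
    Tendsto u atBot (𝓝 c) := by
  rw [tendsto_iff_norm_sub_tendsto_zero]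
  have h0 : Tendsto (fun x => C * Real.exp x) atBot (𝓝 0) := by
    simpa using Real.tendsto_exp_atBot.const_mul C
  refine squeeze_zero' (Eventually.of_forall fun _ => norm_nonneg _) ?_ h0
  filter_upwards [eventually_le_atBot T] with x hx using h x hx

section

variable {α A B φm φp N τ l T : ℝ} {v : ℝ → ℝ}

theorem IsBase.tendsto (h : IsBase α A B φm φp N v) : Tendsto v atBot (𝓝 φm) := by
  obtain ⟨C, hC⟩ := h.bound 0
  exact tendsto_of_exp_bound fun x hx => (hC x hx).1

theorem IsBase.tendsto_deriv (h : IsBase α A B φm φp N v) : Tendsto (deriv v) atBot (𝓝 0) := by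
  obtain ⟨C, hC⟩ := h.bound 0
  exact tendsto_of_exp_bound fun x hx => by simpa only [sub_zero] using (hC x hx).2.1

theorem IsBase.continuous (h : IsBase α A B φm φp N v) : Continuous v :=
  continuous_iff_continuousAt.2 fun x => ((h.sol (x + 1)).hasDerivAt (by linarith)).continuousAt

theorem IsBase.genSol (h : IsBase α A B φm φp N v) (hT : ∀ x < T, |v x| ≤ N) :
    GenSol α A B (NonlocalTW.h φm φp) T v :=
  (h.sol T).congr_fun fun x hx => (hcut_eq (hT x hx)).symm

theorem IsBase.exists_abs_le (h : IsBase α A B φm φp N v) (hN : |φm| + 1 ≤ N) :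
    ∃ T, ∀ x < T, |v x| ≤ N := by
  have h1 := h.tendsto.abs.eventually (gt_mem_nhds (lt_add_one |φm|))
  obtain ⟨Y, hY⟩ := eventually_atBot.1 h1
  exact ⟨Y, fun x hx => (hY x hx.le).le.trans hN⟩

theorem IsBase.contDiffOn (h : IsBase α A B φm φp N v) (hα1 : α < 1) (hA : 0 < A) (hB : 0 ≤ B)
    (hT : ∀ x < T, |v x| ≤ N) : ContDiffOn ℝ 3 v (Iio T) ∧
      ∃ C', ∀ x < T, |deriv (deriv (deriv v)) x| ≤ C' * Real.exp x := by
  obtain ⟨C, hC⟩ := h.bound T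
  exact (h.genSol hT).contDiffOn_three hα1 hA hB hT (fun x hx => (hC x hx.le).2.1)
    fun x hx => (hC x hx.le).2.2

theorem IsBase.sol_comp (h : IsBase α A B φm φp N v) (hl : 0 < l) (hAl : A * l ^ 2 = τ)
    (hBl : B * l ^ α = 1) (s T : ℝ) :
    GenSol α τ 1 (hcut φm φp N) T (fun ξ => v ((ξ + s) / l)) := by
  have := ((h.sol ((T + s) / l)).comp_div hl).comp_add s
  rwa [hAl, hBl, div_mul_cancel₀ _ hl.ne', add_sub_cancel_right] at this

theorem IsBase.isSolutionOn (h : IsBase α A B φm φp N v) (hα1 : α < 1) (hA : 0 < A) (hB : 0 ≤ B)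
    (hl : 0 < l) (hAl : A * l ^ 2 = τ) (hBl : B * l ^ α = 1) {s : ℝ}
    (hT : ∀ ξ < T, |v ((ξ + s) / l)| ≤ N) :
    IsSolutionOn α φm φp τ T (fun ξ => v ((ξ + s) / l)) := by
  have hT' : ∀ x < (T + s) / l, |v x| ≤ N := fun x hx => by
    have := hT (x * l - s) (by rw [lt_div_iff₀ hl] at hx; linarith)
    rwa [sub_add_cancel, mul_div_cancel_right₀ _ hl.ne'] at this
  refine isSolutionOn_of_genSol ((h.sol_comp hl hAl hBl s T).congr_fun
    fun x hx => (hcut_eq (hT x hx)).symm) ?_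
  refine (h.contDiffOn hα1 hA hB hT').1.comp (by fun_prop) fun x hx => ?_
  have hx : x < T := hx
  show (x + s) / l < (T + s) / l
  gcongr

theorem IsBase.inClass (h : IsBase α A B φm φp N v) (hα1 : α < 1) (hA : 0 < A) (hB : 0 ≤ B)
    (hl : 0 < l) (hT : ∀ x < T, |v x| ≤ N) :
    InClassNearMinusInfty φm (fun ξ => v (ξ / l)) (T * l) := by
  obtain ⟨C, hC⟩ := h.bound T
  obtain ⟨h3, C', hC'⟩ := h.contDiffOn hα1 hA hB hT
  obtain ⟨h30, h31⟩ := contDiffOn_three_iff.1 h3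
  obtain ⟨h32, h33, -⟩ := contDiffOn_two_iff.1 h31
  have d1 : deriv (fun ξ => v (ξ / l)) = fun ξ => l⁻¹ * deriv v (ξ / l) := deriv_comp_div v l
  have d2 : deriv (fun ξ => l⁻¹ * deriv v (ξ / l)) =
      fun ξ => l⁻¹ * (l⁻¹ * deriv (deriv v) (ξ / l)) := by
    funext x
    rw [deriv_const_mul_field, deriv_comp_div]
  have d3 : deriv (fun ξ => l⁻¹ * (l⁻¹ * deriv (deriv v) (ξ / l))) =
      fun ξ => l⁻¹ * (l⁻¹ * (l⁻¹ * deriv (deriv (deriv v)) (ξ / l))) := by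
    funext x
    rw [deriv_const_mul_field, deriv_const_mul_field, deriv_comp_div]
  have hlt : ∀ ξ < T * l, ξ / l < T := fun ξ hξ => (div_lt_iff₀ hl).2 hξ
  have hmaps : MapsTo (fun ξ : ℝ => ξ / l) (Iio (T * l)) (Iio T) := hlt
  have hexp : ∀ ξ < T * l, Real.exp (ξ / l) ≤ Real.exp T := fun ξ hξ =>
    Real.exp_le_exp.2 (hlt ξ hξ).le
  have hli : 0 < l⁻¹ := inv_pos.2 hl
  have b0 : ∀ ξ < T * l, |v (ξ / l) - φm| ≤ C * Real.exp (l⁻¹ * ξ) := fun ξ hξ => by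
    rw [show l⁻¹ * ξ = ξ / l from (div_eq_inv_mul _ _).symm]; exact (hC _ (hlt ξ hξ).le).1
  have b1 : ∀ ξ < T * l, |l⁻¹ * deriv v (ξ / l)| ≤ l⁻¹ * C * Real.exp (l⁻¹ * ξ) := fun ξ hξ => by
    rw [show l⁻¹ * ξ = ξ / l from (div_eq_inv_mul _ _).symm, abs_mul, abs_of_pos hli, mul_assoc]
    exact mul_le_mul_of_nonneg_left (hC _ (hlt ξ hξ).le).2.1 hli.le
  have b2 : ∀ ξ < T * l, |l⁻¹ * (l⁻¹ * deriv (deriv v) (ξ / l))| ≤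
      l⁻¹ * (l⁻¹ * C) * Real.exp (l⁻¹ * ξ) := fun ξ hξ => by
    rw [show l⁻¹ * ξ = ξ / l from (div_eq_inv_mul _ _).symm, abs_mul, abs_mul, abs_of_pos hli, mul_assoc, mul_assoc]
    exact mul_le_mul_of_nonneg_left (mul_le_mul_of_nonneg_left (hC _ (hlt ξ hξ).le).2.2 hli.le)
      hli.le
  have b3 : ∀ ξ < T * l, |l⁻¹ * (l⁻¹ * (l⁻¹ * deriv (deriv (deriv v)) (ξ / l)))| ≤
      l⁻¹ * (l⁻¹ * (l⁻¹ * C')) * Real.exp (l⁻¹ * ξ) := fun ξ hξ => by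
    rw [show l⁻¹ * ξ = ξ / l from (div_eq_inv_mul _ _).symm, abs_mul, abs_mul, abs_mul, abs_of_pos hli, mul_assoc, mul_assoc,
      mul_assoc]
    exact mul_le_mul_of_nonneg_left (mul_le_mul_of_nonneg_left (mul_le_mul_of_nonneg_left
      (hC' _ (hlt ξ hξ)) hli.le) hli.le) hli.le
  have hbdd : ∀ {f : ℝ → ℝ} {K : ℝ}, (∀ ξ < T * l, |f ξ| ≤ K * Real.exp (l⁻¹ * ξ)) →
      ∃ C, ∀ ξ < T * l, |f ξ| ≤ C := by
    intro f K hf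
    have hK : 0 ≤ K := by
      have := (abs_nonneg _).trans (hf (T * l - 1) (by linarith))
      exact nonneg_of_mul_nonneg_left this (Real.exp_pos _)
    refine ⟨K * Real.exp T, fun ξ hξ => (hf ξ hξ).trans ?_⟩
    rw [show l⁻¹ * ξ = ξ / l from (div_eq_inv_mul _ _).symm]
    exact mul_le_mul_of_nonneg_left (hexp ξ hξ) hK
  have i1 : iteratedDeriv 1 (fun ξ => v (ξ / l)) = fun ξ => l⁻¹ * deriv v (ξ / l) := by
    rw [iteratedDeriv_one, d1]
  have i2 : iteratedDeriv 2 (fun ξ => v (ξ / l)) =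
      fun ξ => l⁻¹ * (l⁻¹ * deriv (deriv v) (ξ / l)) := by
    rw [iteratedDeriv_two, d1, d2]
  have i3 : iteratedDeriv 3 (fun ξ => v (ξ / l)) =
      fun ξ => l⁻¹ * (l⁻¹ * (l⁻¹ * deriv (deriv (deriv v)) (ξ / l))) := by
    rw [iteratedDeriv_three, d1, d2, d3]
  refine ⟨memLp_two_of_exp_bound hli ?_ b0, fun k hk1 hk2 => ?_, fun k hk => ?_⟩
  · exact (h30.continuousOn.comp (by fun_prop) hmaps).sub continuousOn_const
  · interval_cases k
    · rw [i1]
      exact memLp_two_of_exp_bound hli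
        (continuousOn_const.mul (h32.continuousOn.comp (by fun_prop) hmaps)) b1
    · rw [i2]
      exact memLp_two_of_exp_bound hli (continuousOn_const.mul
        (continuousOn_const.mul (h33.continuousOn.comp (by fun_prop) hmaps))) b2
  · interval_cases k
    · obtain ⟨K, hK⟩ := hbdd b0
      refine ⟨K + |φm|, fun ξ hξ => ?_⟩
      rw [iteratedDeriv_zero]
      have := abs_add_le (v (ξ / l) - φm) φm
      rw [sub_add_cancel] at this
      linarith [hK ξ hξ]
    · rw [i1]; exact hbdd b1
    · rw [i2]; exact hbdd b2
    · rw [i3]; exact hbdd b3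

end

theorem iteratedDeriv_eqOn {u v : ℝ → ℝ} {T : ℝ} (h : EqOn u v (Iio T)) (k : ℕ) :
    EqOn (iteratedDeriv k u) (iteratedDeriv k v) (Iio T) := fun x hx => by
  have : u =ᶠ[𝓝 x] v := by
    filter_upwards [Iio_mem_nhds hx] with y hy using h hy
  exact this.iteratedDeriv_eq k

theorem InClassNearMinusInfty.congr {φm X : ℝ} {u v : ℝ → ℝ} (h : InClassNearMinusInfty φm v X)
    (he : EqOn u v (Iio X)) : InClassNearMinusInfty φm u X := by
  obtain ⟨h1, h2, h3⟩ := h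
  refine ⟨(memLp_congr_ae ?_).1 h1, fun k hk1 hk2 => (memLp_congr_ae ?_).1 (h2 k hk1 hk2),
    fun k hk => ?_⟩
  · refine (ae_restrict_iff' measurableSet_Iio).2 (Eventually.of_forall fun x hx => ?_)
    simp only [he hx]
  · exact (ae_restrict_iff' measurableSet_Iio).2 (Eventually.of_forall fun x hx =>
      (iteratedDeriv_eqOn he k hx).symm)
  · obtain ⟨C, hC⟩ := h3 k hk
    exact ⟨C, fun x hx => by rw [iteratedDeriv_eqOn he k hx]; exact hC x hx⟩

/-! ### Maximal extension, and comparison of trajectories with base solutions. -/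

/-- Every solution on a half-line extends to a maximal interval of existence. -/
theorem exists_maximal_extension {α φm φp τ X l : ℝ} {w : ℝ → ℝ} (hα1 : α < 1) (hτ : 0 < τ)
    (hw : IsSolutionOn α φm φp τ X w) (hlim : Tendsto w atBot (𝓝 l)) :
    ∃ (b : EReal) (φ : ℝ → ℝ), (X : EReal) ≤ b ∧ IsSolutionOn α φm φp τ b φ ∧
      EqOn φ w (Iio X) ∧ ∀ (b' : EReal) (ψ : ℝ → ℝ), b < b' → IsSolutionOn α φm φp τ b' ψ →
        ¬ EqOn ψ φ (leftRay b) := by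
  classical
  -- The end points of all extensions of `w`. Forward uniqueness makes these extensions compatible,
  -- so they glue to one solution up to the supremum.
  set S : Set EReal := {b | ∃ ψ, IsSolutionOn α φm φp τ b ψ ∧ EqOn ψ w (Iio X)} with hS
  have hlim' : ∀ ψ : ℝ → ℝ, EqOn ψ w (Iio X) → Tendsto ψ atBot (𝓝 l) := fun ψ he => by
    refine hlim.congr' ?_
    filter_upwards [eventually_lt_atBot X] with x hx using (he hx).symm
  have huniq : ∀ b₁ b₂ ψ₁ ψ₂, IsSolutionOn α φm φp τ b₁ ψ₁ → EqOn ψ₁ w (Iio X) →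
      IsSolutionOn α φm φp τ b₂ ψ₂ → EqOn ψ₂ w (Iio X) → ∀ x : ℝ, (x : EReal) < b₁ →
      (x : EReal) < b₂ → ψ₁ x = ψ₂ x := by
    intro b₁ b₂ ψ₁ ψ₂ h1 e1 h2 e2 x hx1 hx2
    obtain ⟨T, hxT, hT⟩ := exists_real_between (b := min b₁ b₂) (lt_min hx1 hx2)
    have hT1 := (hT.trans_le (min_le_left _ _)).le
    have hT2 := (hT.trans_le (min_le_right _ _)).le
    exact GenSol.eqOn_of_tendsto hα1 hτ zero_le_one (h1.genSol hT1) (h2.genSol hT2)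
      (hlim' _ e1) (hlim' _ e2) (fun y hy => (e1 hy).trans (e2 hy).symm) hxT
  have hXS : (X : EReal) ∈ S := ⟨w, hw, fun _ _ => rfl⟩
  have hex : ∀ x ∈ leftRay (sSup S), ∃ ψ : ℝ → ℝ, ∃ b : EReal, (x : EReal) < b ∧
      IsSolutionOn α φm φp τ b ψ ∧ EqOn ψ w (Iio X) := by
    intro x hx
    obtain ⟨b, ⟨ψ, h1, h2⟩, hb⟩ := lt_sSup_iff.1 (show (x : EReal) < sSup S from hx)
    exact ⟨ψ, b, hb, h1, h2⟩
  -- One extension is chosen for each point; its diagonal `x ↦ Ψ x x` is the glued solution.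
  choose! Ψ hΨ using hex
  have hφ : ∀ b ψ, IsSolutionOn α φm φp τ b ψ → EqOn ψ w (Iio X) →
      EqOn (fun x => Ψ x x) ψ (leftRay b) := by
    intro b ψ h1 h2 x hx
    have hxS : x ∈ leftRay (sSup S) := lt_of_lt_of_le hx (le_sSup (show b ∈ S from ⟨ψ, h1, h2⟩))
    obtain ⟨b', hb', h1', h2'⟩ := hΨ x hxS
    exact huniq b' b _ _ h1' h2' h1 h2 x hb' hx
  have hφw : EqOn (fun x => Ψ x x) w (Iio X) := by
    have := hφ X w hw fun _ _ => rfl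
    rwa [leftRay_coe] at this
  refine ⟨sSup S, fun x => Ψ x x, le_sSup hXS, ?_, hφw, ?_⟩
  · refine isSolutionOn_of_forall fun x hx => ?_
    obtain ⟨b', hb', h1', h2'⟩ := hΨ x hx
    obtain ⟨T, hxT, hT⟩ := exists_real_between hb'
    exact ⟨T, hxT, (h1'.congr (hφ _ _ h1' h2')).mono hT.le⟩
  · intro b' ψ hb' hψ he
    have hX : Iio X ⊆ leftRay (sSup S) := Iio_subset_leftRay (le_sSup hXS)
    have : b' ∈ S := ⟨ψ, hψ, fun x hx => (he (hX hx)).trans (hφw hx)⟩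
    exact absurd (le_sSup this) (not_le.2 hb')

/-- The trajectory through a base solution. -/
theorem IsBase.exists_isTrajectory {α A B φm φp N τ l : ℝ} {v : ℝ → ℝ}
    (h : IsBase α A B φm φp N v) (hN : |φm| + 1 ≤ N) (hα1 : α < 1) (hA : 0 < A) (hB : 0 ≤ B)
    (hl : 0 < l) (hAl : A * l ^ 2 = τ) (hBl : B * l ^ α = 1) :
    ∃ (b : EReal) (φ : ℝ → ℝ), IsTrajectory α φm φp τ b φ := by
  have hτ : 0 < τ := by rw [← hAl]; positivity
  obtain ⟨T₀, hT₀⟩ := h.exists_abs_le hN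
  obtain ⟨X₀, hX₀⟩ := h.neg
  set T := min T₀ X₀
  have hT : ∀ x < T, |v x| ≤ N := fun x hx => hT₀ x (hx.trans_le (min_le_left _ _))
  have hlt : ∀ ξ < T * l, ξ / l < T := fun ξ hξ => (div_lt_iff₀ hl).2 hξ
  have hw : IsSolutionOn α φm φp τ (T * l : ℝ) (fun ξ => v (ξ / l)) := by
    have := h.isSolutionOn hα1 hA hB hl hAl hBl (s := 0) (T := T * l) fun ξ hξ => by
      rw [add_zero]; exact hT _ (hlt ξ hξ)
    simpa only [add_zero] using this
  have hlim : Tendsto (fun ξ => v (ξ / l)) atBot (𝓝 φm) :=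
    h.tendsto.comp (tendsto_id.atBot_div_const hl)
  obtain ⟨b, φ, hXb, hφ, he, hmax⟩ := exists_maximal_extension hα1 hτ hw hlim
  refine ⟨b, φ, hφ, ?_, ⟨T * l - 1, ?_, fun ξ hξ => ?_, ?_⟩, hmax⟩
  · refine hlim.congr' ?_
    filter_upwards [eventually_lt_atBot (T * l)] with x hx using (he hx).symm
  · exact lt_of_lt_of_le (EReal.coe_lt_coe_iff.2 (by linarith)) hXb
  · have hξ' : ξ < T * l := by linarith
    rw [eqOn_deriv_of_eqOn he hξ', deriv_comp_div]
    have := hX₀ (ξ / l) ((hlt ξ hξ').le.trans (min_le_right _ _))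
    exact mul_neg_of_pos_of_neg (inv_pos.2 hl) this
  · have h1 : InClassNearMinusInfty φm (fun ξ => v (ξ / l)) ((T - l⁻¹) * l) :=
      h.inClass hα1 hA hB hl fun x hx => hT x (hx.trans (by linarith [inv_pos.2 hl]))
    rw [sub_mul, inv_mul_cancel₀ hl.ne'] at h1
    exact h1.congr (he.mono (Iio_subset_Iio (by linarith)))

theorem IsTrajectory.exists_leaving {α φm φp τ : ℝ} {b : EReal} {φ : ℝ → ℝ}
    (h : IsTrajectory α φm φp τ b φ) : ∃ X C, Leaving φm X C φ := by
  obtain ⟨X, -, hneg, -, -, hb⟩ := h.nearMinusInfty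
  obtain ⟨C₁, h1⟩ := hb 1 (by norm_num)
  obtain ⟨C₂, h2⟩ := hb 2 (by norm_num)
  rw [iteratedDeriv_one] at h1
  rw [iteratedDeriv_two] at h2
  exact ⟨X, max C₁ C₂, h.farField, hneg, fun x hx => (h1 x hx).trans (le_max_left _ _),
    fun x hx => (h2 x hx).trans (le_max_right _ _)⟩

theorem IsTrajectory.exists_real_lt {α φm φp τ : ℝ} {b : EReal} {φ : ℝ → ℝ}
    (h : IsTrajectory α φm φp τ b φ) : ∃ T : ℝ, (T : EReal) < b := by
  obtain ⟨X, hX, -⟩ := h.nearMinusInfty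
  exact ⟨X, hX⟩

section

variable {α A B φm φp N τ l : ℝ} {b : EReal} {φ v : ℝ → ℝ}

/-- Every trajectory starts as a translate of the rescaled base solution. -/
theorem IsBase.exists_eqOn_trajectory (hv : IsBase α A B φm φp N v) (hN : |φm| + 1 ≤ N)
    (hα0 : 0 < α) (hα1 : α < 1) (hA : 0 < A) (ha : 0 < slopeAt φm φp) (hl : 0 < l)
    (hAl : A * l ^ 2 = τ) (hBl : B * l ^ α = 1) (h : IsTrajectory α φm φp τ b φ) :
    ∃ s ξ, EqOn φ (fun x => v ((x + s) / l)) (Iio ξ) := by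
  have hτ : 0 < τ := by rw [← hAl]; positivity
  have hli : 0 < l⁻¹ := inv_pos.2 hl
  obtain ⟨T, hT⟩ := h.exists_real_lt
  obtain ⟨X, C, hL⟩ := h.exists_leaving
  obtain ⟨T₀, hT₀⟩ := hv.exists_abs_le hN
  obtain ⟨X₀, hX₀⟩ := hv.neg
  obtain ⟨C₀, hC₀⟩ := hv.bound X₀
  have hw : GenSol α τ 1 (NonlocalTW.h φm φp) (T₀ * l) (fun x => v (x / l)) := by
    have := (hv.genSol hT₀).comp_div hl
    rwa [hAl, hBl] at this
  have d1 : deriv (fun ξ => v (ξ / l)) = fun ξ => l⁻¹ * deriv v (ξ / l) := deriv_comp_div v l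
  have d2 : deriv (fun ξ => l⁻¹ * deriv v (ξ / l)) =
      fun ξ => l⁻¹ * (l⁻¹ * deriv (deriv v) (ξ / l)) := by
    funext x
    rw [deriv_const_mul_field, deriv_comp_div]
  have hC₀0 : 0 ≤ C₀ := by
    have := (abs_nonneg _).trans (hC₀ X₀ le_rfl).1
    exact nonneg_of_mul_nonneg_left this (Real.exp_pos _)
  have hlt : ∀ ξ < X₀ * l, ξ / l ≤ X₀ := fun ξ hξ => ((div_lt_iff₀ hl).2 hξ).le
  have hexp : ∀ ξ < X₀ * l, C₀ * Real.exp (ξ / l) ≤ C₀ * Real.exp X₀ := fun ξ hξ =>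
    mul_le_mul_of_nonneg_left (Real.exp_le_exp.2 (hlt ξ hξ)) hC₀0
  have hwL : Leaving φm (X₀ * l) (max (l⁻¹ * (C₀ * Real.exp X₀)) (l⁻¹ * (l⁻¹ * (C₀ * Real.exp X₀))))
      (fun x => v (x / l)) := by
    refine ⟨hv.tendsto.comp (tendsto_id.atBot_div_const hl), fun ξ hξ => ?_, fun ξ hξ => ?_,
      fun ξ hξ => ?_⟩
    · rw [d1]
      exact mul_neg_of_pos_of_neg hli (hX₀ _ (hlt ξ hξ))
    · rw [d1, abs_mul, abs_of_pos hli]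
      exact (mul_le_mul_of_nonneg_left ((hC₀ _ (hlt ξ hξ)).2.1.trans (hexp ξ hξ)) hli.le).trans
        (le_max_left _ _)
    · rw [d1, d2, abs_mul, abs_mul, abs_of_pos hli]
      exact (mul_le_mul_of_nonneg_left (mul_le_mul_of_nonneg_left
        ((hC₀ _ (hlt ξ hξ)).2.2.trans (hexp ξ hξ)) hli.le) hli.le).trans (le_max_right _ _)
  obtain ⟨s, ξ, -, -, he⟩ := exists_shift_eqOn hα0 hα1 hτ one_pos ha (h.solution.genSol hT.le) hw
    hL hwL
  exact ⟨s, ξ, he⟩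

/-- As long as the trajectory itself stays in `[-N, N]` it also solves the truncated equation, where
forward uniqueness applies; no bound on the base solution is needed. -/
theorem IsBase.eqOn_of_abs_le (hv : IsBase α A B φm φp N v) (hN : 0 ≤ N) (hα1 : α < 1)
    (hA : 0 < A) (hl : 0 < l) (hAl : A * l ^ 2 = τ) (hBl : B * l ^ α = 1) {s ξ T : ℝ}
    (hφ : GenSol α τ 1 (NonlocalTW.h φm φp) T φ)
    (he : EqOn φ (fun x => v ((x + s) / l)) (Iio ξ)) (hb : ∀ x < T, |φ x| ≤ N) :
    EqOn φ (fun x => v ((x + s) / l)) (Iio T) :=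
  GenSol.eqOn hα1 (by rw [← hAl]; positivity) zero_le_one (abs_hcut_sub_le hN)
    (hφ.congr_fun fun x hx => hcut_eq (hb x hx)) (hv.sol_comp hl hAl hBl s T) he

/-- A trajectory that ends at a finite point is unbounded. -/
theorem IsTrajectory.not_bounded {b M : ℝ} (h : IsTrajectory α φm φp τ (b : EReal) φ)
    (hα0 : 0 < α) (hα1 : α < 1) (hA : 0 < A) (hB : 0 ≤ B) (ha : 0 < slopeAt φm φp) (hl : 0 < l)
    (hAl : A * l ^ 2 = τ) (hBl : B * l ^ α = 1)
    (hbase : ∀ N, |φm| + 1 ≤ N → ∃ v, IsBase α A B φm φp N v) (hM : ∀ x < b, |φ x| ≤ M) :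
    False := by
  obtain ⟨v, hv⟩ := hbase (max (M + 1) (|φm| + 1)) (le_max_right _ _)
  set N := max (M + 1) (|φm| + 1) with hN
  have hN1 : |φm| + 1 ≤ N := le_max_right _ _
  have hMN : M < N := lt_of_lt_of_le (lt_add_one M) (le_max_left _ _)
  obtain ⟨s, ξ, he⟩ := hv.exists_eqOn_trajectory hN1 hα0 hα1 hA ha hl hAl hBl h
  have he' := hv.eqOn_of_abs_le (by linarith [abs_nonneg φm]) hα1 hA hl hAl hBl
    (h.solution.genSol le_rfl) he fun x hx => (hM x hx).trans hMN.le
  have hc : Continuous fun x => |v ((x + s) / l)| := by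
    have := hv.continuous
    fun_prop
  have hle : |v ((b + s) / l)| ≤ M := by
    refine le_of_tendsto (hc.continuousAt.continuousWithinAt (s := Iio b)).tendsto ?_
    filter_upwards [self_mem_nhdsWithin] with x hx
    have hx : x < b := hx
    show |v ((x + s) / l)| ≤ M
    rw [← show φ x = v ((x + s) / l) from he' hx]
    exact hM x hx
  -- The base solution is global, and the strict gap `M < N` keeps the truncation inactive slightly
  -- beyond `b`; it therefore extends the trajectory, against maximality.
  obtain ⟨ε, hε, hball⟩ := Metric.eventually_nhds_iff.1
    (hc.continuousAt.eventually (gt_mem_nhds (hle.trans_lt hMN)))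
  refine h.maximal (b + ε : ℝ) (fun x => v ((x + s) / l))
    (EReal.coe_lt_coe_iff.2 (by linarith)) (hv.isSolutionOn hα1 hA hB hl hAl hBl fun x hx => ?_) ?_
  · rcases lt_or_ge x b with hxb | hxb
    · rw [← show φ x = v ((x + s) / l) from he' hxb]
      exact (hM x hxb).trans hMN.le
    · refine (hball ?_).le
      rw [Real.dist_eq, abs_of_nonneg (by linarith)]
      linarith
  · rw [leftRay_coe]
    exact he'.symm

end

/-! ### Escape of the base solution and blow-down of trajectories. -/

/-- Up to `ξ`, the function `v` stays between `-N` and `N`, and it drops below `-N₀` and below minus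
its supremum. -/
def Escapes (N₀ N ξ : ℝ) (v : ℝ → ℝ) : Prop :=
  (∀ x ≤ ξ, |v x| < N) ∧ v ξ < -N₀ ∧ ∃ K, (∀ x ≤ ξ, v x ≤ K) ∧ K < -v ξ

/-- The limit at `-∞` lies above `u ξ`, so the minimum over `(-∞, ξ]` is attained on a compact
piece. Since `-u ξ` exceeds the upper bound `K`, this minimum is a record of the modulus, not only
of the value. -/
theorem exists_record {u : ℝ → ℝ} {l K ξ : ℝ} (hu : ContinuousOn u (Iic ξ))
    (hlim : Tendsto u atBot (𝓝 l)) (hl : u ξ < l) (hK : ∀ x ≤ ξ, u x ≤ K) (hKξ : K < -u ξ) :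
    ∃ x₁ ≤ ξ, u x₁ ≤ u ξ ∧ ∀ y ≤ x₁, |u y| ≤ -u x₁ := by
  obtain ⟨Y, hY⟩ := eventually_atBot.1 (hlim.eventually (lt_mem_nhds hl))
  have hYξ : Y ≤ ξ := by
    by_contra! hlt
    exact lt_irrefl _ (hY ξ hlt.le)
  obtain ⟨x₁, hx₁, hmin⟩ := isCompact_Icc.exists_isMinOn (nonempty_Icc.2 hYξ)
    (hu.mono fun x hx => hx.2)
  have h1 : u x₁ ≤ u ξ := hmin ⟨hYξ, le_rfl⟩
  refine ⟨x₁, hx₁.2, h1, fun y hy => abs_le.2 ⟨?_, ?_⟩⟩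
  · rw [neg_neg]
    rcases le_total y Y with h | h
    · exact h1.trans (hY y h).le
    · exact hmin ⟨h, hy.trans hx₁.2⟩
  · linarith [hK y (hy.trans hx₁.2)]

section

variable {α A B φm φp N τ l : ℝ} {b : EReal} {φ v : ℝ → ℝ}

/-- A trajectory passing through a large record value blows down. -/
theorem IsTrajectory.blowsDown_of_record (h : IsTrajectory α φm φp τ b φ) (hα0 : 0 < α)
    (hα1 : α < 1) (hA : 0 < A) (hB : 0 ≤ B) (ha : 0 < slopeAt φm φp) (hl : 0 < l)
    (hAl : A * l ^ 2 = τ) (hBl : B * l ^ α = 1)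
    (hbase : ∀ N, |φm| + 1 ≤ N → ∃ v, IsBase α A B φm φp N v) {N₀ x₁ : ℝ} (hN₀ : 1 ≤ N₀)
    (hrec : ∀ T x X P₀ u, GenSol α τ 1 (NonlocalTW.h φm φp) T u → x < T →
      (∀ y < X, |deriv u y| ≤ P₀) → (∀ y ≤ x, |u y| ≤ -u x) → N₀ ≤ -u x →
      τ * deriv (deriv u) x ≤ (u x) ^ 3 / 4)
    (hx₁ : (x₁ : EReal) < b) (h1 : ∀ y ≤ x₁, |φ y| ≤ -φ x₁) (hN : N₀ ≤ -φ x₁) :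
    BlowsDown b φ := by
  have hτ : 0 < τ := by rw [← hAl]; positivity
  obtain ⟨X, C, hL⟩ := h.exists_leaving
  have key : ∀ T : ℝ, (T : EReal) ≤ b → x₁ < T → ∀ x ∈ Ico x₁ T,
      deriv φ x ≤ 0 ∧ φ x ≤ -N₀ ∧ τ * deriv (deriv φ) x ≤ (φ x) ^ 3 / 4 := fun T hT hxT =>
    (h.solution.genSol hT).after_record hτ hN₀
      (fun x hx => hrec T x X C φ (h.solution.genSol hT) hx) hL.bd1 h1 hN hxT
  induction b using EReal.rec with
  | bot => exact absurd hx₁ not_lt_bot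
  | top =>
    -- A trajectory defined for all `ξ` would satisfy the cubic differential inequality forever.
    exfalso
    have hG : ∀ T : ℝ, GenSol α τ 1 (NonlocalTW.h φm φp) T φ := fun T => h.solution.genSol le_top
    have hk : ∀ x, x₁ ≤ x →
        deriv φ x ≤ 0 ∧ φ x ≤ -N₀ ∧ τ * deriv (deriv φ) x ≤ (φ x) ^ 3 / 4 := fun x hx =>
      key (x + 1) le_top (by linarith) x ⟨hx, by linarith⟩
    refine not_global_of_cubic (p := fun x => -φ x) (p' := fun x => -deriv φ x)
      (p'' := fun x => -deriv (deriv φ) x) (κ := 1 / (4 * τ)) (a := x₁) (by positivity)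
      (fun x _ => ((hG (x + 1)).hasDerivAt (by linarith)).neg)
      (fun x _ => ((hG (x + 1)).hasDerivAt_deriv (by linarith)).neg)
      (fun x hx => by linarith [(hk x hx).2.1]) (fun x hx => by linarith [(hk x hx).1])
      fun x hx => ?_
    have := (hk x hx).2.2
    rw [div_mul_eq_mul_div, div_le_iff₀ (by positivity)]
    nlinarith [this]
  | coe b =>
    have hx₁b : x₁ < b := EReal.coe_lt_coe_iff.1 hx₁
    have hG := h.solution.genSol (T := b) le_rfl
    have hk := key b le_rfl hx₁b
    have hanti : AntitoneOn φ (Ico x₁ b) := by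
      intro x hx y hy hxy
      exact le_of_hasDerivAt_nonpos hxy (fun z hz => hG.hasDerivAt (hz.2.trans_lt hy.2))
        fun z hz => (hk z ⟨hx.1.trans hz.1, hz.2.trans_lt hy.2⟩).1
    refine ⟨b, rfl, ?_⟩
    rw [tendsto_atBot]
    by_contra! hcon
    obtain ⟨M, hM⟩ := hcon
    have hge : ∀ x ∈ Ico x₁ b, M ≤ φ x := by
      intro x hx
      by_contra! hlt
      refine hM ?_
      filter_upwards [Ioo_mem_nhdsLT hx.2] with y hy
      exact not_lt.2 ((hanti hx ⟨hx.1.trans hy.1.le, hy.2⟩ hy.1.le).trans hlt.le)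
    -- Past the record the trajectory is monotone, so failure to tend to `-∞` gives a lower bound,
    -- hence a bounded trajectory with a finite end point.
    refine h.not_bounded (M := max (-φ x₁) (-M)) hα0 hα1 hA hB ha hl hAl hBl hbase fun x hx => ?_
    rcases le_total x x₁ with hxx | hxx
    · exact (h1 x hxx).trans (le_max_left _ _)
    · have e1 := hge x ⟨hxx, hx⟩
      have e2 := (hk x ⟨hxx, hx⟩).2.1
      rw [abs_of_nonpos (by linarith)]
      exact le_trans (by linarith) (le_max_right _ _)

/-- If the base solution escapes, every trajectory blows down. -/
theorem IsBase.blowsDown (hv : IsBase α A B φm φp N v) (hN : |φm| + 1 ≤ N) (hα0 : 0 < α)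
    (hα1 : α < 1) (hA : 0 < A) (hB : 0 ≤ B) (ha : 0 < slopeAt φm φp) (hφm : 0 < φm) (hl : 0 < l)
    (hAl : A * l ^ 2 = τ) (hBl : B * l ^ α = 1)
    (hbase : ∀ N, |φm| + 1 ≤ N → ∃ v, IsBase α A B φm φp N v) {N₀ ξ : ℝ} (hN₀ : 1 ≤ N₀)
    (hrec : ∀ T x X P₀ u, GenSol α τ 1 (NonlocalTW.h φm φp) T u → x < T →
      (∀ y < X, |deriv u y| ≤ P₀) → (∀ y ≤ x, |u y| ≤ -u x) → N₀ ≤ -u x →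
      τ * deriv (deriv u) x ≤ (u x) ^ 3 / 4)
    (hesc : Escapes N₀ N ξ v) (h : IsTrajectory α φm φp τ b φ) : BlowsDown b φ := by
  obtain ⟨hE1, hE2, K, hE3, hE4⟩ := hesc
  have hτ : 0 < τ := by rw [← hAl]; positivity
  obtain ⟨s, ζ, he⟩ := hv.exists_eqOn_trajectory hN hα0 hα1 hA ha hl hAl hBl h
  set w : ℝ → ℝ := fun x => v ((x + s) / l) with hw
  set ξ' := ξ * l - s with hξ'
  have hle : ∀ x ≤ ξ', (x + s) / l ≤ ξ := fun x hx => by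
    rw [div_le_iff₀ hl]; linarith
  have hwξ : w ξ' = v ξ := by
    simp only [hw, hξ', sub_add_cancel, mul_div_cancel_right₀ _ hl.ne']
  have hwlim : Tendsto w atBot (𝓝 φm) :=
    hv.tendsto.comp ((tendsto_atBot_add_const_right _ s tendsto_id).atBot_div_const hl)
  have hwc : Continuous w := by
    have := hv.continuous
    fun_prop
  have hagree : ∀ T : ℝ, (T : EReal) ≤ b → (∀ x < T, |w x| ≤ N) → EqOn φ w (Iio T) := by
    intro T hT hb
    exact GenSol.eqOn_of_tendsto hα1 hτ zero_le_one (h.solution.genSol hT)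
      ((hv.sol_comp hl hAl hBl s T).congr_fun fun x hx => (hcut_eq (hb x hx)).symm)
      h.farField hwlim he
  -- If the trajectory ended before the escape point, it would coincide with the base solution up to
  -- its end and be bounded by `N`.
  have hξb : (ξ' : EReal) < b := by
    by_contra! hb
    induction b using EReal.rec with
    | bot => obtain ⟨T, hT⟩ := h.exists_real_lt; exact absurd hT not_lt_bot
    | top => exact absurd hb (not_le.2 (EReal.coe_lt_top _))
    | coe b =>
      have hb' : b ≤ ξ' := EReal.coe_le_coe_iff.1 hb
      have hwN : ∀ x < b, |w x| ≤ N := fun x hx => (hE1 _ (hle x (hx.le.trans hb'))).le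
      refine h.not_bounded (M := N) hα0 hα1 hA hB ha hl hAl hBl hbase fun x hx => ?_
      rw [hagree b le_rfl hwN hx]
      exact hwN x hx
  obtain ⟨ε, hε, hball⟩ := Metric.eventually_nhds_iff.1
    (hwc.abs.continuousAt.eventually (gt_mem_nhds (show |w ξ'| < N by
      rw [hwξ]; exact hE1 ξ le_rfl)))
  obtain ⟨T', hT'1, hT'2⟩ := exists_real_between hξb
  set T := min T' (ξ' + ε)
  have hξT : ξ' < T := lt_min hT'1 (by linarith)
  have hTb : (T : EReal) ≤ b := le_trans (EReal.coe_le_coe_iff.2 (min_le_left _ _)) hT'2.le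
  have heT : EqOn φ w (Iio T) := hagree T hTb fun x hx => by
    rcases le_or_gt x ξ' with hx' | hx'
    · exact (hE1 _ (hle x hx')).le
    · refine (hball ?_).le
      rw [Real.dist_eq, abs_of_pos (by linarith)]
      linarith [hx.trans_le (min_le_right T' (ξ' + ε))]
  have hφξ : φ ξ' = v ξ := (heT hξT).trans hwξ
  obtain ⟨x₁, hx₁, h1, h2⟩ := exists_record (u := φ) (K := K) (ξ := ξ')
    ((h.solution.genSol hTb).continuousOn.mono fun x hx => lt_of_le_of_lt hx hξT) h.farField
    (by rw [hφξ]; linarith) (fun x hx => by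
      rw [heT (hx.trans_lt hξT)]; exact hE3 _ (hle x hx)) (by rw [hφξ]; exact hE4)
  refine h.blowsDown_of_record hα0 hα1 hA hB ha hl hAl hBl hbase hN₀ hrec
    (lt_of_le_of_lt (EReal.coe_le_coe_iff.2 hx₁) hξb) h2 ?_
  rw [hφξ] at h1
  linarith

/-- If a trajectory blows down, the base solution escapes. -/
theorem IsTrajectory.exists_escapes (h : IsTrajectory α φm φp τ b φ) (hblow : BlowsDown b φ)
    (hα0 : 0 < α) (hα1 : α < 1) (hA : 0 < A) (ha : 0 < slopeAt φm φp) (hl : 0 < l)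
    (hAl : A * l ^ 2 = τ) (hBl : B * l ^ α = 1) (N₀ : ℝ) :
    ∃ N, |φm| + 1 ≤ N ∧ ∀ v, IsBase α A B φm φp N v → ∃ ξ, Escapes N₀ N ξ v := by
  obtain ⟨b, rfl, hlim⟩ := hblow
  have hG := h.solution.genSol (T := b) le_rfl
  obtain ⟨K, hK⟩ : ∃ K, ∀ x < b, φ x ≤ K := by
    have h0 := (tendsto_atBot.1 hlim 0)
    obtain ⟨c, hc, hcb⟩ := (mem_nhdsLT_iff_exists_Ioo_subset (a := b)).1 h0
    obtain ⟨c', hc1, hc2⟩ := exists_between (show c < b from hc)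
    obtain ⟨M, hM⟩ := exists_abs_le_of_tendsto_atBot hG.continuousOn h.farField hc2
    refine ⟨M, fun x hx => ?_⟩
    rcases le_total x c' with hx' | hx'
    · exact (le_abs_self _).trans (hM x hx')
    · exact (hcb ⟨hc1.trans_le hx', hx⟩).trans ((abs_nonneg _).trans (hM c' le_rfl))
  -- The level lies below both `-N₀` and `-K`, with `K` the upper bound of the trajectory, so the
  -- value at `ξ` meets the requirements of `Escapes`. The truncation height is chosen only
  -- afterwards.
  obtain ⟨ξ, hξ, hξb⟩ := ((tendsto_atBot.1 hlim (-(max N₀ K) - 1)).and self_mem_nhdsWithin).exists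
  obtain ⟨T, hξT, hTb⟩ := exists_between (show ξ < b from hξb)
  obtain ⟨M, hM⟩ := exists_abs_le_of_tendsto_atBot hG.continuousOn h.farField hTb
  refine ⟨max (M + 1) (|φm| + 1), le_max_right _ _, fun v hv => ?_⟩
  set N := max (M + 1) (|φm| + 1)
  have hMN : M < N := lt_of_lt_of_le (lt_add_one M) (le_max_left _ _)
  have hN1 : |φm| + 1 ≤ N := le_max_right _ _
  obtain ⟨s, ζ, he⟩ := hv.exists_eqOn_trajectory hN1 hα0 hα1 hA ha hl hAl hBl h
  have he' := hv.eqOn_of_abs_le (by linarith [abs_nonneg φm]) hα1 hA hl hAl hBl (hG.mono hTb.le) he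
    fun x hx => (hM x hx.le).trans hMN.le
  have hval : ∀ x ≤ (ξ + s) / l, x * l - s ≤ ξ ∧ v x = φ (x * l - s) := by
    intro x hx
    rw [le_div_iff₀ hl] at hx
    have h1 : x * l - s ≤ ξ := by linarith
    refine ⟨h1, ?_⟩
    rw [he' (h1.trans_lt hξT)]
    simp only [sub_add_cancel, mul_div_cancel_right₀ _ hl.ne']
  have hvξ : v ((ξ + s) / l) = φ ξ := (he' hξT).symm
  have hm1 := le_max_left N₀ K
  have hm2 := le_max_right N₀ K
  refine ⟨(ξ + s) / l, fun x hx => ?_, ?_, K, fun x hx => ?_, ?_⟩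
  · obtain ⟨h1, h2⟩ := hval x hx
    rw [h2]
    exact (hM _ (h1.trans hξT.le)).trans_lt hMN
  · rw [hvξ]; linarith
  · obtain ⟨h1, h2⟩ := hval x hx
    rw [h2]
    exact hK _ (h1.trans_lt hξb)
  · rw [hvξ]; linarith

end

theorem exists_isBase {α B φm φp N : ℝ} (hα0 : 0 < α) (hα1 : α < 1) (hB0 : 0 ≤ B)
    (hB : B < slopeAt φm φp) (hN : |φm| + 1 ≤ N) :
    ∃ v, IsBase α (slopeAt φm φp - B) B φm φp N v := by
  obtain ⟨v, -, hsol, hbd, X, hX⟩ := exists_base_family hα0 hα1 hB0 hB hN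
  refine ⟨v ⟨B, hB0, le_rfl⟩, hsol ⟨B, hB0, le_rfl⟩, fun T => ?_, X, hX _⟩
  obtain ⟨C, hC⟩ := hbd T
  exact ⟨C, hC _⟩

/-- Escaping is an open condition along a continuous family. -/
theorem eventually_escapes {P : Type*} [TopologicalSpace P] {φm N₀ N ξ C T : ℝ} {v : P → ℝ → ℝ}
    (hc : Continuous fun q : P × ℝ => v q.1 q.2)
    (hbd : ∀ p, ∀ x ≤ T, |v p x - φm| ≤ C * Real.exp x) (hN : |φm| + 1 ≤ N) {p₀ : P}
    (hE : Escapes N₀ N ξ (v p₀)) : ∀ᶠ p in 𝓝 p₀, Escapes N₀ N ξ (v p) := by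
  obtain ⟨h1, h2, K₀, h3, h4⟩ := hE
  have hK₀ : φm ≤ K₀ := by
    refine le_of_tendsto (tendsto_of_exp_bound (hbd p₀)) ?_
    filter_upwards [eventually_le_atBot ξ] with x hx using h3 x hx
  obtain ⟨K, hK1, hK2⟩ := exists_between h4
  have h0 : Tendsto (fun x => C * Real.exp x) atBot (𝓝 0) := by
    simpa using Real.tendsto_exp_atBot.const_mul C
  -- On the far left the exponential bound, uniform in the parameter, gives both inequalities at
  -- once; the remaining interval is compact.
  have hmin : 0 < min (1 / 2) (K - K₀) := lt_min (by norm_num) (by linarith)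
  obtain ⟨Y, hY⟩ := eventually_atBot.1
    ((h0.eventually (gt_mem_nhds hmin)).and (eventually_le_atBot T))
  have hfar : ∀ p, ∀ x ≤ Y, |v p x| < N ∧ v p x ≤ K := by
    intro p x hx
    have e1 := (hbd p x (hY x hx).2).trans_lt (hY x hx).1
    have e2 := e1.trans_le (min_le_left _ _)
    have e3 := e1.trans_le (min_le_right _ _)
    have e4 := abs_add_le (v p x - φm) φm
    rw [sub_add_cancel] at e4
    have e5 := le_abs_self (v p x - φm)
    constructor <;> linarith
  have hnear : ∀ᶠ p in 𝓝 p₀, ∀ x ∈ Icc Y ξ, |v p x| < N ∧ v p x < K := by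
    refine isCompact_Icc.eventually_forall_of_forall_eventually fun x hx => ?_
    refine (hc.abs.continuousAt.eventually (gt_mem_nhds (h1 x hx.2))).and
      (hc.continuousAt.eventually (gt_mem_nhds ((h3 x hx.2).trans_lt hK1)))
  have hcξ : Continuous fun p => v p ξ := hc.comp (by fun_prop : Continuous fun p : P => (p, ξ))
  filter_upwards [hnear, hcξ.continuousAt.eventually (gt_mem_nhds h2),
    hcξ.continuousAt.eventually (gt_mem_nhds (show v p₀ ξ < -K by linarith))] with p hp1 hp2 hp3
  refine ⟨fun x hx => ?_, hp2, K, fun x hx => ?_, by linarith⟩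
  · rcases le_total x Y with h | h
    · exact (hfar p x h).1
    · exact (hp1 x ⟨h, hx⟩).1
  · rcases le_total x Y with h | h
    · exact (hfar p x h).2
    · exact (hp1 x ⟨h, hx⟩).2.le

/-! ### The characteristic root as parameter, and the two conclusions. -/

/-- Taking the length scale `1 / r` with `r` the characteristic root normalises the growth rate at
`-∞` to `1`. -/
theorem rescale_identities {α a τ r : ℝ} (hr : 0 < r) (h : τ * r ^ 2 + r ^ α = a) :
    (a - r ^ α) * r⁻¹ ^ 2 = τ ∧ r ^ α * r⁻¹ ^ α = 1 := by
  constructor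
  · rw [← h]; field_simp; ring
  · rw [Real.inv_rpow hr.le, mul_inv_cancel₀ (Real.rpow_pos_of_pos hr α).ne']

/-- If the base solutions escape at the parameter `p₀`, all trajectories with nearby parameters
blow down. -/
theorem exists_delta_blowsDown {α φm φp p₀ A₀ : ℝ} (hα0 : 0 < α) (hα1 : α < 1) (hφm : 0 < φm)
    (hp₀ : 0 ≤ p₀) (hp₀a : p₀ < slopeAt φm φp) (hA₀ : 0 < A₀)
    (hesc : ∀ N₀, ∃ N, |φm| + 1 ≤ N ∧
      ∀ v, IsBase α (slopeAt φm φp - p₀) p₀ φm φp N v → ∃ ξ, Escapes N₀ N ξ v) :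
    ∃ δ > 0, ∀ τ r, A₀ ≤ τ → 0 < r → τ * r ^ 2 + r ^ α = slopeAt φm φp → |r ^ α - p₀| < δ →
      ∀ (b : EReal) (φ : ℝ → ℝ), IsTrajectory α φm φp τ b φ → BlowsDown b φ := by
  have ha : 0 < slopeAt φm φp := hp₀.trans_lt hp₀a
  -- The record threshold depends only on the lower bound `A₀` of `τ`, so it can be fixed before the
  -- truncation height and before `τ` itself.
  obtain ⟨N₀, hN₀, hrec⟩ := exists_record_bound φm φp hα0 hα1 hA₀ zero_le_one
  obtain ⟨N, hN, hescN⟩ := hesc N₀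
  set B₁ := (p₀ + slopeAt φm φp) / 2 with hB₁
  have hB₁0 : 0 ≤ B₁ := by rw [hB₁]; linarith
  have hB₁a : B₁ < slopeAt φm φp := by rw [hB₁]; linarith
  have hpB : p₀ ≤ B₁ := by rw [hB₁]; linarith
  obtain ⟨v, hc, hsol, hbd, X, hX⟩ := exists_base_family hα0 hα1 hB₁0 hB₁a hN
  have hbase : ∀ p : Icc 0 B₁, IsBase α (slopeAt φm φp - p) p φm φp N (v p) := fun p => by
    refine ⟨hsol p, fun T => ?_, X, hX p⟩
    obtain ⟨C, hC⟩ := hbd T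
    exact ⟨C, hC p⟩
  obtain ⟨ξ, hξ⟩ := hescN _ (hbase ⟨p₀, hp₀, hpB⟩)
  obtain ⟨C, hC⟩ := hbd 0
  obtain ⟨ε, hε, hball⟩ := Metric.eventually_nhds_iff.1
    (eventually_escapes hc (fun p x hx => (hC p x hx).1) hN hξ)
  -- As `B₁` is the midpoint of `p₀` and `a`, the second entry equals `B₁ - p₀` and keeps the
  -- parameter inside `[0, B₁]`.
  refine ⟨min ε (slopeAt φm φp - B₁), lt_min hε (by linarith), fun τ r hτ hr hroot hδ b φ h => ?_⟩
  have hB0 : 0 < r ^ α := Real.rpow_pos_of_pos hr α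
  have hδ1 := hδ.trans_le (min_le_left _ _)
  have hδ2 := hδ.trans_le (min_le_right _ _)
  have hBB : r ^ α ≤ B₁ := by
    have := (le_abs_self _).trans_lt hδ2
    rw [hB₁] at this ⊢
    linarith
  have hA : 0 < slopeAt φm φp - r ^ α := by linarith
  obtain ⟨e1, e2⟩ := rescale_identities hr hroot
  have hE := hball (y := ⟨r ^ α, hB0.le, hBB⟩) (by rw [Subtype.dist_eq, Real.dist_eq]; exact hδ1)
  exact (hbase ⟨r ^ α, hB0.le, hBB⟩).blowsDown hN hα0 hα1 hA hB0.le ha hφm (inv_pos.2 hr) e1 e2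
    (fun M hM => exists_isBase hα0 hα1 hB0.le (by linarith) hM) hN₀
    (fun T x X P₀ u hu hx h1 h2 h3 => hrec τ 1 T x X P₀ u hτ zero_le_one le_rfl hu hx h1 h2 h3)
    hE h

theorem continuous_symbol {α : ℝ} (hα0 : 0 < α) (τ : ℝ) :
    Continuous fun r : ℝ => τ * r ^ 2 + r ^ α := by
  have := Real.continuous_rpow_const hα0.le
  fun_prop

theorem exists_root {α a τ : ℝ} (hα0 : 0 < α) (ha : 0 < a) (hτ : 0 < τ) :
    ∃ r, 0 < r ∧ τ * r ^ 2 + r ^ α = a := by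
  have hM : (1 : ℝ) ≤ a / τ + 1 := by
    have : 0 < a / τ := by positivity
    linarith
  obtain ⟨r, hr, hroot⟩ := intermediate_value_Icc (a := 0) (b := a / τ + 1) (by linarith)
    (continuous_symbol hα0 τ).continuousOn (show a ∈ Icc _ _ from by
      refine ⟨by simp only [Real.zero_rpow hα0.ne']; norm_num; exact ha.le, ?_⟩
      have h1 : 0 ≤ (a / τ + 1) ^ α := by positivity
      have h2 : τ * (a / τ + 1) ≤ τ * (a / τ + 1) ^ 2 := by
        refine mul_le_mul_of_nonneg_left ?_ hτ.le
        nlinarith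
      have h3 : τ * (a / τ + 1) = a + τ := by field_simp
      show a ≤ τ * (a / τ + 1) ^ 2 + (a / τ + 1) ^ α
      linarith)
  refine ⟨r, lt_of_le_of_ne hr.1 fun h0 => ?_, hroot⟩
  rw [← h0] at hroot
  simp only [Real.zero_rpow hα0.ne'] at hroot
  norm_num at hroot
  exact ha.ne hroot

theorem rpow_root_lt {α a τ r : ℝ} (hτ : 0 < τ) (hr : 0 < r) (h : τ * r ^ 2 + r ^ α = a) :
    r ^ α < a := by
  have : 0 < τ * r ^ 2 := by positivity
  linarith

theorem exists_isTrajectory {α φm φp τ : ℝ} (hα0 : 0 < α) (hα1 : α < 1) (ha : 0 < slopeAt φm φp)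
    (hτ : 0 < τ) : ∃ (b : EReal) (φ : ℝ → ℝ), IsTrajectory α φm φp τ b φ := by
  obtain ⟨r, hr, hroot⟩ := exists_root hα0 ha hτ
  have hB := rpow_root_lt hτ hr hroot
  have hB0 : 0 < r ^ α := Real.rpow_pos_of_pos hr α
  obtain ⟨v, hv⟩ := exists_isBase (N := |φm| + 1) hα0 hα1 hB0.le hB le_rfl
  obtain ⟨e1, e2⟩ := rescale_identities hr hroot
  exact hv.exists_isTrajectory le_rfl hα1 (by linarith) hB0.le (inv_pos.2 hr) e1 e2

/-- As `τ → ∞` the characteristic root tends to `0`, hence so does the parameter `B = r^α`. At `B =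
0` the base solution escapes by conservation of energy, and escape persists for small `B`. -/
theorem exists_threshold {α φm φp : ℝ} (hα0 : 0 < α) (hα1 : α < 1) (hφm : 0 < φm) (hφp : φp < 0)
    (hpm : 0 < φp + φm) (ha : 0 < slopeAt φm φp) :
    ∃ τm : ℝ, 0 < τm ∧ ∀ τ : ℝ, τm < τ →
      ∀ (b : EReal) (φ : ℝ → ℝ), IsTrajectory α φm φp τ b φ → BlowsDown b φ := by
  obtain ⟨δ, hδ, hgood⟩ := exists_delta_blowsDown (p₀ := 0) hα0 hα1 hφm le_rfl ha one_pos
    fun N₀ => by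
      have h1 := le_max_left N₀ φm
      have h2 := le_max_right N₀ φm
      -- The level to be crossed is `-(max N₀ φm + 1)`: one unit beyond both `N₀` and the supremum
      -- `φm`, and one unit inside the truncation.
      refine ⟨max N₀ φm + 2, by rw [abs_of_pos hφm]; linarith, fun v hv => ?_⟩
      obtain ⟨X, hX⟩ := hv.neg
      obtain ⟨ξ, hξ1, hξ2⟩ := ode_escape (N' := max N₀ φm + 1) (by linarith) hφm hφp hpm
        (by linarith) (by linarith) hv.sol hv.tendsto hv.tendsto_deriv hX
      refine ⟨ξ, fun x hx => abs_lt.2 ⟨?_, ?_⟩, by linarith, φm, fun x hx => (hξ2 x hx).2,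
        by linarith⟩
      · linarith [(hξ2 x hx).1]
      · linarith [(hξ2 x hx).2]
  -- A root below `r₀` has parameter `r^α < δ`, and `τ r² ≤ a` forces this once `τ > a / r₀²`.
  set r₀ := δ ^ (1 / α) with hr₀
  have hr₀0 : 0 < r₀ := Real.rpow_pos_of_pos hδ _
  refine ⟨max 1 (slopeAt φm φp / r₀ ^ 2), lt_max_of_lt_left one_pos, fun τ hτ => ?_⟩
  have hτ1 : 1 < τ := (le_max_left _ _).trans_lt hτ
  have hτ2 : slopeAt φm φp / r₀ ^ 2 < τ := (le_max_right _ _).trans_lt hτ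
  obtain ⟨r, hr, hroot⟩ := exists_root hα0 ha (by linarith : 0 < τ)
  have hB0 : 0 < r ^ α := Real.rpow_pos_of_pos hr α
  refine hgood τ r hτ1.le hr hroot ?_
  rw [sub_zero, abs_of_pos hB0]
  have hrr : r < r₀ := by
    by_contra! hge
    rw [div_lt_iff₀ (by positivity)] at hτ2
    have : τ * r₀ ^ 2 ≤ τ * r ^ 2 := by gcongr
    linarith
  calc r ^ α < r₀ ^ α := Real.rpow_lt_rpow hr.le hrr hα0
    _ = δ := by rw [hr₀, ← Real.rpow_mul hδ.le, one_div, inv_mul_cancel₀ hα0.ne', Real.rpow_one]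

/-- The root of the characteristic equation depends continuously on `τ`. -/
theorem eventually_exists_root {α a τ₀ r₀ ε : ℝ} (hα0 : 0 < α) (hτ₀ : 0 < τ₀) (hr₀ : 0 < r₀)
    (h : τ₀ * r₀ ^ 2 + r₀ ^ α = a) (hε : 0 < ε) :
    ∀ᶠ τ in 𝓝 τ₀, ∃ r, 0 < r ∧ |r - r₀| ≤ ε ∧ τ * r ^ 2 + r ^ α = a := by
  have hmono : ∀ r s : ℝ, 0 < r → r < s → τ₀ * r ^ 2 + r ^ α < τ₀ * s ^ 2 + s ^ α := by
    intro r s hr hrs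
    have e1 : r ^ α < s ^ α := Real.rpow_lt_rpow hr.le hrs hα0
    have e2 : τ₀ * r ^ 2 ≤ τ₀ * s ^ 2 := by gcongr
    linarith
  set e := min ε (r₀ / 2) with he
  have he0 : 0 < e := lt_min hε (by linarith)
  have he1 : e ≤ ε := min_le_left _ _
  have he2 : e ≤ r₀ / 2 := min_le_right _ _
  have hlo : τ₀ * (r₀ - e) ^ 2 + (r₀ - e) ^ α < a := h ▸ hmono _ _ (by linarith) (by linarith)
  have hhi : a < τ₀ * (r₀ + e) ^ 2 + (r₀ + e) ^ α := h ▸ hmono _ _ hr₀ (by linarith)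
  have hc : ∀ r : ℝ, Continuous fun τ : ℝ => τ * r ^ 2 + r ^ α := fun r => by fun_prop
  filter_upwards [(hc _).continuousAt.eventually (gt_mem_nhds hlo),
    (hc _).continuousAt.eventually (lt_mem_nhds hhi)] with τ h1 h2
  obtain ⟨r, hr, hroot⟩ := intermediate_value_Icc (a := r₀ - e) (b := r₀ + e) (by linarith)
    (continuous_symbol hα0 τ).continuousOn (show a ∈ Icc _ _ from ⟨h1.le, h2.le⟩)
  refine ⟨r, by linarith [hr.1], abs_le.2 ⟨by linarith [hr.1], by linarith [hr.2]⟩, hroot⟩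

/-- Blow-down at `τ₀` makes the base solution escape there; escape is inherited by nearby
parameters, which depend continuously on `τ`, and in turn forces blow-down. -/
theorem isOpen_sigmaU {α φm φp : ℝ} (hα0 : 0 < α) (hα1 : α < 1) (hφm : 0 < φm)
    (ha : 0 < slopeAt φm φp) : IsOpen (sigmaU α φm φp) := by
  refine isOpen_iff_mem_nhds.2 fun τ₀ hτ₀ => ?_
  obtain ⟨hτ₀0, ⟨b, φ, hφ⟩, hall⟩ := hτ₀
  obtain ⟨r₀, hr₀, hroot⟩ := exists_root hα0 ha hτ₀0
  have hB := rpow_root_lt hτ₀0 hr₀ hroot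
  have hB0 : 0 < r₀ ^ α := Real.rpow_pos_of_pos hr₀ α
  obtain ⟨e1, e2⟩ := rescale_identities hr₀ hroot
  obtain ⟨δ, hδ, hgood⟩ := exists_delta_blowsDown (p₀ := r₀ ^ α) (A₀ := τ₀ / 2) hα0 hα1 hφm
    hB0.le hB (by linarith) fun N₀ =>
      hφ.exists_escapes (hall b φ hφ) hα0 hα1 (by linarith) ha (inv_pos.2 hr₀) e1 e2 N₀
  obtain ⟨ε, hε, hball⟩ := Metric.continuousAt_iff.1
    (Real.continuous_rpow_const hα0.le).continuousAt δ hδ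
  filter_upwards [lt_mem_nhds (show τ₀ / 2 < τ₀ by linarith),
    eventually_exists_root hα0 hτ₀0 hr₀ hroot (half_pos hε)] with τ hτ ⟨r, hr, hrr, hroot'⟩
  have hτ0 : 0 < τ := by linarith
  refine ⟨hτ0, exists_isTrajectory hα0 hα1 ha hτ0, hgood τ r hτ.le hr hroot' ?_⟩
  have := hball (x := r) (by rw [Real.dist_eq]; linarith)
  rwa [Real.dist_eq] at this

end NonlocalTW

theorem mainTheorem5 (α φm φp : ℝ) (hα0 : 0 < α) (hα1 : α < 1)
    (hpc : φp < -(φp + φm)) (hcm : -(φp + φm) < φm) (hpm : 0 < φp + φm) :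
    (∃ τm : ℝ, 0 < τm ∧ ∀ τ : ℝ, τm < τ →
      (∃ (b : EReal) (φ : ℝ → ℝ), NonlocalTW.IsTrajectory α φm φp τ b φ) ∧
      ∀ (b : EReal) (φ : ℝ → ℝ),
        NonlocalTW.IsTrajectory α φm φp τ b φ → NonlocalTW.BlowsDown b φ) ∧
    IsOpen (NonlocalTW.sigmaU α φm φp) := by
  have hφp : φp < 0 := by linarith
  have hφm : 0 < φm := by linarith
  have ha : 0 < NonlocalTW.slopeAt φm φp := by
    -- Both factors are positive: the second is `φm` plus `φp + φm`. Thus `φm` is linearly unstable,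
    -- which is all that existence and uniqueness require of the states.
    have h1 : NonlocalTW.slopeAt φm φp = (φm - φp) * (2 * φm + φp) := by
      unfold NonlocalTW.slopeAt NonlocalTW.waveSpeed
      ring
    rw [h1]
    exact mul_pos (by linarith) (by linarith)
  refine ⟨?_, NonlocalTW.isOpen_sigmaU hα0 hα1 hφm ha⟩
  obtain ⟨τm, hτm, h⟩ := NonlocalTW.exists_threshold hα0 hα1 hφm hφp hpm ha
  exact ⟨τm, hτm, fun τ hτ =>
    ⟨NonlocalTW.exists_isTrajectory hα0 hα1 ha (hτm.trans hτ), h τ hτ⟩⟩
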